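/- **Setting.** Let $M$ be a closed smooth three-dimensional manifold, $r\ge 2$ (possibly $r=\infty$), and $f\in\mathrm{Diff}^r(M)$ with periodic points $P,Q$ of (minimal) periods $\pi_P,\pi_Q$. Assume: (L) *Linearization.* There are $C^r$ charts around $P$ and $Q$, centred at $P$ and $Q$, and open neighbourhoods $U_P\ni P$, $U_Q\ni Q$ inside their domains, such that in these coordinates $$f^{\pi_P}(x,y,z)=(\tilde\lambda x,\tilde\sigma y,\tilde\zeta z)\ \text{ on } U_P,\qquad f^{\pi_Q}(x,y,z)=(\lambda x,\sigma y,\zeta z)\ \text{ on } U_Q .$$ (E) *Eigenvalues.* $|\tilde\lambda|<1<|\tilde\sigma|<|\tilde\zeta|$, $\ |\lambda|<|\zeta|<1<|\sigma|$, and, with $k=\log|\lambda|^{-1}/\log|\tilde\zeta|$, $$|\tilde\sigma\tilde\zeta|^{k}\,|\sigma\zeta^2|<1,\qquad |\tilde\sigma^{-3}\tilde\zeta|^{k}\,|\sigma^{-1}|<1,\qquad |\tilde\lambda\tilde\sigma|^{k}\,|\sigma|<1 .$$ Moreover $\log|\tilde\zeta|/\log|\lambda|$ is irrational. (So $P$ has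 index two and $Q$ index one.) (C) *Non-transverse heterodimensional cycle.* There are $N_1,N_2\ge 1$ and points $X\in W^u_{loc}(Q)$ with $f^{N_1}(X)\in W^s_{loc}(P)$, and $Y\in W^u_{loc}(P)$ with $f^{N_2}(Y)\in W^s_{loc}(Q)$, with coordinates $X=(0,1,0)$, $f^{N_2}(Y)=(1,0,1)$ in $U_Q$ and $f^{N_1}(X)=(1,0,0)$, $Y=(0,1,1)$ in $U_P$. The intersection of $W^u(Q)$ and $W^s(P)$ at $f^{N_1}(X)$ is quasi-transverse (the tangent lines span a plane), and that of $W^u(P)$ and $W^s(Q)$ at $f^{N_2}(Y)$ is not transverse. Here $W^s_{loc}$ (resp. $W^u_{loc}$) consists of the points whose forward (resp. backward) orbit under $f^{\pi}$, with $\pi$ the period, stays in the linearizing neighbourhood and converges to the periodic point. (T) *Transitions.* In the charts, near $X$ and $Y$ respectively, $$f^{N_1}(x,1+y,z)=(1+\alpha_1x+\alpha_2y+\alpha_3z+\tilde H_1,\ \beta_1x+\beta_2y+\beta_3z+\tilde H_2,\ \gamma_1x+\gamma_2y+\gamma_3z+\tilde H_3),$$ $$f^{N_2}(x,1+y,1+z)=(1+a_1x+a_2y+a_3z+H_1,\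 b_1x+b_2y^2+b_3z^2+b_4yz+H_2,\ 1+c_1x+c_2y+c_3z+H_3),$$ where $\tilde H_i,H_i$ vanish at $0$ together with their first derivatives, $\partial_{yy}H_2(0)=\partial_{zz}H_2(0)=\partial_{yz}H_2(0)=0$, and $$\beta_3=\gamma_2=\gamma_3=0,\quad c_3=0,\quad b_2b_3\ne0,\quad \gamma_1a_3>0,\quad a_2\neq 0 .$$ **Theorem 1.2.** Under these assumptions there are $\epsilon>0$ and a six-parameter family $\{f_{\mu,\nu}\}_{\mu,\nu\in[-\epsilon,\epsilon]^3}\subset\mathrm{Diff}^r(M)$, of class $C^r$ jointly in the parameters and the point, with $f_{\mathbf 0,\mathbf 0}=f$, which coincides with $f$ near the orbits of $P$ and $Q$ and which in the charts satisfies $f^{N_1}_{\mu,\nu}=f^{N_1}+\nu$ near $X$ and $f^{N_2}_{\mu,\nu}=f^{N_2}+\mu$ near $Y$, such that the following holds. For every $\xi>0$ there are * $C^r$ coordinate changes $\Psi_k$, i.e. $C^r$ diffeomorphisms from open subsets of $\mathbb R^3$ onto open subsets of $M$, the domain of $\Psi_k$ containing any given compact set $K\subset\mathbb R^3$ for all large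 $k$; * reparametrizations $\mu_k:\mathbb R\to\mathbb R^3$ (injective $C^r$ curves with non-vanishing derivative) and parameters $\nu_k\in\mathbb R^3$; * natural numbers $m_k,n_k\to\infty$; such that, for all compact $I\subset\mathbb R$, $K\subset\mathbb R^3$ and all large $k$, the renormalized return map $$F_{\mu_k(\bar\mu),\nu_k}(\bar{\mathbf x})=\Psi_k^{-1}\circ f_{\mu_k(\bar\mu),\nu_k}^{\,N_2+\pi_Pm_k+N_1+\pi_Qn_k}\circ\Psi_k(\bar{\mathbf x})$$ is well defined for $(\bar\mu,\bar{\mathbf x})\in I\times K$, and: 1. uniformly on compact sets of $(\bar\mu,\bar{\mathbf x})\in\mathbb R\times\mathbb R^3$, $(\mu_k(\bar\mu),\nu_k)\to(\mathbf 0,\mathbf 0)$ and $\Psi_k(\bar{\mathbf x})$ converges to the tangency point $f^{N_2}(Y)$; 2. as maps of $(\bar\mu,\bar{\mathbf x})$, the $F_{\mu_k(\bar\mu),\nu_k}$ converge in the $C^r$ topology on compact sets to a one-parameter family which is conjugate, by a linear isomorphism of $\mathbb R^3$ and a rescaling $\mu=\tau\bar\mu$ ($\tau\ne0$) of the parameter,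 to $$G_\mu(x,y,z)=(\xi x+y,\ \mu+y^2+\kappa_1x^2+\kappa_2xy,\ y),\qquad \kappa_1=\frac{\xi^2a_2^2b_3}{a_3^2b_2},\quad \kappa_2=\frac{\xi a_2b_4}{a_3b_2}.$$ -/

import Mathlib

open Set Filter Topology Function
open scoped Manifold ContDiff

/-- Three-dimensional Euclidean space, with coordinates `x = v 0`, `y = v 1`, `z = v 2`. -/
abbrev E3 : Type := EuclideanSpace ℝ (Fin 3)

/-- The coordinate vectors of `E3`. -/
noncomputable def axis (i : Fin 3) : E3 := EuclideanSpace.single i 1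

/-- The parameter cube `[-ε, ε]³`. -/
def paramCube (ε : ℝ) : Set E3 := {μ | ∀ i, |μ i| ≤ ε}

/-- The Hénon-like family
`G_{ξ,μ,κ₁,κ₂}(x,y,z) = (ξ x + y, μ + y² + κ₁ x² + κ₂ x y, y)`. -/
noncomputable def henonLike (ξ μ κ₁ κ₂ : ℝ) (v : E3) : E3 :=
  !₂[ξ * v 0 + v 1, μ + v 1 ^ 2 + κ₁ * v 0 ^ 2 + κ₂ * v 0 * v 1, v 1]

/-- Convergence in the `C^r` topology on compact sets: near each compact set `F k` is eventually
of class `C^r`, and all derivatives of order at most `r` converge uniformly on it. -/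
def TendstoCr {A B : Type*} [NormedAddCommGroup A] [NormedSpace ℝ A]
    [NormedAddCommGroup B] [NormedSpace ℝ B] (r : ℕ∞) (F : ℕ → A → B) (G : A → B) : Prop :=
  ContDiff ℝ r G ∧ ∀ K : Set A, IsCompact K →
    (∀ᶠ k in atTop, ∀ p ∈ K, ContDiffAt ℝ r (F k) p) ∧
    ∀ j : ℕ, (j : ℕ∞) ≤ r →
      TendstoUniformlyOn (fun k => iteratedFDeriv ℝ j (F k)) (iteratedFDeriv ℝ j G) atTop K

section Dynamics

variable {M : Type*} [TopologicalSpace M]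

/-- The local stable set of a fixed point `p` of `g` in `U`: the points whose forward orbit
stays in `U` and converges to `p`. -/
def localStable (g : M → M) (p : M) (U : Set M) : Set M :=
  {q | (∀ j : ℕ, g^[j] q ∈ U) ∧ Tendsto (fun j : ℕ => g^[j] q) atTop (𝓝 p)}

variable [ChartedSpace E3 M]

/-- A `C^r` chart around `p`, together with an open neighbourhood `dom` of `p` on which, in the
coordinates of the chart, `g` is the map `(x,y,z) ↦ (l₁ x, l₂ y, l₃ z)`. -/
structure LinearizingChart (r : ℕ∞) (g : M → M) (p : M) (l₁ l₂ l₃ : ℝ) where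
  chart : OpenPartialHomeomorph M E3
  chart_mem : chart ∈ IsManifold.maximalAtlas (𝓡 3) r M
  dom : Set M
  isOpen_dom : IsOpen dom
  dom_subset : dom ⊆ chart.source
  mem_dom : p ∈ dom
  chart_center : chart p = 0
  linear : ∀ q ∈ dom, g q ∈ chart.source ∧
    chart (g q) = !₂[l₁ * chart q 0, l₂ * chart q 1, l₃ * chart q 2]

/-- The map `h` written in the charts `φ` (at the source) and `ψ` (at the target). -/
def inCharts (φ ψ : OpenPartialHomeomorph M E3) (h : M → M) : E3 → E3 :=
  fun v => ψ (h (φ.symm v))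

/-- The non-transverse heterodimensional cycle of the saddles `P` (index two) and `Q` (index one),
seen in linearizing charts.  In the chart at `P` the local stable manifold is the `x`-axis and
the local unstable manifold is the plane `x = 0`; in the chart at `Q` the local unstable manifold
is the `y`-axis and the local stable manifold is the plane `y = 0`.
The point `X` of `W^u_loc(Q)` is sent by `f^{N₁}` into `W^s_loc(P)`, and the point `Y` of
`W^u_loc(P)` is sent by `f^{N₂}` into `W^s_loc(Q)`. -/
structure IsNonTransverseCycle {r : ℕ∞} (f : M ≃ₘ^r⟮𝓡 3, 𝓡 3⟯ M) (P Q : M)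
    {lam' sig' zet' lam sig zet : ℝ}
    (cP : LinearizingChart r f^[minimalPeriod f P] P lam' sig' zet')
    (cQ : LinearizingChart r f^[minimalPeriod f Q] Q lam sig zet)
    (X Y : M) (N₁ N₂ : ℕ) : Prop where
  N₁_pos : 0 < N₁
  N₂_pos : 0 < N₂
  X_mem : X ∈ localStable (f.symm)^[minimalPeriod f Q] Q cQ.dom
  X_coord : cQ.chart X = !₂[0, 1, 0]
  fX_mem : f^[N₁] X ∈ localStable f^[minimalPeriod f P] P cP.dom
  fX_coord : cP.chart (f^[N₁] X) = !₂[1, 0, 0]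
  Y_mem : Y ∈ localStable (f.symm)^[minimalPeriod f P] P cP.dom
  Y_coord : cP.chart Y = !₂[0, 1, 1]
  fY_mem : f^[N₂] Y ∈ localStable f^[minimalPeriod f Q] Q cQ.dom
  fY_coord : cQ.chart (f^[N₂] Y) = !₂[1, 0, 1]
  /-- Quasi-transversality: the tangent lines of `W^s(P)` and `W^u(Q)` at `f^{N₁}(X)` span
  a space of dimension two. -/
  quasiTransverse :
    Module.finrank ℝ ↥(Submodule.span ℝ {axis 0} ⊔ (Submodule.span ℝ {axis 1}).map
      (fderiv ℝ (inCharts cQ.chart cP.chart f^[N₁]) !₂[0, 1, 0] : E3 →ₗ[ℝ] E3)) = 2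
  /-- Tangency: the tangent planes of `W^u(P)` and `W^s(Q)` at `f^{N₂}(Y)` do not span. -/
  nonTransverse :
    (Submodule.span ℝ {axis 1, axis 2}).map
      (fderiv ℝ (inCharts cP.chart cQ.chart f^[N₂]) !₂[0, 1, 1] : E3 →ₗ[ℝ] E3) ⊔
      Submodule.span ℝ {axis 0, axis 2} ≠ ⊤

/-- `T(x, 1 + y, z) = (1 + α₁x + α₂y + α₃z + H₁, β₁x + β₂y + β₃z + H₂, γ₁x + γ₂y + γ₃z + H₃)`,
where each `Hᵢ` vanishes at `0` together with its first derivatives. -/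
def HasExpansionAtX (T : E3 → E3) (α₁ α₂ α₃ β₁ β₂ β₃ γ₁ γ₂ γ₃ : ℝ) : Prop :=
  let H : E3 → E3 := fun v => T (!₂[0, 1, 0] + v) -
    !₂[1 + α₁ * v 0 + α₂ * v 1 + α₃ * v 2,
       β₁ * v 0 + β₂ * v 1 + β₃ * v 2,
       γ₁ * v 0 + γ₂ * v 1 + γ₃ * v 2]
  H 0 = 0 ∧ HasFDerivAt H (0 : E3 →L[ℝ] E3) 0

/-- `T(x, 1 + y, 1 + z) = (1 + a₁x + a₂y + a₃z + H₁, b₁x + b₂y² + b₃z² + b₄yz + H₂,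
1 + c₁x + c₂y + c₃z + H₃)`, where each `Hᵢ` vanishes at `0` together with its first derivatives,
and the second derivatives of `H₂` in `yy`, `zz` and `yz` vanish at `0` as well. -/
def HasExpansionAtY (T : E3 → E3) (a₁ a₂ a₃ b₁ b₂ b₃ b₄ c₁ c₂ c₃ : ℝ) : Prop :=
  let H : E3 → E3 := fun v => T (!₂[0, 1, 1] + v) -
    !₂[1 + a₁ * v 0 + a₂ * v 1 + a₃ * v 2,
       b₁ * v 0 + b₂ * v 1 ^ 2 + b₃ * v 2 ^ 2 + b₄ * v 1 * v 2,
       1 + c₁ * v 0 + c₂ * v 1 + c₃ * v 2]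
  H 0 = 0 ∧ HasFDerivAt H (0 : E3 →L[ℝ] E3) 0 ∧
    iteratedFDeriv ℝ 2 (fun v => H v 1) 0 ![axis 1, axis 1] = 0 ∧
    iteratedFDeriv ℝ 2 (fun v => H v 1) 0 ![axis 2, axis 2] = 0 ∧
    iteratedFDeriv ℝ 2 (fun v => H v 1) 0 ![axis 1, axis 2] = 0

/-- A six-parameter family of `C^r` diffeomorphisms, `C^r` jointly in the point and in the
parameters `μ, ν ∈ [-ε, ε]³`, that starts at `f`, coincides with `f` near the orbits of `P` and
`Q`, and whose parameters `ν` and `μ` translate, in the charts at `P` and `Q`, the transitions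
`f^{N₁}` near `X` and `f^{N₂}` near `Y`. -/
structure IsUnfolding {r : ℕ∞} (f : M ≃ₘ^r⟮𝓡 3, 𝓡 3⟯ M) (P Q : M)
    (φP φQ : OpenPartialHomeomorph M E3) (X Y : M) (N₁ N₂ : ℕ)
    (ε : ℝ) (F : E3 → E3 → (M ≃ₘ^r⟮𝓡 3, 𝓡 3⟯ M)) : Prop where
  base : F 0 0 = f
  smooth : ContMDiffOn (𝓘(ℝ, E3 × E3).prod (𝓡 3)) (𝓡 3) r
    (fun q : (E3 × E3) × M => F q.1.1 q.1.2 q.2) ((paramCube ε ×ˢ paramCube ε) ×ˢ univ)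
  eq_near_saddles : ∃ W : Set M, IsOpen W ∧ (∀ i : ℕ, f^[i] P ∈ W ∧ f^[i] Q ∈ W) ∧
    ∀ μ ∈ paramCube ε, ∀ ν ∈ paramCube ε, ∀ q ∈ W, F μ ν q = f q
  unfold_X : ∃ V ∈ 𝓝 X, ∀ μ ∈ paramCube ε, ∀ ν ∈ paramCube ε, ∀ q ∈ V,
    f^[N₁] q ∈ φP.source ∧ (F μ ν)^[N₁] q ∈ φP.source ∧
      φP ((F μ ν)^[N₁] q) = φP (f^[N₁] q) + ν
  unfold_Y : ∃ V ∈ 𝓝 Y, ∀ μ ∈ paramCube ε, ∀ ν ∈ paramCube ε, ∀ q ∈ V,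
    f^[N₂] q ∈ φQ.source ∧ (F μ ν)^[N₂] q ∈ φQ.source ∧
      φQ ((F μ ν)^[N₂] q) = φQ (f^[N₂] q) + μ

end Dynamics

/-- `C^r` convergence at a point, formulated as continuous convergence of all derivatives. -/
structure TendstoCrAt {A B : Type*} [NormedAddCommGroup A] [NormedSpace ℝ A]
    [NormedAddCommGroup B] [NormedSpace ℝ B] (r : ℕ∞) (F : ℕ → A → B) (G : A → B) (x : A) :
    Prop where
  contDiffAt : ∀ᶠ q : ℕ × A in atTop ×ˢ 𝓝 x, ContDiffAt ℝ r (F q.1) q.2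
  tendsto : ∀ j : ℕ, (j : ℕ∞) ≤ r →
    Tendsto (fun q : ℕ × A => iteratedFDeriv ℝ j (F q.1) q.2) (atTop ×ˢ 𝓝 x)
      (𝓝 (iteratedFDeriv ℝ j G x))

section

variable {A : Type*} [TopologicalSpace A]

/-- Continuous convergence at all points implies uniform convergence on compact sets. -/
theorem tendstoUniformlyOn_of_tendsto_prod {β : Type*} [UniformSpace β]
    {F : ℕ → A → β} {G : A → β} (hG : Continuous G)
    (h : ∀ x, Tendsto (fun q : ℕ × A => F q.1 q.2) (atTop ×ˢ 𝓝 x) (𝓝 (G x)))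
    {K : Set A} (hK : IsCompact K) : TendstoUniformlyOn F G atTop K := by
  have h1 : TendstoLocallyUniformly F G atTop := by
    rw [tendstoLocallyUniformly_iff_forall_tendsto]
    intro x
    have h2 : Tendsto (fun q : ℕ × A => G q.2) (atTop ×ˢ 𝓝 x) (𝓝 (G x)) :=
      (hG.tendsto x).comp tendsto_snd
    exact (h2.prodMk_nhds (h x)).mono_right (nhds_le_uniformity (G x))
  exact (tendstoLocallyUniformlyOn_iff_tendstoUniformlyOn_of_compact hK).1
    h1.tendstoLocallyUniformlyOn

theorem eventually_atTop_forall_mem_compact {P : ℕ → A → Prop} {K : Set A} (hK : IsCompact K)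
    (h : ∀ x ∈ K, ∀ᶠ q : ℕ × A in atTop ×ˢ 𝓝 x, P q.1 q.2) :
    ∀ᶠ k in atTop, ∀ p ∈ K, P k p := by
  have h1 : ∀ᶠ q : A × ℕ in 𝓝ˢ K ×ˢ atTop, P q.2 q.1 := by
    rw [hK.nhdsSet_prod_eq_biSup]
    simp only [eventually_iSup]
    intro x hx
    have := h x hx
    rw [prod_comm, eventually_map] at this
    exact this
  obtain ⟨pa, ha, pb, hb, hab⟩ := eventually_prod_iff.1 h1
  exact hb.mono fun k hk p hp => hab (subset_of_mem_nhdsSet ha hp) hk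

theorem eventually_prod_eventually_nhds {P : ℕ → A → Prop} {x : A}
    (h : ∀ᶠ q : ℕ × A in atTop ×ˢ 𝓝 x, P q.1 q.2) :
    ∀ᶠ q : ℕ × A in atTop ×ˢ 𝓝 x, ∀ᶠ y in 𝓝 q.2, P q.1 y := by
  obtain ⟨pa, ha, pb, hb, hab⟩ := eventually_prod_iff.1 h
  exact eventually_prod_iff.2 ⟨pa, ha, fun y => ∀ᶠ z in 𝓝 y, pb z, hb.eventually_nhds,
    fun {k} hk {y} hy => hy.mono fun z hz => hab hk hz⟩

end

section

variable {A B C : Type*} [NormedAddCommGroup A] [NormedSpace ℝ A]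
  [NormedAddCommGroup B] [NormedSpace ℝ B] [NormedAddCommGroup C] [NormedSpace ℝ C] {r : ℕ∞}

theorem tendstoCr_of_tendstoCrAt {F : ℕ → A → B} {G : A → B} (hG : ContDiff ℝ r G)
    (h : ∀ x, TendstoCrAt r F G x) : TendstoCr r F G := by
  refine ⟨hG, fun K hK => ⟨eventually_atTop_forall_mem_compact hK fun x _ => (h x).contDiffAt,
    fun j hj => ?_⟩⟩
  exact tendstoUniformlyOn_of_tendsto_prod
    (F := fun k => iteratedFDeriv ℝ j (F k))
    (hG.continuous_iteratedFDeriv (by exact_mod_cast hj)) (fun x => (h x).tendsto j hj) hK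

theorem TendstoCrAt.congr {F F' : ℕ → A → B} {G : A → B} {x : A} (h : TendstoCrAt r F G x)
    (he : ∀ᶠ q : ℕ × A in atTop ×ˢ 𝓝 x, F' q.1 q.2 = F q.1 q.2) : TendstoCrAt r F' G x := by
  have he' := eventually_prod_eventually_nhds (P := fun k y => F' k y = F k y) he
  refine ⟨?_, fun j hj => ?_⟩
  · filter_upwards [he', h.contDiffAt] with q h1 h2
    exact h2.congr_of_eventuallyEq h1
  · refine (h.tendsto j hj).congr' ?_
    filter_upwards [he'] with q h1
    exact (Filter.EventuallyEq.iteratedFDeriv ℝ h1 j).self_of_nhds.symm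

theorem TendstoCrAt.of_contDiff {G : A → B} (hG : ContDiff ℝ r G) (x : A) :
    TendstoCrAt r (fun _ => G) G x :=
  ⟨Eventually.of_forall fun _ => hG.contDiffAt, fun _ hj =>
    ((hG.continuous_iteratedFDeriv (by exact_mod_cast hj)).tendsto x).comp tendsto_snd⟩

theorem TendstoCrAt.tendsto_apply {F : ℕ → A → B} {G : A → B} {x : A} (h : TendstoCrAt r F G x) :
    Tendsto (fun q : ℕ × A => F q.1 q.2) (atTop ×ˢ 𝓝 x) (𝓝 (G x)) := by
  have h0 := h.tendsto 0 (by simp)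
  have h1 := ((continuousMultilinearCurryFin0 ℝ A B).continuous.tendsto _).comp h0
  simpa [Function.comp_def] using h1

theorem TendstoCrAt.add {F F' : ℕ → A → B} {G G' : A → B} {x : A} (h : TendstoCrAt r F G x)
    (h' : TendstoCrAt r F' G' x) (hG : ContDiffAt ℝ r G x) (hG' : ContDiffAt ℝ r G' x) :
    TendstoCrAt r (fun k y => F k y + F' k y) (fun y => G y + G' y) x := by
  refine ⟨?_, fun j hj => ?_⟩
  · filter_upwards [h.contDiffAt, h'.contDiffAt] with q h1 h2 using h1.add h2
  · have hj' : (j : WithTop ℕ∞) ≤ r := by exact_mod_cast hj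
    have e := fun_iteratedFDeriv_add_apply (hG.of_le hj') (hG'.of_le hj')
    rw [e]
    refine ((h.tendsto j hj).add (h'.tendsto j hj)).congr' ?_
    filter_upwards [h.contDiffAt, h'.contDiffAt] with q h1 h2
    exact (fun_iteratedFDeriv_add_apply (h1.of_le hj') (h2.of_le hj')).symm

theorem TendstoCrAt.comp {R : ℕ → B → C} {R' : B → C} {W : ℕ → A → B} {W' : A → B} {x : A}
    (hR : TendstoCrAt r R R' (W' x)) (hW : TendstoCrAt r W W' x)
    (hR' : ContDiffAt ℝ r R' (W' x)) (hW' : ContDiffAt ℝ r W' x) :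
    TendstoCrAt r (fun k y => R k (W k y)) (fun y => R' (W' y)) x := by
  have hlim : Tendsto (fun q : ℕ × A => (q.1, W q.1 q.2)) (atTop ×ˢ 𝓝 x)
      (atTop ×ˢ 𝓝 (W' x)) := tendsto_fst.prodMk hW.tendsto_apply
  have hRc := hlim.eventually hR.contDiffAt
  refine ⟨?_, fun j hj => ?_⟩
  · filter_upwards [hRc, hW.contDiffAt] with q h1 h2
    exact ContDiffAt.comp q.2 h1 h2
  · have hj' : (j : WithTop ℕ∞) ≤ r := by exact_mod_cast hj
    have e := iteratedFDeriv_comp hR' hW' hj'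
    have e1 : Tendsto (fun q : ℕ × A => (ftaylorSeries ℝ (R q.1) (W q.1 q.2)).taylorComp
        (ftaylorSeries ℝ (W q.1) q.2) j) (atTop ×ˢ 𝓝 x)
        (𝓝 ((ftaylorSeries ℝ R' (W' x)).taylorComp (ftaylorSeries ℝ W' x) j)) := by
      unfold FormalMultilinearSeries.taylorComp
      refine tendsto_finsetSum _ fun c _ => ?_
      have hb : Tendsto (fun q : ℕ × A => c.compAlongOrderedFinpartitionL ℝ A B C
          (iteratedFDeriv ℝ c.length (R q.1) (W q.1 q.2))) (atTop ×ˢ 𝓝 x)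
          (𝓝 (c.compAlongOrderedFinpartitionL ℝ A B C
            (iteratedFDeriv ℝ c.length R' (W' x)))) :=
        ((c.compAlongOrderedFinpartitionL ℝ A B C).continuous.tendsto _).comp
          ((hR.tendsto c.length (le_trans (by exact_mod_cast c.length_le) hj)).comp hlim)
      have hp : Tendsto (fun (q : ℕ × A) (i : Fin c.length) =>
          iteratedFDeriv ℝ (c.partSize i) (W q.1) q.2) (atTop ×ˢ 𝓝 x)
          (𝓝 fun i => iteratedFDeriv ℝ (c.partSize i) W' x) :=
        tendsto_pi_nhds.2 fun i =>
          hW.tendsto _ (le_trans (by exact_mod_cast c.partSize_le i) hj)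
      exact (ContinuousEval.continuous_eval.tendsto _).comp (hb.prodMk_nhds hp)
    change Tendsto (fun q : ℕ × A => iteratedFDeriv ℝ j (R q.1 ∘ W q.1) q.2) _
      (𝓝 (iteratedFDeriv ℝ j (R' ∘ W') x))
    rw [e]
    refine e1.congr' ?_
    filter_upwards [hRc, hW.contDiffAt] with q h1 h2
    exact (iteratedFDeriv_comp h1 h2 hj').symm

end

section

variable {E F : Type*} [NormedAddCommGroup E] [NormedSpace ℝ E]
  [NormedAddCommGroup F] [NormedSpace ℝ F] {r : ℕ∞}

/-- If the derivatives converge to zero and so do the values at the origin, then so do all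
values. -/
theorem tendsto_zero_of_tendsto_fderiv_zero [ProperSpace E] {R : ℕ → E → F}
    (hd : ∀ w, ∀ᶠ q : ℕ × E in atTop ×ˢ 𝓝 w, DifferentiableAt ℝ (R q.1) q.2)
    (hf : ∀ w, Tendsto (fun q : ℕ × E => ‖fderiv ℝ (R q.1) q.2‖) (atTop ×ˢ 𝓝 w) (𝓝 0))
    (h0 : Tendsto (fun k => R k 0) atTop (𝓝 0)) (w : E) :
    Tendsto (fun q : ℕ × E => R q.1 q.2) (atTop ×ˢ 𝓝 w) (𝓝 0) := by
  rw [tendsto_zero_iff_norm_tendsto_zero, Metric.tendsto_nhds]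
  intro ε hε
  set ρ := ‖w‖ + 1 with hρ
  have hρ0 : 0 < ρ := by positivity
  have h1 : ∀ᶠ k in atTop, ∀ y ∈ Metric.closedBall (0 : E) ρ,
      DifferentiableAt ℝ (R k) y ∧ ‖fderiv ℝ (R k) y‖ < ε / (2 * ρ) := by
    refine eventually_atTop_forall_mem_compact (isCompact_closedBall 0 ρ) fun x _ => ?_
    exact (hd x).and ((hf x).eventually (gt_mem_nhds (by positivity)))
  have h2 : ∀ᶠ k in atTop, ‖R k 0‖ < ε / 2 := by
    have := h0.norm
    rw [norm_zero] at this
    exact this.eventually (gt_mem_nhds (by positivity))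
  have h3 : ∀ᶠ y in 𝓝 w, y ∈ Metric.closedBall (0 : E) ρ := by
    refine mem_of_superset (Metric.isOpen_ball.mem_nhds (?_ : w ∈ Metric.ball (0 : E) ρ))
      Metric.ball_subset_closedBall
    simp [hρ]
  filter_upwards [(h1.and h2).prod_mk h3] with q hq
  obtain ⟨⟨hq1, hq2⟩, hq3⟩ := hq
  have hz : (0 : E) ∈ Metric.closedBall (0 : E) ρ := by simp [hρ0.le]
  have := (convex_closedBall (0 : E) ρ).norm_image_sub_le_of_norm_fderiv_le
    (fun y hy => (hq1 y hy).1) (fun y hy => (hq1 y hy).2.le) hz hq3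
  have h4 : ‖q.2 - 0‖ ≤ ρ := by simpa using hq3
  have h5 : ε / (2 * ρ) * ‖q.2 - 0‖ ≤ ε / 2 := by
    calc ε / (2 * ρ) * ‖q.2 - 0‖ ≤ ε / (2 * ρ) * ρ := by gcongr
      _ = ε / 2 := by field_simp
  have h6 : ‖R q.1 q.2‖ ≤ ‖R q.1 0‖ + ‖R q.1 q.2 - R q.1 0‖ := by
    simpa using norm_add_le (R q.1 0) (R q.1 q.2 - R q.1 0)
  rw [Real.dist_eq, sub_zero, abs_of_nonneg (norm_nonneg _)]
  linarith

theorem tendstoCrAt_zero_of_iteratedFDeriv [ProperSpace E] (hr : 2 ≤ r) {R : ℕ → E → F}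
    (hd : ∀ w, ∀ᶠ q : ℕ × E in atTop ×ˢ 𝓝 w, ContDiffAt ℝ r (R q.1) q.2)
    (h2 : ∀ j : ℕ, 2 ≤ j → (j : ℕ∞) ≤ r → ∀ w,
      Tendsto (fun q : ℕ × E => iteratedFDeriv ℝ j (R q.1) q.2) (atTop ×ˢ 𝓝 w) (𝓝 0))
    (h1 : Tendsto (fun k => fderiv ℝ (R k) 0) atTop (𝓝 0))
    (h0 : Tendsto (fun k => R k 0) atTop (𝓝 0)) (w : E) :
    TendstoCrAt r R (fun _ => 0) w := by
  have hr2 : (2 : WithTop ℕ∞) ≤ r := WithTop.coe_le_coe.2 hr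
  have e1 : ∀ w, Tendsto (fun q : ℕ × E => fderiv ℝ (R q.1) q.2) (atTop ×ˢ 𝓝 w) (𝓝 0) := by
    refine tendsto_zero_of_tendsto_fderiv_zero (R := fun k => fderiv ℝ (R k)) ?_ ?_ h1
    · intro w
      filter_upwards [hd w] with q hq
      exact (hq.fderiv_right (m := 1) (by simpa [one_add_one_eq_two] using hr2)).differentiableAt
        (by simp)
    · intro w
      have := (h2 2 le_rfl (by exact_mod_cast hr) w).norm
      rw [norm_zero] at this
      refine this.congr fun q => ?_
      rw [← norm_iteratedFDeriv_one, norm_iteratedFDeriv_fderiv]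
  have e0 : ∀ w, Tendsto (fun q : ℕ × E => R q.1 q.2) (atTop ×ˢ 𝓝 w) (𝓝 0) := by
    refine tendsto_zero_of_tendsto_fderiv_zero ?_ ?_ h0
    · intro w
      filter_upwards [hd w] with q hq
      exact hq.differentiableAt (by
        intro h
        rw [h] at hr2
        simp at hr2)
    · intro w
      simpa using (e1 w).norm
  refine ⟨hd w, fun j hj => ?_⟩
  have hz : iteratedFDeriv ℝ j (fun _ : E => (0 : F)) w = 0 := by
    rw [iteratedFDeriv_fun_zero]; rfl
  rw [hz]
  match j, hj with
  | 0, _ =>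
    rw [tendsto_zero_iff_norm_tendsto_zero]
    simpa [norm_iteratedFDeriv_zero] using (e0 w).norm
  | 1, _ =>
    rw [tendsto_zero_iff_norm_tendsto_zero]
    simpa [norm_iteratedFDeriv_one] using (e1 w).norm
  | j + 2, hj => exact h2 (j + 2) (by omega) hj w

theorem iteratedFDeriv_rescale {T : E → F} {U : Set E} (hU : IsOpen U) (hT : ContDiffOn ℝ r T U)
    (p : E) (S : E →L[ℝ] E) (D : F →L[ℝ] F) {y : E} (hy : p + S y ∈ U) :
    ContDiffAt ℝ r (fun w => D (T (p + S w) - T p)) y ∧ ∀ j : ℕ, j ≠ 0 → (j : ℕ∞) ≤ r →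
      iteratedFDeriv ℝ j (fun w => D (T (p + S w) - T p)) y =
        D.compContinuousMultilinearMap
          ((iteratedFDeriv ℝ j T (p + S y)).compContinuousLinearMap fun _ => S) := by
  set V : Set E := {q | p + q ∈ U} with hV
  have hVo : IsOpen V := hU.preimage (by fun_prop)
  have hWo : IsOpen (S ⁻¹' V) := hVo.preimage S.continuous
  have hT' : ContDiffOn ℝ r (fun q => T (p + q)) V :=
    hT.comp (contDiff_const.add contDiff_id).contDiffOn fun q hq => hq
  have hTS : ContDiffOn ℝ r ((fun q => T (p + q)) ∘ S) (S ⁻¹' V) :=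
    hT'.comp S.contDiff.contDiffOn fun q hq => hq
  have hTy : ContDiffAt ℝ r ((fun q => T (p + q)) ∘ S) y := hTS.contDiffAt (hWo.mem_nhds hy)
  have hTy' : ContDiffAt ℝ r (fun w => (((fun q => T (p + q)) ∘ S) w + -T p)) y :=
    hTy.add contDiffAt_const
  have hfun : (fun w => D (T (p + S w) - T p)) =
      D ∘ (fun w => (((fun q => T (p + q)) ∘ S) w + -T p)) := by
    ext w; simp [sub_eq_add_neg]
  rw [hfun]
  refine ⟨D.contDiff.contDiffAt.comp y hTy', fun j hj0 hj => ?_⟩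
  have hj' : (j : WithTop ℕ∞) ≤ r := by exact_mod_cast hj
  rw [D.iteratedFDeriv_comp_left hTy' hj',
    fun_iteratedFDeriv_add_apply (hTy.of_le hj') contDiffAt_const,
    iteratedFDeriv_const_of_ne hj0]
  congr 1
  simp only [Pi.zero_apply, add_zero]
  have := S.iteratedFDerivWithin_comp_right hT' hVo.uniqueDiffOn hWo.uniqueDiffOn
    (x := y) hy hj'
  rw [iteratedFDerivWithin_of_isOpen j hWo hy, iteratedFDerivWithin_of_isOpen j hVo hy] at this
  rw [this, iteratedFDeriv_comp_add_left]

/-- Blow-ups `w ↦ D_k (T (p_k + S_k w) - T p_k)` of a `C^r` map converge in the `C^r` topology to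
a map of degree two as soon as their first and second derivatives do. -/
theorem tendstoCrAt_rescale [ProperSpace E] (hr : 2 ≤ r) {T : E → F} {U : Set E} (hU : IsOpen U)
    (hT : ContDiffOn ℝ r T U) {x₀ : E} (hx₀ : x₀ ∈ U) {p : ℕ → E} (hp : Tendsto p atTop (𝓝 x₀))
    {S : ℕ → E →L[ℝ] E} (hS : Tendsto S atTop (𝓝 0)) {D : ℕ → F →L[ℝ] F} {C : ℝ}
    (hC : ∀ᶠ k in atTop, ‖D k‖ * ‖S k‖ ^ 2 ≤ C) {G : E → F} (hG : ContDiff ℝ r G) (hG0 : G 0 = 0)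
    (h1 : Tendsto (fun k => (D k).comp ((fderiv ℝ T (p k)).comp (S k))) atTop
      (𝓝 (fderiv ℝ G 0)))
    {B : ContinuousMultilinearMap ℝ (fun _ : Fin 2 => E) F}
    (hB : ∀ w, iteratedFDeriv ℝ 2 G w = B)
    (h2 : Tendsto (fun q : ℕ × E => (D q.1).compContinuousMultilinearMap
      ((iteratedFDeriv ℝ 2 T q.2).compContinuousLinearMap fun _ => S q.1)) (atTop ×ˢ 𝓝 x₀) (𝓝 B))
    (w : E) : TendstoCrAt r (fun k w => D k (T (p k + S k w) - T (p k))) G w := by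
  have hr2 : (2 : WithTop ℕ∞) ≤ r := WithTop.coe_le_coe.2 hr
  have hr0 : (r : WithTop ℕ∞) ≠ 0 := by
    intro h; rw [h] at hr2; simp at hr2
  have hpt : ∀ w, Tendsto (fun q : ℕ × E => p q.1 + S q.1 q.2) (atTop ×ˢ 𝓝 w) (𝓝 x₀) := by
    intro w
    have := (hp.comp tendsto_fst).add
      (((isBoundedBilinearMap_apply (𝕜 := ℝ) (E := E) (F := E)).continuous.tendsto (0, w)).comp
        ((hS.comp (tendsto_fst (g := 𝓝 w))).prodMk_nhds (tendsto_snd (f := atTop))))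
    simpa using this
  have hmem : ∀ w, ∀ᶠ q : ℕ × E in atTop ×ˢ 𝓝 w, p q.1 + S q.1 q.2 ∈ U :=
    fun w => (hpt w).eventually (hU.eventually_mem hx₀)
  set H : ℕ → E → F := fun k w => D k (T (p k + S k w) - T (p k)) with hH
  have hHd : ∀ w, ∀ᶠ q : ℕ × E in atTop ×ˢ 𝓝 w, ContDiffAt ℝ r (H q.1) q.2 := fun w =>
    (hmem w).mono fun q hq => (iteratedFDeriv_rescale hU hT _ _ _ hq).1
  have hH2 : ∀ j : ℕ, 2 ≤ j → (j : ℕ∞) ≤ r → ∀ w,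
      Tendsto (fun q : ℕ × E => iteratedFDeriv ℝ j (H q.1) q.2) (atTop ×ˢ 𝓝 w)
        (𝓝 (iteratedFDeriv ℝ j G w)) := by
    intro j hj hjr w
    obtain rfl | hj3 := hj.eq_or_lt
    · rw [hB]
      refine (h2.comp (tendsto_fst.prodMk (hpt w))).congr' ?_
      filter_upwards [hmem w] with q hq
      exact ((iteratedFDeriv_rescale hU hT _ _ _ hq).2 2 (by norm_num) hjr).symm
    · obtain ⟨i, rfl⟩ : ∃ i, j = i + 1 + 2 := ⟨j - 3, by omega⟩
      have hz : ∀ i w, iteratedFDeriv ℝ (i + 1 + 2) G w = 0 := by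
        intro i
        induction i with
        | zero =>
          intro w
          have hc : iteratedFDeriv ℝ 2 G = fun _ => B := funext hB
          ext v
          rw [iteratedFDeriv_succ_apply_left, hc]
          simp
        | succ i ih =>
          intro w
          have hc : iteratedFDeriv ℝ (i + 1 + 2) G = fun _ => 0 := funext ih
          ext v
          refine (iteratedFDeriv_succ_apply_left (n := i + 1 + 2) v).trans ?_
          rw [hc]
          simp
      rw [hz i w, tendsto_zero_iff_norm_tendsto_zero]
      have hTc : Tendsto (fun q : ℕ × E => ‖iteratedFDeriv ℝ (i + 1 + 2) T (p q.1 + S q.1 q.2)‖)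
          (atTop ×ˢ 𝓝 w) (𝓝 ‖iteratedFDeriv ℝ (i + 1 + 2) T x₀‖) := by
        have hc := (hT.continuousOn_iteratedFDerivWithin (m := i + 1 + 2)
          (WithTop.coe_le_coe.2 hjr) hU.uniqueDiffOn).congr
          (fun x hx => (iteratedFDerivWithin_of_isOpen _ hU hx).symm)
        exact ((hc.continuousAt (hU.mem_nhds hx₀)).tendsto.comp (hpt w)).norm
      have hS0 : Tendsto (fun q : ℕ × E => ‖S q.1‖ ^ (i + 1)) (atTop ×ˢ 𝓝 w) (𝓝 0) := by
        have := (hS.comp (tendsto_fst (g := 𝓝 w))).norm.pow (i + 1)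
        simpa using this
      have hlim := (hTc.mul hS0).const_mul C
      rw [mul_zero, mul_zero] at hlim
      refine squeeze_zero' (Eventually.of_forall fun _ => norm_nonneg _) ?_ hlim
      filter_upwards [hmem w, (tendsto_fst (g := 𝓝 w)).eventually hC] with q hq hqC
      rw [(iteratedFDeriv_rescale hU hT _ _ _ hq).2 _ (by omega) hjr]
      refine (ContinuousLinearMap.norm_compContinuousMultilinearMap_le _ _).trans ?_
      have hle := ContinuousMultilinearMap.norm_compContinuousLinearMap_le
        (iteratedFDeriv ℝ (i + 1 + 2) T (p q.1 + S q.1 q.2)) (fun _ => S q.1)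
      rw [Finset.prod_const, Finset.card_univ, Fintype.card_fin] at hle
      calc ‖D q.1‖ * _ ≤ ‖D q.1‖ * (‖iteratedFDeriv ℝ (i + 1 + 2) T (p q.1 + S q.1 q.2)‖ *
            ‖S q.1‖ ^ (i + 1 + 2)) := by gcongr
        _ = ‖D q.1‖ * ‖S q.1‖ ^ 2 * (‖iteratedFDeriv ℝ (i + 1 + 2) T (p q.1 + S q.1 q.2)‖ *
            ‖S q.1‖ ^ (i + 1)) := by ring
        _ ≤ _ := by gcongr
  have hGd : ∀ w, ContDiffAt ℝ r G w := fun w => hG.contDiffAt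
  have hΔ : TendstoCrAt r (fun k w => H k w + -G w) (fun _ => 0) w := by
    refine tendstoCrAt_zero_of_iteratedFDeriv hr ?_ ?_ ?_ ?_ w
    · intro w
      filter_upwards [hHd w] with q hq using hq.add (hGd _).neg
    · intro j hj hjr w
      have hj' : (j : WithTop ℕ∞) ≤ r := by exact_mod_cast hjr
      have hGj : Tendsto (fun q : ℕ × E => iteratedFDeriv ℝ j G q.2) (atTop ×ˢ 𝓝 w)
          (𝓝 (iteratedFDeriv ℝ j G w)) :=
        ((hG.continuous_iteratedFDeriv hj').tendsto w).comp tendsto_snd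
      have := (hH2 j hj hjr w).sub hGj
      rw [sub_self] at this
      refine this.congr' ?_
      filter_upwards [hHd w] with q hq
      rw [fun_iteratedFDeriv_add_apply (hq.of_le hj') ((hGd _).neg.of_le hj')]
      have := iteratedFDeriv_neg_apply (𝕜 := ℝ) (f := G) (x := q.2) (i := j)
      rw [show (fun x => -G x) = -G from rfl, this, sub_eq_add_neg]
    · have := h1.sub (tendsto_const_nhds (x := fderiv ℝ G 0))
      rw [sub_self] at this
      refine this.congr' ?_
      filter_upwards [hp.eventually (hU.eventually_mem hx₀)] with k hk
      have hk' : p k + S k 0 ∈ U := by simpa using hk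
      have hTd : DifferentiableAt ℝ T (p k + S k 0) :=
        (hT.contDiffAt (hU.mem_nhds hk')).differentiableAt hr0
      have hd1 : HasFDerivAt (fun w => p k + S k w) (S k) 0 := (S k).hasFDerivAt.const_add _
      have hd2 : HasFDerivAt (H k) ((D k).comp ((fderiv ℝ T (p k + S k 0)).comp (S k))) 0 :=
        (D k).hasFDerivAt.comp 0 ((hTd.hasFDerivAt.comp 0 hd1).sub_const _)
      have hd3 := hd2.fun_add ((hGd 0).differentiableAt hr0).hasFDerivAt.fun_neg
      rw [map_zero, add_zero, ← sub_eq_add_neg] at hd3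
      exact hd3.fderiv.symm
    · simp [hH, hG0]
  have := hΔ.add (TendstoCrAt.of_contDiff hG w) contDiffAt_const (hGd w)
  simpa using this

end

section

variable {E F : Type*} [NormedAddCommGroup E] [NormedSpace ℝ E]
  [NormedAddCommGroup F] [NormedSpace ℝ F] {r : ℕ∞}

theorem ContDiffOn.tendsto_iteratedFDeriv_two (hr : 2 ≤ r) {T : E → F} {U : Set E} (hU : IsOpen U)
    (hT : ContDiffOn ℝ r T U) {x₀ : E} (hx₀ : x₀ ∈ U) :
    Tendsto (iteratedFDeriv ℝ 2 T) (𝓝 x₀) (𝓝 (iteratedFDeriv ℝ 2 T x₀)) :=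
  (((hT.continuousOn_iteratedFDerivWithin (m := 2) (WithTop.coe_le_coe.2 hr) hU.uniqueDiffOn).congr
    (fun _ hx => (iteratedFDerivWithin_of_isOpen _ hU hx).symm)).continuousAt
      (hU.mem_nhds hx₀)).tendsto

/-- Blow-ups whose second derivatives vanish in the limit converge to a linear map. -/
theorem tendstoCrAt_rescale_linear [ProperSpace E] (hr : 2 ≤ r) {T : E → F} {U : Set E}
    (hU : IsOpen U) (hT : ContDiffOn ℝ r T U) {x₀ : E} (hx₀ : x₀ ∈ U) {p : ℕ → E}
    (hp : Tendsto p atTop (𝓝 x₀)) {S : ℕ → E →L[ℝ] E} (hS : Tendsto S atTop (𝓝 0))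
    {D : ℕ → F →L[ℝ] F} (hDS : Tendsto (fun k => ‖D k‖ * ‖S k‖ ^ 2) atTop (𝓝 0)) {L : E →L[ℝ] F}
    (hL : Tendsto (fun k => (D k).comp ((fderiv ℝ T (p k)).comp (S k))) atTop (𝓝 L)) (w : E) :
    TendstoCrAt r (fun k w => D k (T (p k + S k w) - T (p k))) L w := by
  refine tendstoCrAt_rescale hr hU hT hx₀ hp hS (C := 1) (B := 0)
    ((hDS.eventually (gt_mem_nhds one_pos)).mono fun k hk => hk.le) L.contDiff (map_zero L)
    (by rwa [L.fderiv]) (fun w => ?_) ?_ w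
  · ext v
    rw [iteratedFDeriv_two_apply]
    have : fderiv ℝ L = fun _ => L := funext fun w => L.fderiv
    simp [this]
  · rw [tendsto_zero_iff_norm_tendsto_zero]
    have h1 := ((hT.tendsto_iteratedFDeriv_two hr hU hx₀).norm.comp
      (tendsto_snd (f := (atTop : Filter ℕ)))).mul (hDS.comp (tendsto_fst (g := 𝓝 x₀)))
    rw [mul_zero] at h1
    refine squeeze_zero (fun _ => norm_nonneg _) (fun q => ?_) h1
    refine (ContinuousLinearMap.norm_compContinuousMultilinearMap_le _ _).trans ?_
    have hle := ContinuousMultilinearMap.norm_compContinuousLinearMap_le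
      (iteratedFDeriv ℝ 2 T q.2) (fun _ => S q.1)
    rw [Finset.prod_const, Finset.card_univ, Fintype.card_fin] at hle
    calc ‖D q.1‖ * _ ≤ ‖D q.1‖ * (‖iteratedFDeriv ℝ 2 T q.2‖ * ‖S q.1‖ ^ 2) := by gcongr
      _ = _ := by simp only [Function.comp]; ring

/-- Blow-ups by `s_k` in the source and by `s_k⁻²` in the target converge to a quadratic map. -/
theorem tendstoCrAt_rescale_quadratic [ProperSpace E] (hr : 2 ≤ r) {T : E → F} {U : Set E}
    (hU : IsOpen U) (hT : ContDiffOn ℝ r T U) {x₀ : E} (hx₀ : x₀ ∈ U) {p : ℕ → E}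
    (hp : Tendsto p atTop (𝓝 x₀)) {s : ℕ → ℝ} (hs : Tendsto s atTop (𝓝 0)) (hs0 : ∀ k, s k ≠ 0)
    {S : ℕ → E →L[ℝ] E} {S' : E →L[ℝ] E} (hS : Tendsto S atTop (𝓝 S'))
    {D : ℕ → F →L[ℝ] F} {D' : F →L[ℝ] F} (hD : Tendsto D atTop (𝓝 D')) {L : E →L[ℝ] F}
    (hL : Tendsto (fun k => ((s k ^ 2)⁻¹ • D k).comp ((fderiv ℝ T (p k)).comp (s k • S k)))
      atTop (𝓝 L)) (w : E) :
    TendstoCrAt r (fun k w => ((s k ^ 2)⁻¹ • D k) (T (p k + (s k • S k) w) - T (p k)))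
      (fun w => L w + (1 / 2 : ℝ) • D' (iteratedFDeriv ℝ 2 T x₀ ![S' w, S' w])) w := by
  have hr2 : (2 : WithTop ℕ∞) ≤ r := WithTop.coe_le_coe.2 hr
  have hS0 : Tendsto (fun k => s k • S k) atTop (𝓝 0) := by simpa using hs.smul hS
  have hDS : Tendsto (fun k => ‖D k‖ * ‖S k‖ ^ 2) atTop (𝓝 (‖D'‖ * ‖S'‖ ^ 2)) :=
    hD.norm.mul (hS.norm.pow 2)
  set Q := fderiv ℝ (fderiv ℝ T) x₀ with hQ
  have hsymm : ∀ u v, Q u v = Q v u := fun u v =>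
    (hT.contDiffAt (hU.mem_nhds hx₀)).isSymmSndFDerivAt (by simpa using hr2) u v
  set b : E →L[ℝ] E →L[ℝ] F :=
    (ContinuousLinearMap.compL ℝ E F F D').comp
      (((ContinuousLinearMap.compL ℝ E E F).flip S').comp (Q.comp S')) with hb
  have hbapp : ∀ u v, b u v = D' (Q (S' u) (S' v)) := fun u v => rfl
  have hQ2 : ∀ u v, iteratedFDeriv ℝ 2 T x₀ ![u, v] = Q u v := fun u v => by
    rw [iteratedFDeriv_two_apply]; rfl
  simp only [hQ2]
  have hder : ∀ w, HasFDerivAt (fun w => L w + (1 / 2 : ℝ) • D' (Q (S' w) (S' w))) (L + b w) w := by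
    intro w
    have h1 : HasFDerivAt (fun w => b w w) ((b w) + b.flip w) w := by
      have := b.hasFDerivAt_of_bilinear (hasFDerivAt_id w) (hasFDerivAt_id w)
      refine this.congr_fderiv ?_
      ext v; simp
    refine (L.hasFDerivAt.fun_add (h1.const_smul (1 / 2 : ℝ))).congr_fderiv ?_
    ext v
    simp only [add_apply, smul_apply,
      ContinuousLinearMap.flip_apply, hbapp, hsymm (S' v) (S' w)]
    rw [← two_smul ℝ, smul_smul]; norm_num
  have hfd : fderiv ℝ (fun w => L w + (1 / 2 : ℝ) • D' (Q (S' w) (S' w))) = fun w => L + b w :=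
    funext fun w => (hder w).fderiv
  refine tendstoCrAt_rescale hr hU hT hx₀ hp hS0 (C := ‖D'‖ * ‖S'‖ ^ 2 + 1)
    (B := D'.compContinuousMultilinearMap
      ((iteratedFDeriv ℝ 2 T x₀).compContinuousLinearMap fun _ => S')) ?_ ?_ (by simp)
    (by rw [hfd]; simpa using hL) (fun w => ?_) ?_ w
  · filter_upwards [hDS.eventually (gt_mem_nhds (lt_add_one _))] with k hk
    have hk0 : 0 < |s k| := abs_pos.2 (hs0 k)
    rw [norm_smul, norm_smul, norm_inv, norm_pow, Real.norm_eq_abs]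
    calc (|s k| ^ 2)⁻¹ * ‖D k‖ * (|s k| * ‖S k‖) ^ 2 = ‖D k‖ * ‖S k‖ ^ 2 := by field_simp
      _ ≤ _ := hk.le
  · exact L.contDiff.add (contDiff_const.smul
      (D'.contDiff.comp ((Q.contDiff.comp S'.contDiff).clm_apply S'.contDiff)))
  · ext v
    rw [iteratedFDeriv_two_apply, hfd, fderiv_const_add, b.fderiv]
    simp [iteratedFDeriv_two_apply, hbapp, hQ]
  · have key : Continuous fun q : (F →L[ℝ] F) × (ContinuousMultilinearMap ℝ (fun _ : Fin 2 => E) F)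
        × (E →L[ℝ] E) => q.1.compContinuousMultilinearMap
          (q.2.1.compContinuousLinearMap fun _ => q.2.2) := by
      have h1 : Continuous fun q : (F →L[ℝ] F) × (ContinuousMultilinearMap ℝ (fun _ : Fin 2 => E) F)
          × (E →L[ℝ] E) => ContinuousMultilinearMap.compContinuousLinearMapContinuousMultilinear ℝ
            (fun _ : Fin 2 => E) (fun _ : Fin 2 => E) F (fun _ => q.2.2) := by
        exact (ContinuousMultilinearMap.cont _).comp (by fun_prop)
      have h2 := h1.clm_apply (continuous_fst.comp continuous_snd)
      exact ((ContinuousLinearMap.compContinuousMultilinearMapL ℝ (fun _ : Fin 2 => E) F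
        F).continuous.comp continuous_fst).clm_apply h2
    have h1 := (key.tendsto (D', iteratedFDeriv ℝ 2 T x₀, S')).comp
      ((hD.comp (tendsto_fst (g := 𝓝 x₀))).prodMk_nhds
      (((hT.tendsto_iteratedFDeriv_two hr hU hx₀).comp
      (tendsto_snd (f := (atTop : Filter ℕ)))).prodMk_nhds
        (hS.comp (tendsto_fst (g := 𝓝 x₀)))))
    refine h1.congr fun q => ?_
    ext v
    have hk0 := hs0 q.1
    have := (iteratedFDeriv ℝ 2 T q.2).map_smul_univ (fun _ => s q.1) (fun i => S q.1 (v i))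
    simp only [Finset.prod_const, Finset.card_univ, Fintype.card_fin] at this
    simp only [Function.comp, ContinuousLinearMap.compContinuousMultilinearMap_coe,
      ContinuousMultilinearMap.compContinuousLinearMap_apply, smul_apply,
      this, map_smul, smul_smul]
    rw [mul_inv_cancel₀ (pow_ne_zero 2 hk0), one_smul]

end

/-- The endomorphism of `E3` with the given matrix. -/
noncomputable def matMap (m : Matrix (Fin 3) (Fin 3) ℝ) : E3 →L[ℝ] E3 :=
  (Matrix.toEuclideanLin m).toContinuousLinearMap

theorem matMap_apply (m : Matrix (Fin 3) (Fin 3) ℝ) (v : E3) (i : Fin 3) :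
    matMap m v i = m i 0 * v 0 + m i 1 * v 1 + m i 2 * v 2 := by
  simp [matMap, Matrix.toLpLin_apply, Matrix.mulVec, dotProduct, Fin.sum_univ_three]

theorem axis_apply (i j : Fin 3) : axis j i = if i = j then 1 else 0 := by
  simp [axis]

theorem matMap_axis (m : Matrix (Fin 3) (Fin 3) ℝ) (i j : Fin 3) :
    matMap m (axis j) i = m i j := by
  rw [matMap_apply]
  fin_cases j <;> simp [axis_apply]

theorem E3.eq_sum_axis (v : E3) : v = v 0 • axis 0 + v 1 • axis 1 + v 2 • axis 2 := by
  ext i; fin_cases i <;> simp [axis_apply]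

theorem E3.clm_ext {F : Type*} [NormedAddCommGroup F] [NormedSpace ℝ F] {A B : E3 →L[ℝ] F}
    (h : ∀ j, A (axis j) = B (axis j)) : A = B := by
  ext v
  rw [E3.eq_sum_axis v]
  simp [h]

theorem eq_matMap (A : E3 →L[ℝ] E3) : A = matMap (Matrix.of fun i j => A (axis j) i) :=
  E3.clm_ext fun j => by ext i; rw [matMap_axis]; rfl

theorem continuous_matMap : Continuous matMap := by
  have : matMap = fun m => (LinearMap.toContinuousLinearMap (E := E3) (F' := E3)
    (𝕜 := ℝ)).toLinearMap ((Matrix.toEuclideanLin (𝕜 := ℝ) (m := Fin 3) (n := Fin 3)) m) := rfl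
  rw [this]
  exact LinearMap.continuous_of_finiteDimensional
    ((LinearMap.toContinuousLinearMap (E := E3) (F' := E3) (𝕜 := ℝ)).toLinearMap ∘ₗ
      (Matrix.toEuclideanLin (𝕜 := ℝ) (m := Fin 3) (n := Fin 3)).toLinearMap)

theorem tendsto_matMap {ι : Type*} {l : Filter ι} {A : ι → E3 →L[ℝ] E3}
    {m : Matrix (Fin 3) (Fin 3) ℝ} (h : ∀ i j, Tendsto (fun k => A k (axis j) i) l (𝓝 (m i j))) :
    Tendsto A l (𝓝 (matMap m)) := by
  have h1 : Tendsto (fun k => (Matrix.of fun i j => A k (axis j) i : Matrix (Fin 3) (Fin 3) ℝ)) l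
      (𝓝 m) := tendsto_pi_nhds.2 fun i => tendsto_pi_nhds.2 fun j => h i j
  refine ((continuous_matMap.tendsto m).comp h1).congr fun k => ?_
  exact (eq_matMap (A k)).symm

theorem tendsto_E3 {ι : Type*} {l : Filter ι} {v : ι → E3} {w : E3} :
    Tendsto v l (𝓝 w) ↔ ∀ i, Tendsto (fun k => v k i) l (𝓝 (w i)) := by
  rw [← tendsto_pi_nhds (f := fun k i => v k i)]
  exact (PiLp.homeomorph 2 (fun _ : Fin 3 => ℝ)).isInducing.tendsto_nhds_iff

/-- The endomorphism of `E3` which multiplies the coordinates by the given numbers. -/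
noncomputable def diagMap (d : Fin 3 → ℝ) : E3 →L[ℝ] E3 := matMap (Matrix.diagonal d)

theorem diagMap_apply (d : Fin 3 → ℝ) (v : E3) (i : Fin 3) : diagMap d v i = d i * v i := by
  rw [diagMap, matMap_apply]
  fin_cases i <;> simp

theorem diagMap_axis (d : Fin 3 → ℝ) (j : Fin 3) : diagMap d (axis j) = d j • axis j := by
  ext i
  rw [diagMap_apply]
  simp only [PiLp.smul_apply, axis_apply, smul_eq_mul]
  split_ifs with h
  · rw [h]
  · simp

theorem tendsto_diagMap {ι : Type*} {l : Filter ι} {d : ι → Fin 3 → ℝ} {d' : Fin 3 → ℝ}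
    (h : ∀ i, Tendsto (fun k => d k i) l (𝓝 (d' i))) :
    Tendsto (fun k => diagMap (d k)) l (𝓝 (diagMap d')) := by
  refine tendsto_matMap fun i j => ?_
  simp only [diagMap_axis, PiLp.smul_apply, axis_apply, smul_eq_mul, Matrix.diagonal_apply]
  by_cases hij : i = j
  · simpa [hij] using h j
  · simpa [hij] using tendsto_const_nhds

theorem diagMap_zero : diagMap 0 = 0 := by
  ext v i; simp [diagMap_apply]

theorem smul_diagMap (c : ℝ) (d : Fin 3 → ℝ) : c • diagMap d = diagMap (c • d) := by
  ext v i; simp [diagMap_apply, mul_assoc]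

theorem E3.abs_apply_le_norm (v : E3) (i : Fin 3) : |v i| ≤ ‖v‖ := by
  simpa using PiLp.norm_apply_le v i

theorem norm_diagMap_le (d : Fin 3 → ℝ) : ‖diagMap d‖ ≤ |d 0| + |d 1| + |d 2| := by
  refine ContinuousLinearMap.opNorm_le_bound _ (by positivity) fun v => ?_
  have h1 : diagMap d v = (d 0 * v 0) • axis 0 + (d 1 * v 1) • axis 1 + (d 2 * v 2) • axis 2 := by
    rw [E3.eq_sum_axis (diagMap d v)]
    simp only [diagMap_apply]
  have h2 : ∀ i, ‖(d i * v i) • axis i‖ ≤ |d i| * ‖v‖ := fun i => by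
    rw [norm_smul, Real.norm_eq_abs, abs_mul, show ‖axis i‖ = 1 by simp [axis], mul_one]
    exact mul_le_mul_of_nonneg_left (E3.abs_apply_le_norm v i) (abs_nonneg _)
  rw [h1]
  refine (norm_add₃_le).trans ?_
  linarith [h2 0, h2 1, h2 2]

theorem tendsto_norm_diagMap_mul_sq {d s : ℕ → Fin 3 → ℝ}
    (h : ∀ i j, Tendsto (fun k => d k i * s k j ^ 2) atTop (𝓝 0)) :
    Tendsto (fun k => ‖diagMap (d k)‖ * ‖diagMap (s k)‖ ^ 2) atTop (𝓝 0) := by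
  have h1 : Tendsto (fun k => 3 * ∑ i, ∑ j, |d k i * s k j ^ 2|) atTop (𝓝 0) := by
    have : Tendsto (fun k => ∑ i, ∑ j, |d k i * s k j ^ 2|) atTop
        (𝓝 (∑ i : Fin 3, ∑ j : Fin 3, |(0 : ℝ)|)) :=
      tendsto_finsetSum _ fun i _ => tendsto_finsetSum _ fun j _ => (h i j).abs
    simpa using this.const_mul 3
  refine squeeze_zero (fun k => by positivity) (fun k => ?_) h1
  have hs : ‖diagMap (s k)‖ ^ 2 ≤ 3 * (s k 0 ^ 2 + s k 1 ^ 2 + s k 2 ^ 2) := by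
    have := pow_le_pow_left₀ (norm_nonneg _) (norm_diagMap_le (s k)) 2
    have h0 := sq_abs (s k 0)
    have h1 := sq_abs (s k 1)
    have h2 := sq_abs (s k 2)
    nlinarith [sq_nonneg (|s k 0| - |s k 1|), sq_nonneg (|s k 0| - |s k 2|),
      sq_nonneg (|s k 1| - |s k 2|)]
  calc ‖diagMap (d k)‖ * ‖diagMap (s k)‖ ^ 2
      ≤ (|d k 0| + |d k 1| + |d k 2|) * (3 * (s k 0 ^ 2 + s k 1 ^ 2 + s k 2 ^ 2)) := by
        gcongr
        exact norm_diagMap_le (d k)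
    _ = _ := by
        simp only [Fin.sum_univ_three, abs_mul, abs_pow, sq_abs]; ring

theorem diagMap_comp_comp_axis (d s : Fin 3 → ℝ) (A : E3 →L[ℝ] E3) (i j : Fin 3) :
    (diagMap d).comp (A.comp (diagMap s)) (axis j) i = d i * s j * A (axis j) i := by
  simp only [ContinuousLinearMap.comp_apply, diagMap_apply, diagMap_axis, map_smul,
    PiLp.smul_apply, smul_eq_mul]
  ring

/-- The powers of the eigenvalues at the two saddles in the successive renormalizations:
`a, b, c` stand for `λⁿ, σⁿ, ζⁿ` at the saddle of index one and `a', b', c'` for the `m`-th powers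
at the saddle of index two. -/
structure SaddleScales (a b c a' b' c' : ℕ → ℝ) (γ : ℝ) : Prop where
  a_pos : ∀ k, 0 < a k
  b_pos : ∀ k, 0 < b k
  c_pos : ∀ k, 0 < c k
  b'_pos : ∀ k, 0 < b' k
  c'_pos : ∀ k, 0 < c' k
  a'_nonneg : ∀ k, 0 ≤ a' k
  a_le_c : ∀ k, a k ≤ c k
  c_lim : Tendsto c atTop (𝓝 0)
  b_lim : Tendsto (fun k => (b k)⁻¹) atTop (𝓝 0)
  a'_lim : Tendsto a' atTop (𝓝 0)
  b'_lim : Tendsto (fun k => (b' k)⁻¹) atTop (𝓝 0)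
  c'_lim : Tendsto (fun k => (c' k)⁻¹) atTop (𝓝 0)
  b'_div_c'_lim : Tendsto (fun k => b' k / c' k) atTop (𝓝 0)
  lim₁ : Tendsto (fun k => b' k * c' k * b k * c k ^ 2) atTop (𝓝 0)
  lim₂ : Tendsto (fun k => c' k / (b' k ^ 3 * b k)) atTop (𝓝 0)
  lim₃ : Tendsto (fun k => a' k * b' k * b k) atTop (𝓝 0)
  lim₄ : Tendsto (fun k => c' k * a k) atTop (𝓝 γ)

namespace SaddleScales

variable {a b c a' b' c' : ℕ → ℝ} {γ : ℝ}

theorem a_lim (h : SaddleScales a b c a' b' c' γ) : Tendsto a atTop (𝓝 0) :=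
  squeeze_zero (fun k => (h.a_pos k).le) h.a_le_c h.c_lim

theorem δ_lim (h : SaddleScales a b c a' b' c' γ) :
    Tendsto (fun k => (b' k * b k)⁻¹) atTop (𝓝 0) := by
  have := h.b'_lim.mul h.b_lim
  rw [mul_zero] at this
  exact this.congr fun k => (mul_inv _ _).symm

/-- `ζⁿ ζ'ᵐ / σ'ᵐ → 0`. -/
theorem c_mul_c'_div_b'_lim (h : SaddleScales a b c a' b' c' γ) :
    Tendsto (fun k => c' k * c k / b' k) atTop (𝓝 0) := by
  have h1 := (h.lim₁.mul h.lim₂).sqrt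
  rw [mul_zero, Real.sqrt_zero] at h1
  refine h1.congr fun k => ?_
  have := h.b_pos k
  have := h.b'_pos k
  have := h.c_pos k
  have := h.c'_pos k
  rw [Real.sqrt_eq_iff_mul_self_eq (by positivity) (by positivity)]
  field_simp

theorem b'_mul_c_sq_lim (h : SaddleScales a b c a' b' c' γ) :
    Tendsto (fun k => b' k * c k ^ 2) atTop (𝓝 0) := by
  have h1 := (h.lim₁.mul h.c'_lim).mul h.b_lim
  simp only [mul_zero] at h1
  refine h1.congr fun k => ?_
  have := h.b_pos k
  have := h.c'_pos k
  field_simp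

theorem c'_mul_c_sq_lim (h : SaddleScales a b c a' b' c' γ) :
    Tendsto (fun k => c' k * c k ^ 2) atTop (𝓝 0) := by
  have h1 := (h.lim₁.mul h.b'_lim).mul h.b_lim
  simp only [mul_zero] at h1
  refine h1.congr fun k => ?_
  have := h.b_pos k
  have := h.b'_pos k
  field_simp

/-- The scale `δ = 1 / (σ'ᵐ σⁿ)` of the renormalization. -/
noncomputable def scale (b b' : ℕ → ℝ) (k : ℕ) : ℝ := (b' k * b k)⁻¹

theorem scale_pos (h : SaddleScales a b c a' b' c' γ) (k : ℕ) : 0 < scale b b' k :=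
  inv_pos.2 (mul_pos (h.b'_pos k) (h.b_pos k))

/-- The scaling at the source of the first transition. -/
noncomputable def src (a b c b' : ℕ → ℝ) (k : ℕ) : Fin 3 → ℝ :=
  ![a k * scale b b' k, b k * scale b b' k ^ 2, c k * scale b b' k]

/-- The scaling at the target of the first transition. -/
noncomputable def tgt (b a' b' c' : ℕ → ℝ) (k : ℕ) : Fin 3 → ℝ :=
  ![a' k / scale b b' k ^ 2, b' k / scale b b' k, c' k / scale b b' k]

theorem tendsto_src (h : SaddleScales a b c a' b' c' γ) (i : Fin 3) :
    Tendsto (fun k => src a b c b' k i) atTop (𝓝 0) := by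
  fin_cases i
  · have h1 := h.a_lim.mul h.δ_lim
    rw [mul_zero] at h1
    exact h1
  · have h1 := (h.b'_lim.mul h.b'_lim).mul h.b_lim
    simp only [mul_zero] at h1
    refine h1.congr fun k => ?_
    have := h.b_pos k
    have := h.b'_pos k
    simp only [src, scale, Fin.mk_one, Matrix.cons_val_one, Matrix.cons_val_zero]
    field_simp
  · have h1 := h.c_lim.mul h.δ_lim
    rw [mul_zero] at h1
    exact h1

theorem tendsto_tgt_mul_src_sq (h : SaddleScales a b c a' b' c' γ) (i j : Fin 3) :
    Tendsto (fun k => tgt b a' b' c' k i * src a b c b' k j ^ 2) atTop (𝓝 0) := by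
  have key2 : ∀ i, Tendsto (fun k => tgt b a' b' c' k i * src a b c b' k 2 ^ 2) atTop (𝓝 0) := by
    intro i
    have hc2 := h.c_lim.mul h.c_lim
    rw [mul_zero] at hc2
    fin_cases i
    · have h1 := h.a'_lim.mul hc2
      rw [mul_zero] at h1
      refine h1.congr fun k => ?_
      have := h.scale_pos k
      simp only [src, tgt, Fin.zero_eta, Matrix.cons_val_zero, Matrix.cons_val]
      field_simp
    · have h1 := hc2.mul h.b_lim
      rw [mul_zero] at h1
      refine h1.congr fun k => ?_
      have := h.b_pos k
      have := h.b'_pos k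
      simp only [src, tgt, scale, Fin.mk_one, Matrix.cons_val]
      field_simp
    · have h1 := h.c'_mul_c_sq_lim.mul h.δ_lim
      rw [mul_zero] at h1
      refine h1.congr fun k => ?_
      have := h.b_pos k
      have := h.b'_pos k
      simp only [src, tgt, scale, Fin.reduceFinMk, Matrix.cons_val]
      field_simp
  have htgt : ∀ i k, 0 ≤ tgt b a' b' c' k i := by
    intro i k
    have h1 := h.scale_pos k
    have h2 := h.a'_nonneg k
    have h3 := h.b'_pos k
    have h4 := h.c'_pos k
    fin_cases i <;> simp only [tgt, Fin.zero_eta, Fin.mk_one, Fin.reduceFinMk, Matrix.cons_val] <;>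
      positivity
  fin_cases j
  · refine squeeze_zero (fun k => mul_nonneg (htgt i k) (sq_nonneg _)) (fun k => ?_) (key2 i)
    have h1 := h.scale_pos k
    have h2 := h.a_pos k
    have h3 := h.a_le_c k
    have : src a b c b' k 0 ≤ src a b c b' k 2 := by
      simp only [src, Matrix.cons_val]; gcongr
    have h0 : 0 ≤ src a b c b' k 0 := by
      simp only [src, Matrix.cons_val]; positivity
    exact mul_le_mul_of_nonneg_left (pow_le_pow_left₀ h0 this 2) (htgt i k)
  · fin_cases i
    · have h1 := (h.a'_lim.mul h.b'_lim).mul h.b'_lim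
      simp only [mul_zero] at h1
      refine h1.congr fun k => ?_
      have := h.b_pos k
      have := h.b'_pos k
      simp only [src, tgt, scale, Fin.zero_eta, Fin.mk_one, Matrix.cons_val]
      field_simp
    · have h1 := (h.b'_lim.mul h.b'_lim).mul h.b_lim
      simp only [mul_zero] at h1
      refine h1.congr fun k => ?_
      have := h.b_pos k
      have := h.b'_pos k
      simp only [src, tgt, scale, Fin.mk_one, Matrix.cons_val]
      field_simp
    · refine h.lim₂.congr fun k => ?_
      have := h.b_pos k
      have := h.b'_pos k
      simp only [src, tgt, scale, Fin.mk_one, Fin.reduceFinMk, Matrix.cons_val]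
      field_simp
  · exact key2 i

end SaddleScales

theorem tendsto_mul_of_isBigO {e f g : ℕ → ℝ} (h : e =O[atTop] g)
    (hfg : Tendsto (fun k => f k * g k) atTop (𝓝 0)) :
    Tendsto (fun k => f k * e k) atTop (𝓝 0) :=
  ((Asymptotics.isBigO_refl f atTop).mul h).trans_tendsto hfg

theorem ContDiffOn.isBigO_fderiv_entry {r : ℕ∞} (hr : 2 ≤ r) {T : E3 → E3} {U : Set E3}
    (hU : IsOpen U) (hT : ContDiffOn ℝ r T U) {x : E3} (hx : x ∈ U) {p : ℕ → E3}
    (hp : Tendsto p atTop (𝓝 x)) {g : ℕ → ℝ} (hg : (fun k => p k - x) =O[atTop] g) (i j : Fin 3) :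
    (fun k => fderiv ℝ T (p k) (axis j) i - fderiv ℝ T x (axis j) i) =O[atTop] g := by
  have hd : DifferentiableAt ℝ (fderiv ℝ T) x :=
    ((hT.contDiffAt (hU.mem_nhds hx)).fderiv_right (m := 1)
      (by simpa [one_add_one_eq_two] using WithTop.coe_le_coe.2 hr)).differentiableAt one_ne_zero
  refine Asymptotics.IsBigO.trans ?_ ((hd.isBigO_sub.comp_tendsto hp).trans hg)
  refine Asymptotics.IsBigO.of_bound 1 (Eventually.of_forall fun k => ?_)
  simp only [Function.comp]
  have h1 := E3.abs_apply_le_norm ((fderiv ℝ T (p k) - fderiv ℝ T x) (axis j)) i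
  have h2 := (fderiv ℝ T (p k) - fderiv ℝ T x).le_opNorm (axis j)
  rw [show ‖axis j‖ = 1 by simp [axis], mul_one] at h2
  simpa using h1.trans h2

namespace SaddleScales

variable {a b c a' b' c' : ℕ → ℝ} {γ : ℝ} {r : ℕ∞}

/-- The limit of the rescaled passage from the saddle of index one to that of index two. -/
theorem tendstoCrAt_first (h : SaddleScales a b c a' b' c' γ) (hr : 2 ≤ r) {T : E3 → E3}
    {U : Set E3} (hU : IsOpen U) (hT : ContDiffOn ℝ r T U) {x : E3} (hx : x ∈ U)
    {M : Matrix (Fin 3) (Fin 3) ℝ} (hM : ∀ i j, fderiv ℝ T x (axis j) i = M i j)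
    (h12 : M 1 2 = 0) (h21 : M 2 1 = 0) (h22 : M 2 2 = 0) (w : E3) :
    TendstoCrAt r (fun k w => diagMap (tgt b a' b' c' k)
        (T (x + !₂[a k, 0, c k] + diagMap (src a b c b' k) w) - T (x + !₂[a k, 0, c k])))
      (matMap !![0, 0, 0; 0, M 1 1, 0; γ * M 2 0, 0, 0]) w := by
  have hv : Tendsto (fun k => (!₂[a k, 0, c k] : E3)) atTop (𝓝 0) := by
    rw [tendsto_E3]
    intro i
    fin_cases i
    · simpa using h.a_lim
    · simp
    · simpa using h.c_lim
  have hp : Tendsto (fun k => x + (!₂[a k, 0, c k] : E3)) atTop (𝓝 x) := by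
    simpa using hv.const_add x
  have hO : (fun k => x + (!₂[a k, 0, c k] : E3) - x) =O[atTop] c := by
    refine Asymptotics.IsBigO.of_bound 2 (Eventually.of_forall fun k => ?_)
    have e : x + (!₂[a k, 0, c k] : E3) - x = a k • axis 0 + c k • axis 2 := by
      ext i; fin_cases i <;> simp [axis_apply]
    rw [e, Real.norm_eq_abs, abs_of_pos (h.c_pos k)]
    refine (norm_add_le _ _).trans ?_
    rw [norm_smul, norm_smul, show ‖axis 0‖ = 1 by simp [axis], show ‖axis 2‖ = 1 by simp [axis],
      Real.norm_eq_abs, Real.norm_eq_abs, abs_of_pos (h.c_pos k), abs_of_pos (h.a_pos k)]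
    linarith [h.a_le_c k]
  have hS : Tendsto (fun k => diagMap (src a b c b' k)) atTop (𝓝 0) := by
    rw [← diagMap_zero]
    exact tendsto_diagMap h.tendsto_src
  have hr1 : ((1 : ℕ∞) : WithTop ℕ∞) ≤ r := WithTop.coe_le_coe.2 (one_le_two.trans hr)
  have hE : ∀ i j, Tendsto (fun k => fderiv ℝ T (x + !₂[a k, 0, c k]) (axis j) i) atTop
      (𝓝 (M i j)) := by
    intro i j
    have h1 := ((hT.contDiffAt (hU.mem_nhds hx)).continuousAt_fderiv
      (fun h0 => by rw [h0] at hr1; simp at hr1)).tendsto.comp hp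
    have h2 := tendsto_E3.1 (((ContinuousLinearMap.apply ℝ E3 (axis j)).continuous.tendsto _).comp
      h1) i
    rw [← hM]
    exact h2
  have hE' : ∀ i j, M i j = 0 →
      (fun k => fderiv ℝ T (x + !₂[a k, 0, c k]) (axis j) i) =O[atTop] c := by
    intro i j hij
    have := hT.isBigO_fderiv_entry hr hU hx hp hO i j
    simpa [hM, hij] using this
  refine tendstoCrAt_rescale_linear hr hU hT hx hp hS
    (tendsto_norm_diagMap_mul_sq h.tendsto_tgt_mul_src_sq) (tendsto_matMap fun i j => ?_) w
  simp only [diagMap_comp_comp_axis]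
  have hfac : ∀ {i j} {t : ℝ}, Tendsto (fun k => tgt b a' b' c' k i * src a b c b' k j) atTop
      (𝓝 t) → Tendsto (fun k => tgt b a' b' c' k i * src a b c b' k j *
        fderiv ℝ T (x + !₂[a k, 0, c k]) (axis j) i) atTop (𝓝 (t * M i j)) :=
    fun ht => ht.mul (hE _ _)
  have hfac' : ∀ {i j}, M i j = 0 →
      Tendsto (fun k => tgt b a' b' c' k i * src a b c b' k j * c k) atTop (𝓝 0) →
      Tendsto (fun k => tgt b a' b' c' k i * src a b c b' k j *
        fderiv ℝ T (x + !₂[a k, 0, c k]) (axis j) i) atTop (𝓝 0) :=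
    fun h0 ht => tendsto_mul_of_isBigO (hE' _ _ h0) ht
  have hfac0 : ∀ {i j} {t : ℝ} {f g : ℕ → ℝ}, Tendsto f atTop (𝓝 t) → Tendsto g atTop (𝓝 0) →
      (∀ k, f k * g k = tgt b a' b' c' k i * src a b c b' k j) →
      Tendsto (fun k => tgt b a' b' c' k i * src a b c b' k j *
        fderiv ℝ T (x + !₂[a k, 0, c k]) (axis j) i) atTop (𝓝 0) := fun {i j t f g} hf hg he => by
    have h1 := hf.mul hg
    rw [mul_zero] at h1
    simpa using hfac (h1.congr he)
  have pb := h.b_pos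
  have pb' := h.b'_pos
  have pc' := h.c'_pos
  fin_cases i <;> fin_cases j <;>
    simp only [Fin.zero_eta, Fin.mk_one, Fin.reduceFinMk, Matrix.of_apply, Matrix.cons_val]
  · refine hfac0 h.lim₃ h.a_lim fun k => ?_
    have := pb k; have := pb' k
    simp only [src, tgt, scale, Matrix.cons_val]
    field_simp
  · refine hfac0 h.lim₃ h.b'_lim fun k => ?_
    have := pb k; have := pb' k
    simp only [src, tgt, scale, Matrix.cons_val]
    field_simp
  · refine hfac0 h.lim₃ h.c_lim fun k => ?_
    have := pb k; have := pb' k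
    simp only [src, tgt, scale, Matrix.cons_val]
    field_simp
  · refine hfac0 h.lim₄ h.b'_div_c'_lim fun k => ?_
    have := pb k; have := pb' k; have := pc' k
    simp only [src, tgt, scale, Matrix.cons_val]
    field_simp
  · rw [← one_mul (M 1 1)]
    refine hfac (tendsto_const_nhds.congr fun k => ?_)
    have := pb k; have := pb' k
    simp only [src, tgt, scale, Matrix.cons_val]
    field_simp
  · refine hfac' h12 (h.b'_mul_c_sq_lim.congr fun k => ?_)
    have := pb k; have := pb' k
    simp only [src, tgt, scale, Matrix.cons_val]
    field_simp
  · refine hfac (h.lim₄.congr fun k => ?_)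
    have := pb k; have := pb' k
    simp only [src, tgt, scale, Matrix.cons_val]
    field_simp
  · refine hfac' h21 (h.c_mul_c'_div_b'_lim.congr fun k => ?_)
    have := pb k; have := pb' k
    simp only [src, tgt, scale, Matrix.cons_val]
    field_simp
  · refine hfac' h22 (h.c'_mul_c_sq_lim.congr fun k => ?_)
    have := pb k; have := pb' k
    simp only [src, tgt, scale, Matrix.cons_val]
    field_simp

/-- The limit of the rescaled passage from the saddle of index two to that of index one. -/
theorem tendstoCrAt_second (h : SaddleScales a b c a' b' c' γ) (hr : 2 ≤ r) {T : E3 → E3}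
    {U : Set E3} (hU : IsOpen U) (hT : ContDiffOn ℝ r T U) {x : E3} (hx : x ∈ U)
    {M : Matrix (Fin 3) (Fin 3) ℝ} (hM : ∀ i j, fderiv ℝ T x (axis j) i = M i j)
    (h11 : M 1 1 = 0) (h12 : M 1 2 = 0) {p : ℕ → E3} (hO : (fun k => p k - x) =O[atTop] a')
    (w : E3) :
    TendstoCrAt r (fun k w => ((scale b b' k ^ 2)⁻¹ • diagMap ![scale b b' k, 1, scale b b' k])
        (T (p k + (scale b b' k • diagMap ![scale b b' k, 1, 1]) w) - T (p k)))
      (fun w => matMap !![0, M 0 1, M 0 2; M 1 0, 0, 0; 0, M 2 1, M 2 2] w + (1 / 2 : ℝ) •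
        diagMap ![0, 1, 0] (iteratedFDeriv ℝ 2 T x
          ![diagMap ![0, 1, 1] w, diagMap ![0, 1, 1] w])) w := by
  have hp : Tendsto p atTop (𝓝 x) := by
    have := (hO.trans_tendsto h.a'_lim).add_const x
    simpa using this
  have hδ : Tendsto (scale b b') atTop (𝓝 0) := h.δ_lim
  have hδ0 := fun k => (h.scale_pos k).ne'
  have hr1 : ((1 : ℕ∞) : WithTop ℕ∞) ≤ r := WithTop.coe_le_coe.2 (one_le_two.trans hr)
  have hE : ∀ i j, Tendsto (fun k => fderiv ℝ T (p k) (axis j) i) atTop (𝓝 (M i j)) := by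
    intro i j
    have h1 := ((hT.contDiffAt (hU.mem_nhds hx)).continuousAt_fderiv
      (fun h0 => by rw [h0] at hr1; simp at hr1)).tendsto.comp hp
    have h2 := tendsto_E3.1 (((ContinuousLinearMap.apply ℝ E3 (axis j)).continuous.tendsto _).comp
      h1) i
    rw [← hM]
    exact h2
  have hE' : ∀ i j, M i j = 0 → (fun k => fderiv ℝ T (p k) (axis j) i) =O[atTop] a' := by
    intro i j hij
    have := hT.isBigO_fderiv_entry hr hU hx hp hO i j
    simpa [hM, hij] using this
  refine tendstoCrAt_rescale_quadratic hr hU hT hx hp hδ hδ0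
    (tendsto_diagMap fun i => ?_) (tendsto_diagMap fun i => ?_) (tendsto_matMap fun i j => ?_) w
  · fin_cases i
    · simpa using hδ
    · simp
    · simp
  · fin_cases i
    · simpa using hδ
    · simp
    · simpa using hδ
  · simp only [smul_diagMap, diagMap_comp_comp_axis, Pi.smul_apply, smul_eq_mul]
    have hlim₃ : Tendsto (fun k => (scale b b' k)⁻¹ * a' k) atTop (𝓝 0) :=
      h.lim₃.congr fun k => by simp only [scale, inv_inv]; ring
    fin_cases i <;> fin_cases j <;>
      simp only [Fin.zero_eta, Fin.mk_one, Fin.reduceFinMk, Matrix.of_apply, Matrix.cons_val]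
    · have := hδ.mul (hE 0 0)
      rw [zero_mul] at this
      exact this.congr fun k => by have := hδ0 k; field_simp
    · exact (hE 0 1).congr fun k => by have := hδ0 k; field_simp
    · exact (hE 0 2).congr fun k => by have := hδ0 k; field_simp
    · exact (hE 1 0).congr fun k => by have := hδ0 k; field_simp
    · exact (tendsto_mul_of_isBigO (hE' 1 1 h11) hlim₃).congr fun k => by
        have := hδ0 k; field_simp
    · exact (tendsto_mul_of_isBigO (hE' 1 2 h12) hlim₃).congr fun k => by
        have := hδ0 k; field_simp
    · have := hδ.mul (hE 2 0)
      rw [zero_mul] at this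
      exact this.congr fun k => by have := hδ0 k; field_simp
    · exact (hE 2 1).congr fun k => by have := hδ0 k; field_simp
    · exact (hE 2 2).congr fun k => by have := hδ0 k; field_simp

end SaddleScales

theorem exists_nat_mul_sub_nat_mul_near {a b : ℝ} (ha : 0 < a) (hb : 0 < b)
    (hab : Irrational (a / b)) (t : ℝ) (N : ℕ) {ε : ℝ} (hε : 0 < ε) :
    ∃ m n : ℕ, N ≤ m ∧ N ≤ n ∧ |m * a - n * b - t| < ε := by
  have : Fact (0 < b) := ⟨hb⟩
  have hd : DenseRange (fun n : ℤ => n • (a : AddCircle b)) := AddCircle.denseRange_zsmul_coe_iff.2 hab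
  have hc : MapClusterPt (t : AddCircle b) atTop (fun n : ℕ => n • (a : AddCircle b)) :=
    ((mapClusterPt_atTop_nsmul_tfae (t : AddCircle b) (a : AddCircle b)).out 0 3).2 (hd _)
  have hU : ((↑) : ℝ → AddCircle b) '' Metric.ball t ε ∈ 𝓝 (t : AddCircle b) :=
    (QuotientAddGroup.isOpenMap_coe _ Metric.isOpen_ball).mem_nhds
      ⟨t, Metric.mem_ball_self hε, rfl⟩
  obtain ⟨M, hM⟩ := exists_nat_gt ((N * b + |t| + ε) / a)
  obtain ⟨m, hm, x, hx, hxm⟩ := (frequently_atTop.1 (hc.frequently hU)) (max N M)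
  have hxm' : ((m * a : ℝ) : AddCircle b) = (x : AddCircle b) := by
    rw [hxm, ← nsmul_eq_mul]; rfl
  have h0 : ((m * a - x : ℝ) : AddCircle b) = 0 := by
    rw [AddCircle.coe_sub, hxm', sub_self]
  obtain ⟨l, hl⟩ := (AddCircle.coe_eq_zero_iff b).1 h0
  rw [zsmul_eq_mul] at hl
  rw [Metric.mem_ball, Real.dist_eq] at hx
  have hma : N * b + |t| + ε < m * a := by
    have h1 : (M : ℝ) ≤ m := by exact_mod_cast (le_max_right _ _).trans hm
    rw [div_lt_iff₀ ha] at hM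
    nlinarith
  have hlN : (N : ℝ) < l := by
    have h1 := (abs_lt.1 hx).2
    have h2 := le_abs_self t
    have h3 : (N : ℝ) * b < l * b := by linarith
    exact lt_of_mul_lt_mul_right h3 hb.le
  have hlN' : (N : ℤ) < l := by exact_mod_cast hlN
  obtain ⟨n, rfl⟩ := Int.eq_ofNat_of_zero_le (show 0 ≤ l by omega)
  refine ⟨m, n, (le_max_left _ _).trans hm, by omega, ?_⟩
  rw [Int.cast_natCast] at hl
  rwa [hl, sub_sub_cancel]

theorem exists_seq_nat_mul_sub_nat_mul_tendsto {a b : ℝ} (ha : 0 < a) (hb : 0 < b)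
    (hab : Irrational (a / b)) (t : ℝ) :
    ∃ m n : ℕ → ℕ, Tendsto m atTop atTop ∧ Tendsto n atTop atTop ∧
      Tendsto (fun k => m k * a - n k * b) atTop (𝓝 t) := by
  choose m n hm hn hmn using fun k : ℕ => exists_nat_mul_sub_nat_mul_near ha hb hab t k
    (show (0 : ℝ) < 1 / (k + 1) by positivity)
  refine ⟨m, n, tendsto_atTop_mono hm tendsto_id, tendsto_atTop_mono hn tendsto_id, ?_⟩
  rw [tendsto_iff_dist_tendsto_zero]
  refine squeeze_zero (fun _ => dist_nonneg) (fun k => ?_)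
    (tendsto_one_div_add_atTop_nhds_zero_nat (𝕜 := ℝ))
  rw [Real.dist_eq]
  exact (hmn k).le

theorem tendsto_pow_mul_pow_zero {m n : ℕ → ℕ} (hm : Tendsto m atTop atTop)
    (hn : Tendsto n atTop atTop) {κ e : ℝ} (hκ : Tendsto (fun k => m k - κ * n k) atTop (𝓝 e))
    {A B : ℝ} (hA : 0 ≤ A) (hB : 0 ≤ B) (h : A ^ κ * B < 1) :
    Tendsto (fun k => A ^ m k * B ^ n k) atTop (𝓝 0) := by
  obtain rfl | hA := hA.eq_or_lt
  · refine tendsto_const_nhds.congr' ?_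
    filter_upwards [hm.eventually_ge_atTop 1] with k hk
    rw [zero_pow (by omega), zero_mul]
  · have h1 : Tendsto (fun k => (A ^ κ * B) ^ n k) atTop (𝓝 0) :=
      (tendsto_pow_atTop_nhds_zero_of_lt_one (by positivity) h).comp hn
    have h2 := (tendsto_const_nhds (x := A)).rpow hκ (Or.inl hA.ne')
    have h3 := h1.mul h2
    rw [zero_mul] at h3
    refine h3.congr fun k => ?_
    rw [mul_pow, ← Real.rpow_natCast (A ^ κ), ← Real.rpow_mul hA.le, mul_right_comm,
      ← Real.rpow_add hA]
    congr 1
    rw [← Real.rpow_natCast A]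
    congr 1
    ring

theorem exists_saddleScales {lam' sig' zet' lam sig zet : ℝ}
    (heigP : |lam'| < 1 ∧ 1 < |sig'| ∧ |sig'| < |zet'|)
    (heigQ : |lam| < |zet| ∧ |zet| < 1 ∧ 1 < |sig|)
    {κ : ℝ} (hκ : κ = Real.log |lam|⁻¹ / Real.log |zet'|)
    (heig₁ : |sig' * zet'| ^ κ * |sig * zet ^ 2| < 1)
    (heig₂ : |(sig' ^ 3)⁻¹ * zet'| ^ κ * |sig⁻¹| < 1)
    (heig₃ : |lam' * sig'| ^ κ * |sig| < 1)
    (hirr : Irrational (Real.log |zet'| / Real.log |lam|)) {γ : ℝ} (hγ : 0 < γ) :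
    ∃ m n : ℕ → ℕ, Tendsto m atTop atTop ∧ Tendsto n atTop atTop ∧
      SaddleScales (fun k => lam ^ n k) (fun k => sig ^ n k) (fun k => zet ^ n k)
        (fun k => lam' ^ m k) (fun k => sig' ^ m k) (fun k => zet' ^ m k) γ := by
  obtain ⟨hl', hs', hz'⟩ := heigP
  obtain ⟨hl, hz, hs⟩ := heigQ
  have hlz : 0 < Real.log |zet'| := Real.log_pos (hs'.trans hz')
  have hlam0 : lam ≠ 0 := by
    rintro rfl
    simp [Irrational] at hirr
  have hlamp : 0 < |lam| := abs_pos.2 hlam0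
  have hll : 0 < Real.log |lam|⁻¹ := by
    rw [Real.log_inv, neg_pos]
    exact Real.log_neg hlamp (hl.trans hz)
  have hirr' : Irrational (2 * Real.log |zet'| / (2 * Real.log |lam|⁻¹)) := by
    rw [mul_div_mul_left _ _ two_ne_zero, Real.log_inv, div_neg]
    exact hirr.neg
  obtain ⟨m, n, hm, hn, hmn⟩ := exists_seq_nat_mul_sub_nat_mul_tendsto
    (mul_pos two_pos hlz) (mul_pos two_pos hll) hirr' (Real.log γ)
  have h2m : Tendsto (fun k => 2 * m k) atTop atTop :=
    tendsto_atTop_mono (fun k => by omega) hm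
  have h2n : Tendsto (fun k => 2 * n k) atTop atTop :=
    tendsto_atTop_mono (fun k => by omega) hn
  have hκ' : Tendsto (fun k => ((2 * m k : ℕ) : ℝ) - κ * (2 * n k : ℕ)) atTop
      (𝓝 (Real.log γ / Real.log |zet'|)) := by
    refine (hmn.div_const _).congr fun k => ?_
    rw [hκ]
    push_cast
    field_simp
  have key : ∀ {A B : ℝ}, |A| ^ κ * |B| < 1 →
      Tendsto (fun k => A ^ (2 * m k) * B ^ (2 * n k)) atTop (𝓝 0) := fun {A B} h =>
    (tendsto_pow_mul_pow_zero h2m h2n hκ' (abs_nonneg A) (abs_nonneg B) h).congr fun k => by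
      rw [(even_two_mul _).pow_abs, (even_two_mul _).pow_abs]
  have hpos : ∀ {x : ℝ} (j : ℕ), x ≠ 0 → 0 < x ^ (2 * j) := fun j hx =>
    (even_two_mul j).pow_pos hx
  have hne : ∀ {x : ℝ}, 1 < |x| → x ≠ 0 := by
    rintro x hx rfl
    simp at hx
    linarith
  have hz0 : zet ≠ 0 := abs_pos.1 (hlamp.trans hl)
  have hinv : ∀ {x : ℝ}, 1 < |x| → |x⁻¹| < 1 := fun hx => by
    rw [abs_inv]; exact inv_lt_one_of_one_lt₀ hx
  refine ⟨fun k => 2 * m k, fun k => 2 * n k, h2m, h2n, ?_⟩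
  have nlim : ∀ {x : ℝ}, |x| < 1 → Tendsto (fun k => x ^ (2 * n k)) atTop (𝓝 0) := fun hx =>
    (tendsto_pow_atTop_nhds_zero_of_abs_lt_one hx).comp h2n
  have mlim : ∀ {x : ℝ}, |x| < 1 → Tendsto (fun k => x ^ (2 * m k)) atTop (𝓝 0) := fun hx =>
    (tendsto_pow_atTop_nhds_zero_of_abs_lt_one hx).comp h2m
  exact
    { a_pos := fun k => hpos _ hlam0
      b_pos := fun k => hpos _ (hne hs)
      c_pos := fun k => hpos _ hz0
      b'_pos := fun k => hpos _ (hne hs')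
      c'_pos := fun k => hpos _ (hne (hs'.trans hz'))
      a'_nonneg := fun k => (even_two_mul _).pow_nonneg _
      a_le_c := fun k => by
        rw [← (even_two_mul (n k)).pow_abs lam, ← (even_two_mul (n k)).pow_abs zet]
        exact pow_le_pow_left₀ (abs_nonneg _) hl.le _
      c_lim := nlim hz
      b_lim := (nlim (hinv hs)).congr fun k => inv_pow _ _
      a'_lim := mlim hl'
      b'_lim := (mlim (hinv hs')).congr fun k => inv_pow _ _
      c'_lim := (mlim (hinv (hs'.trans hz'))).congr fun k => inv_pow _ _
      b'_div_c'_lim := by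
        have : |sig' / zet'| < 1 := by
          rw [abs_div, div_lt_one ((zero_lt_one.trans hs').trans hz')]
          exact hz'
        exact (mlim this).congr fun k => div_pow _ _ _
      lim₁ := (key heig₁).congr fun k => by ring
      lim₂ := (key heig₂).congr fun k => by
        have := hne hs
        have := hne hs'
        rw [mul_pow, inv_pow, inv_pow]
        field_simp
        ring
      lim₃ := (key heig₃).congr fun k => by rw [mul_pow]
      lim₄ := by
        have h1 := (Real.continuous_exp.tendsto _).comp hmn
        rw [Real.exp_log hγ] at h1
        refine h1.congr fun k => ?_
        have e1 : Real.exp (Real.log |zet'|) = |zet'| :=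
          Real.exp_log ((zero_lt_one.trans hs').trans hz')
        have e2 : Real.exp (Real.log |lam|) = |lam| := Real.exp_log hlamp
        have : (m k : ℝ) * (2 * Real.log |zet'|) - n k * (2 * Real.log |lam|⁻¹) =
            ((2 * m k : ℕ) : ℝ) * Real.log |zet'| + ((2 * n k : ℕ) : ℝ) * Real.log |lam| := by
          rw [Real.log_inv]; push_cast; ring
        simp only [Function.comp]
        rw [this, Real.exp_add, Real.exp_nat_mul, Real.exp_nat_mul, e1, e2,
          (even_two_mul _).pow_abs, (even_two_mul _).pow_abs] }

theorem E3.norm_le_sum (v : E3) : ‖v‖ ≤ |v 0| + |v 1| + |v 2| := by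
  conv_lhs => rw [E3.eq_sum_axis v]
  refine norm_add₃_le.trans (le_of_eq ?_)
  simp [norm_smul, axis]

theorem diagMap_pow_tendsto {ι : Type*} {l : Filter ι} {d : Fin 3 → ℝ} {v : ι → E3} {w : E3}
    (h : Tendsto v l (𝓝 w)) : Tendsto (fun k => diagMap d (v k)) l (𝓝 (diagMap d w)) :=
  ((diagMap d).continuous.tendsto w).comp h

/-- Points whose `n`-th image under a linear saddle is close to the point `q` of the unstable
subspace and which are close to the point `p` of the stable subspace have an orbit segment which
stays close to the orbits of `p` and `q` and to the origin. -/
theorem eventually_diagMap_pow_mem {ι : Type*} {l : Filter ι} {d : Fin 3 → ℝ}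
    (hd : ∀ i, |d i| < 1 ∨ 1 < |d i|) {O : Set E3} (hO : IsOpen O) (h0 : (0 : E3) ∈ O) {p q : E3}
    (hp : ∀ j, diagMap (d ^ j) p ∈ O) (hq : ∀ j, diagMap (d⁻¹ ^ (j + 1)) q ∈ O)
    (hq0 : ∀ i, |d i| < 1 → q i = 0)
    {n : ι → ℕ} (hn : Tendsto n l atTop) {c : ι → E3} (hc : Tendsto c l (𝓝 p))
    (hcn : Tendsto (fun k => diagMap (d ^ n k) (c k)) l (𝓝 q)) :
    ∀ᶠ k in l, ∀ j < n k, diagMap (d ^ j) (c k) ∈ O := by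
  obtain ⟨ε, hε, hεO⟩ := Metric.isOpen_iff.1 hO 0 h0
  set C := ‖p‖ + ‖q‖ + 1 with hC
  have hCp : 0 < C := by positivity
  have hJ : ∀ i, ∀ᶠ J : ℕ in atTop, (|d i| < 1 → |d i| ^ J * C < ε / 3) ∧
      (1 < |d i| → |d i|⁻¹ ^ J * C < ε / 3) := by
    intro i
    have aux : ∀ x : ℝ, 0 ≤ x → x < 1 → ∀ᶠ J : ℕ in atTop, x ^ J * C < ε / 3 := fun x hx0 hx1 => by
      have := (tendsto_pow_atTop_nhds_zero_of_lt_one hx0 hx1).mul_const C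
      rw [zero_mul] at this
      exact this.eventually (gt_mem_nhds (by positivity))
    rcases hd i with h | h
    · filter_upwards [aux _ (abs_nonneg _) h] with J hJ
      exact ⟨fun _ => hJ, fun h' => absurd h h'.not_gt⟩
    · filter_upwards [aux _ (by positivity) (inv_lt_one_of_one_lt₀ h)] with J hJ
      exact ⟨fun h' => absurd h h'.not_gt, fun _ => hJ⟩
  obtain ⟨J, hJ⟩ := (eventually_all.2 hJ).exists
  have hbd : ∀ {v : ι → E3} {w : E3}, Tendsto v l (𝓝 w) → ‖w‖ < C → ∀ᶠ k in l, ∀ i, |v k i| ≤ C :=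
    fun hv hw => (hv.norm.eventually (gt_mem_nhds hw)).mono fun k hk i =>
      (E3.abs_apply_le_norm _ i).trans hk.le
  have hearly : ∀ᶠ k in l, ∀ j ∈ Finset.range J, diagMap (d ^ j) (c k) ∈ O := by
    rw [Filter.eventually_all_finset]
    intro j _
    exact (diagMap_pow_tendsto hc).eventually (hO.eventually_mem (hp j))
  have hlate : ∀ᶠ k in l, ∀ i ∈ Finset.range J, diagMap (d ^ (n k - (i + 1))) (c k) ∈ O := by
    rw [Filter.eventually_all_finset]
    intro i _
    refine Tendsto.eventually ?_ (hO.eventually_mem (hq i))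
    rw [tendsto_E3]
    intro s
    simp only [diagMap_apply, Pi.pow_apply, Pi.inv_apply]
    rcases hd s with h | h
    · have h1 : Tendsto (fun k => d s ^ (n k - (i + 1)) * c k s) l (𝓝 (0 * p s)) :=
        ((tendsto_pow_atTop_nhds_zero_of_abs_lt_one h).comp
          ((tendsto_sub_atTop_nat _).comp hn)).mul (tendsto_E3.1 hc s)
      rw [hq0 s h, mul_zero]
      rwa [zero_mul] at h1
    · refine ((tendsto_E3.1 hcn s).const_mul _).congr' ?_
      filter_upwards [hn.eventually_ge_atTop (i + 1)] with k hk
      have hds : d s ≠ 0 := by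
        intro h'
        rw [h', abs_zero] at h
        linarith
      rw [diagMap_apply, Pi.pow_apply, pow_sub₀ _ hds hk, inv_pow]
      ring
  filter_upwards [hearly, hlate, hbd hc (by rw [hC]; linarith [norm_nonneg q]),
    hbd hcn (by rw [hC]; linarith [norm_nonneg p])] with k h1 h2 h3 h4 j hj
  by_cases hjJ : j < J
  · exact h1 j (Finset.mem_range.2 hjJ)
  by_cases hnj : n k - j ≤ J
  · have := h2 (n k - j - 1) (Finset.mem_range.2 (by omega))
    rwa [show n k - (n k - j - 1 + 1) = j by omega] at this
  push Not at hjJ hnj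
  refine hεO ?_
  rw [mem_ball_zero_iff]
  have hi : ∀ i, |diagMap (d ^ j) (c k) i| < ε / 3 := by
    intro i
    rw [diagMap_apply, Pi.pow_apply, abs_mul, abs_pow]
    rcases hd i with h | h
    · refine lt_of_le_of_lt ?_ ((hJ i).1 h)
      exact mul_le_mul (pow_le_pow_of_le_one (abs_nonneg _) h.le hjJ) (h3 i) (abs_nonneg _)
        (by positivity)
    · refine lt_of_le_of_lt ?_ ((hJ i).2 h)
      have hpos : 0 < |d i| := zero_lt_one.trans h
      have h5 := h4 i
      rw [diagMap_apply, Pi.pow_apply, abs_mul, abs_pow] at h5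
      have h6 : |d i| ^ j * |c k i| = |d i|⁻¹ ^ (n k - j) * (|d i| ^ n k * |c k i|) := by
        have h7 : |d i| ^ n k = |d i| ^ (n k - j) * |d i| ^ j := by
          rw [← pow_add, Nat.sub_add_cancel hj.le]
        rw [inv_pow, h7]
        field_simp
      rw [h6]
      exact mul_le_mul (pow_le_pow_of_le_one (by positivity)
        (inv_le_one_of_one_le₀ h.le) hnj.le) h5 (by positivity) (by positivity)
  have := E3.norm_le_sum (diagMap (d ^ j) (c k))
  linarith [hi 0, hi 1, hi 2]

theorem iterate_eq_of_eq_off {M : Type*} {f F : M → M} {S : Set M} (hF : ∀ q, f q ∉ S → F q = f q) {q : M}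
    {n : ℕ} (h : ∀ i, 1 ≤ i → i ≤ n → f^[i] q ∉ S) : F^[n] q = f^[n] q := by
  induction n with
  | zero => rfl
  | succ n ih =>
    rw [iterate_succ_apply', iterate_succ_apply', ih fun i h1 h2 => h i h1 (by omega)]
    refine hF _ ?_
    rw [← iterate_succ_apply' f]
    exact h (n + 1) (by omega) le_rfl

section

variable {M : Type*} [TopologicalSpace M]

theorem iterate_eq_symm_diagMap_pow {φ : OpenPartialHomeomorph M E3} {g : M → M} {d : Fin 3 → ℝ}
    {Ω : Set M} (hg : ∀ q ∈ Ω, g q ∈ φ.source ∧ φ (g q) = diagMap d (φ q)) {c : E3}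
    (hc : c ∈ φ.target) {n : ℕ}
    (h : ∀ j < n, diagMap (d ^ j) c ∈ φ.target ∩ φ.symm ⁻¹' Ω) :
    g^[n] (φ.symm c) ∈ φ.source ∧ φ (g^[n] (φ.symm c)) = diagMap (d ^ n) c := by
  induction n with
  | zero =>
    refine ⟨φ.map_target hc, ?_⟩
    rw [iterate_zero, id, φ.right_inv hc]
    ext i; simp [diagMap_apply]
  | succ n ih =>
    obtain ⟨h1, h2⟩ := ih fun j hj => h j (hj.trans (Nat.lt_succ_self n))
    have h3 := h n (Nat.lt_succ_self n)
    have h4 : g^[n] (φ.symm c) = φ.symm (diagMap (d ^ n) c) := by rw [← h2, φ.left_inv h1]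
    have h5 : g^[n] (φ.symm c) ∈ Ω := by rw [h4]; exact h3.2
    rw [iterate_succ_apply']
    refine ⟨(hg _ h5).1, ?_⟩
    rw [(hg _ h5).2, h2]
    ext i
    simp only [diagMap_apply, Pi.pow_apply]
    ring

theorem tendsto_iterate_mul {f : M → M} {a p : M} {m : ℕ}
    (h : Tendsto (fun j : ℕ => (f^[m])^[j] a) atTop (𝓝 p)) {l : ℕ} (hl : 0 < l) :
    Tendsto (fun j : ℕ => f^[m * l * j] a) atTop (𝓝 p) := by
  have h1 : Tendsto (fun j : ℕ => l * j) atTop atTop :=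
    tendsto_atTop_mono (fun j => Nat.le_mul_of_pos_left j hl) tendsto_id
  refine (h.comp h1).congr fun j => ?_
  simp only [Function.comp]
  rw [← iterate_mul, mul_assoc]

variable [T2Space M]

theorem eq_of_mem_periodicPts_of_tendsto {f : M → M} {a p : M} {m : ℕ}
    (h : Tendsto (fun j : ℕ => (f^[m])^[j] a) atTop (𝓝 p)) (ha : a ∈ periodicPts f) : a = p := by
  obtain ⟨l, hl, hper⟩ := ha
  refine tendsto_nhds_unique (tendsto_const_nhds.congr fun j => ?_) (tendsto_iterate_mul h hl)
  have := (hper.const_mul m).mul_const j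
  exact this.symm

theorem iterate_eq_of_tendsto {f : M → M} (hf : Continuous f) {a b p q : M} {m n : ℕ} (hm : 0 < m)
    (hn : 0 < n) (ha : Tendsto (fun j : ℕ => (f^[m])^[j] a) atTop (𝓝 p))
    (hb : Tendsto (fun j : ℕ => (f^[n])^[j] b) atTop (𝓝 q)) {l : ℕ} (hl : f^[l] a = b) :
    f^[l] p = q := by
  have h1 := ((hf.iterate l).tendsto p).comp (tendsto_iterate_mul ha hn)
  have h2 := tendsto_iterate_mul hb hm
  refine tendsto_nhds_unique h1 (h2.congr fun j => ?_)
  simp only [Function.comp]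
  rw [← hl, ← iterate_add_apply, ← iterate_add_apply, mul_comm n m, add_comm]

/-- The closure of a half-orbit which converges to a periodic orbit. -/
theorem exists_isClosed_halfOrbit {f : M → M} (hf : Continuous f) {y p : M} {m : ℕ} (hm : 0 < m)
    (h : Tendsto (fun j : ℕ => (f^[m])^[j] y) atTop (𝓝 p)) :
    ∃ K : Set M, IsClosed K ∧ (∀ i, f^[i] y ∈ K) ∧
      ∀ x ∈ K, (∃ i, x = f^[i] y) ∨ ∃ i, x = f^[i] p := by
  refine ⟨⋃ s ∈ Finset.range m, insert (f^[s] p) (range fun j => f^[s] ((f^[m])^[j] y)), ?_, ?_, ?_⟩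
  · refine isClosed_biUnion_finset fun s _ => ?_
    exact (((hf.iterate s).tendsto p).comp h).isCompact_insert_range.isClosed
  · intro i
    refine mem_iUnion₂.2 ⟨i % m, Finset.mem_range.2 (Nat.mod_lt _ hm), Or.inr ⟨i / m, ?_⟩⟩
    simp only
    rw [← iterate_mul, ← iterate_add_apply, Nat.mod_add_div]
  · intro x hx
    obtain ⟨s, _, hx⟩ := mem_iUnion₂.1 hx
    rcases hx with rfl | ⟨j, rfl⟩
    · exact Or.inr ⟨s, rfl⟩
    · refine Or.inl ⟨s + m * j, ?_⟩
      simp only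
      rw [← iterate_mul, ← iterate_add_apply]

/-- For heteroclinic points `a` and `b` of a cycle there is a closed set containing the
other points of their orbits and the orbits of the saddles. -/
theorem exists_isClosed_cycle (f : M ≃ₜ M) {P Q : M} {m n : ℕ} (hm : 0 < m) (hn : 0 < n)
    (hP : f^[m] P = P) (hQ : f^[n] Q = Q) (hPQ : ∀ l, f^[l] P ≠ Q) (hQP : ∀ l, f^[l] Q ≠ P)
    {a b X Y : M} {N₁ N₂ : ℕ} (hN₁ : 0 < N₁) (hN₂ : 0 < N₂) (hXa : f^[N₁] X = a)
    (hYb : f^[N₂] Y = b) (haP : a ≠ P) (hbQ : b ≠ Q)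
    (ha : Tendsto (fun j : ℕ => (f^[m])^[j] a) atTop (𝓝 P))
    (hb : Tendsto (fun j : ℕ => (f^[n])^[j] b) atTop (𝓝 Q))
    (hX : Tendsto (fun j : ℕ => (f.symm^[n])^[j] X) atTop (𝓝 Q))
    (hY : Tendsto (fun j : ℕ => (f.symm^[m])^[j] Y) atTop (𝓝 P)) :
    a ≠ b ∧ ∃ K : Set M, IsClosed K ∧ a ∉ K ∧ b ∉ K ∧ (∀ i, f^[i] P ∈ K) ∧ (∀ i, f^[i] Q ∈ K) ∧
      (∀ i, f^[i + 1] a ∈ K) ∧ (∀ i, f^[i + 1] b ∈ K) ∧ (∀ i, f.symm^[i] X ∈ K) ∧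
      (∀ i, f.symm^[i] Y ∈ K) ∧ (∀ i < N₁, f^[i] X ∈ K) ∧ ∀ i < N₂, f^[i] Y ∈ K := by
  have hc := f.continuous
  have hc' := f.symm.continuous
  have hstep : ∀ {c p : M} {m : ℕ}, Tendsto (fun j : ℕ => (f^[m])^[j] c) atTop (𝓝 p) →
      Tendsto (fun j : ℕ => (f^[m])^[j] (f c)) atTop (𝓝 (f p)) := fun {c p m} h => by
    refine ((hc.tendsto p).comp h).congr fun j => ?_
    simp only [Function.comp]
    rw [← iterate_mul, ← iterate_succ_apply, iterate_succ_apply']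
  have hconst : ∀ {p : M} {m : ℕ}, f^[m] p = p →
      Tendsto (fun j : ℕ => (f^[m])^[j] p) atTop (𝓝 p) := fun {p m} h =>
    tendsto_const_nhds.congr fun j => (IsFixedPt.iterate h j).symm
  obtain ⟨K₁, c₁, m₁, d₁⟩ := exists_isClosed_halfOrbit hc hm (hstep ha)
  obtain ⟨K₂, c₂, m₂, d₂⟩ := exists_isClosed_halfOrbit hc hn (hstep hb)
  obtain ⟨K₃, c₃, m₃, d₃⟩ := exists_isClosed_halfOrbit hc' hn hX
  obtain ⟨K₄, c₄, m₄, d₄⟩ := exists_isClosed_halfOrbit hc' hm hY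
  obtain ⟨K₅, c₅, m₅, d₅⟩ := exists_isClosed_halfOrbit hc hm (hconst hP)
  obtain ⟨K₆, c₆, m₆, d₆⟩ := exists_isClosed_halfOrbit hc hn (hconst hQ)
  have hPp : P ∈ periodicPts f := ⟨m, hm, hP⟩
  have hQp : Q ∈ periodicPts f := ⟨n, hn, hQ⟩
  have hap : a ∉ periodicPts f := fun h => haP (eq_of_mem_periodicPts_of_tendsto ha h)
  have hbp : b ∉ periodicPts f := fun h => hbQ (eq_of_mem_periodicPts_of_tendsto hb h)
  have hab : ∀ l, f^[l] a ≠ b := fun l hl => hPQ l (iterate_eq_of_tendsto hc hm hn ha hb hl)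
  have hba : ∀ l, f^[l] b ≠ a := fun l hl => hQP l (iterate_eq_of_tendsto hc hn hm hb ha hl)
  have haa : ∀ l, f^[l + 1] a ≠ a := fun l hl => hap ⟨l + 1, l.succ_pos, hl⟩
  have hbb : ∀ l, f^[l + 1] b ≠ b := fun l hl => hbp ⟨l + 1, l.succ_pos, hl⟩
  have hfwd : ∀ {p : M}, p ∈ periodicPts f → ∀ i, f^[i] p ∈ periodicPts f := fun hp i => by
    obtain ⟨l, hl, hper⟩ := hp
    exact ⟨l, hl, hper.apply_iterate i⟩
  have hbwd : ∀ {p : M}, p ∈ periodicPts f → ∀ i, f.symm^[i] p ∈ periodicPts f := fun {p} hp i => by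
    obtain ⟨l, hl, hper⟩ := hp
    refine ⟨l, hl, ?_⟩
    have hcomm : f ∘ f.symm = f.symm ∘ f := by ext; simp
    have h2 : Function.Commute f f.symm := fun x => congrFun hcomm x
    have : f^[l] (f.symm^[i] p) = f.symm^[i] (f^[l] p) := (h2.iterate_iterate l i) p
    exact this.trans (congrArg _ hper)
  have hinv : ∀ i x, f^[i] (f.symm^[i] x) = x := fun i x =>
    (Function.LeftInverse.iterate f.apply_symm_apply i) x
  have hfx : ∀ {c : M}, c ∉ periodicPts f → (∀ l, f^[l + 1] a ≠ c) → (∀ l, f^[l + 1] b ≠ c) →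
      (∀ l, f^[l + 1] c ≠ a) → (∀ l, f^[l + 1] c ≠ b) →
      c ∉ K₁ ∪ K₂ ∪ K₃ ∪ K₄ ∪ K₅ ∪ K₆ ∪ (fun i => f^[i] X) '' Set.Iio N₁ ∪
        (fun i => f^[i] Y) '' Set.Iio N₂ := by
    intro c hcp h1 h2 h3 h4 hmem
    simp only [mem_union] at hmem
    rcases hmem with ((((((h | h) | h) | h) | h) | h) | h) | h
    · rcases d₁ c h with ⟨i, hi⟩ | ⟨i, hi⟩
      · exact h1 i (by rw [iterate_succ_apply]; exact hi.symm)
      · exact hcp (hi ▸ hfwd (hfwd hPp 1) i)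
    · rcases d₂ c h with ⟨i, hi⟩ | ⟨i, hi⟩
      · exact h2 i (by rw [iterate_succ_apply]; exact hi.symm)
      · exact hcp (hi ▸ hfwd (hfwd hQp 1) i)
    · rcases d₃ c h with ⟨i, hi⟩ | ⟨i, hi⟩
      · refine h3 (N₁ - 1 + i) ?_
        rw [show N₁ - 1 + i + 1 = N₁ + i by omega, iterate_add_apply, hi, hinv, hXa]
      · exact hcp (hi ▸ hbwd hQp i)
    · rcases d₄ c h with ⟨i, hi⟩ | ⟨i, hi⟩
      · refine h4 (N₂ - 1 + i) ?_
        rw [show N₂ - 1 + i + 1 = N₂ + i by omega, iterate_add_apply, hi, hinv, hYb]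
      · exact hcp (hi ▸ hbwd hPp i)
    · rcases d₅ c h with ⟨i, hi⟩ | ⟨i, hi⟩ <;> exact hcp (hi ▸ hfwd hPp i)
    · rcases d₆ c h with ⟨i, hi⟩ | ⟨i, hi⟩ <;> exact hcp (hi ▸ hfwd hQp i)
    · obtain ⟨i, hi, rfl⟩ := h
      have hi' : i < N₁ := hi
      refine h3 (N₁ - i - 1) ?_
      rw [← iterate_add_apply, show N₁ - i - 1 + 1 + i = N₁ by omega, hXa]
    · obtain ⟨i, hi, rfl⟩ := h
      have hi' : i < N₂ := hi
      refine h4 (N₂ - i - 1) ?_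
      rw [← iterate_add_apply, show N₂ - i - 1 + 1 + i = N₂ by omega, hYb]
  refine ⟨hab 0, K₁ ∪ K₂ ∪ K₃ ∪ K₄ ∪ K₅ ∪ K₆ ∪ (fun i => f^[i] X) '' Set.Iio N₁ ∪
        (fun i => f^[i] Y) '' Set.Iio N₂, ?_, hfx hap haa (fun l => hba _) haa (fun l => hab _),
    hfx hbp (fun l => hab _) hbb (fun l => hba _) hbb, ?_, ?_, ?_, ?_, ?_, ?_, ?_, ?_⟩
  · exact (((((((c₁.union c₂).union c₃).union c₄).union c₅).union c₆).union
      ((finite_Iio N₁).image _).isClosed).union ((finite_Iio N₂).image _).isClosed)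
  all_goals intro i
  · simp [m₅ i]
  · simp [m₆ i]
  · have := m₁ i
    rw [← iterate_succ_apply] at this
    simp only [mem_union, this, true_or]
  · have := m₂ i
    rw [← iterate_succ_apply] at this
    simp only [mem_union, this, true_or, or_true]
  · simp [m₃ i]
  · simp [m₄ i]
  · intro hi
    exact Or.inl (Or.inr ⟨i, hi, rfl⟩)
  · intro hi
    exact Or.inr ⟨i, hi, rfl⟩

end

section

variable {M : Type*} [TopologicalSpace M]

theorem isOpen_inCharts_domain (φ ψ : OpenPartialHomeomorph M E3) {F : M → M}
    (hF : Continuous F) : IsOpen (φ.target ∩ φ.symm ⁻¹' (F ⁻¹' ψ.source)) :=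
  φ.isOpen_inter_preimage_symm (ψ.open_source.preimage hF)

open Classical in
/-- The extension by the identity of a map which is given in a chart. -/
noncomputable def extendChart (φ : OpenPartialHomeomorph M E3) (h : E3 → E3) (q : M) : M :=
  if q ∈ φ.source then φ.symm (h (φ q)) else q

theorem extendChart_of_notMem {φ : OpenPartialHomeomorph M E3} {h : E3 → E3} {K : Set E3}
    (hK : ∀ v ∉ K, h v = v) {q : M} (hq : q ∉ φ.symm '' K) : extendChart φ h q = q := by
  unfold extendChart
  split_ifs with hs
  · rw [hK, φ.left_inv hs]
    intro hmem
    exact hq ⟨φ q, hmem, φ.left_inv hs⟩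
  · rfl

theorem extendChart_extendChart {φ : OpenPartialHomeomorph M E3} {h h' : E3 → E3}
    (ht : MapsTo h φ.target φ.target) (hinv : LeftInverse h' h) (q : M) :
    extendChart φ h' (extendChart φ h q) = q := by
  unfold extendChart
  by_cases hs : q ∈ φ.source
  · have := ht (φ.map_source hs)
    simp only [hs, if_true, φ.map_target this, φ.right_inv this, hinv (φ q), φ.left_inv hs]
  · simp only [hs, if_false]

variable [ChartedSpace E3 M]

theorem contDiffOn_inCharts {r : ℕ∞} {φ ψ : OpenPartialHomeomorph M E3}
    (hφ : φ ∈ IsManifold.maximalAtlas (𝓡 3) r M) (hψ : ψ ∈ IsManifold.maximalAtlas (𝓡 3) r M)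
    {F : M → M} (hF : ContMDiff (𝓡 3) (𝓡 3) r F) :
    ContDiffOn ℝ r (inCharts φ ψ F) (φ.target ∩ φ.symm ⁻¹' (F ⁻¹' ψ.source)) := by
  rw [← contMDiffOn_iff_contDiffOn]
  refine (contMDiffOn_of_mem_maximalAtlas hψ).comp
    ((hF.comp_contMDiffOn (contMDiffOn_symm_of_mem_maximalAtlas hφ)).mono inter_subset_left) ?_
  intro v hv
  exact hv.2

theorem fderiv_inCharts_injective {r : ℕ∞} (hr : 1 ≤ r) {φ ψ : OpenPartialHomeomorph M E3}
    (hφ : φ ∈ IsManifold.maximalAtlas (𝓡 3) r M) (hψ : ψ ∈ IsManifold.maximalAtlas (𝓡 3) r M)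
    {F F' : M → M} (hF : ContMDiff (𝓡 3) (𝓡 3) r F) (hF' : ContMDiff (𝓡 3) (𝓡 3) r F')
    (hinv : LeftInverse F' F) {q : M} (hq : q ∈ φ.source) (hFq : F q ∈ ψ.source) :
    Injective (fderiv ℝ (inCharts φ ψ F) (φ q)) := by
  have hr0 : (r : WithTop ℕ∞) ≠ 0 := by
    intro h
    have h1 : ((1 : ℕ∞) : WithTop ℕ∞) ≤ r := WithTop.coe_le_coe.2 hr
    rw [h] at h1
    simp at h1
  have hmem : φ q ∈ φ.target ∩ φ.symm ⁻¹' (F ⁻¹' ψ.source) :=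
    ⟨φ.map_source hq, by simpa [φ.left_inv hq] using hFq⟩
  have hval : inCharts φ ψ F (φ q) = ψ (F q) := by simp [inCharts, φ.left_inv hq]
  have hmem' : inCharts φ ψ F (φ q) ∈ ψ.target ∩ ψ.symm ⁻¹' (F' ⁻¹' φ.source) := by
    rw [hval]
    exact ⟨ψ.map_source hFq, by simpa [ψ.left_inv hFq, hinv q] using hq⟩
  have hopen := isOpen_inCharts_domain φ ψ hF.continuous
  have h1 := (((contDiffOn_inCharts hφ hψ hF).contDiffAt
    (hopen.mem_nhds hmem)).differentiableAt hr0).hasFDerivAt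
  have h2 := (((contDiffOn_inCharts hψ hφ hF').contDiffAt
    ((isOpen_inCharts_domain ψ φ hF'.continuous).mem_nhds hmem')).differentiableAt hr0).hasFDerivAt
  have h3 := h2.comp (φ q) h1
  have h4 : inCharts ψ φ F' ∘ inCharts φ ψ F =ᶠ[𝓝 (φ q)] id := by
    filter_upwards [hopen.mem_nhds hmem] with v hv
    have hv2 : F (φ.symm v) ∈ ψ.source := hv.2
    simp only [Function.comp, inCharts, ψ.left_inv hv2, hinv (φ.symm v), φ.right_inv hv.1, id]
  have h5 := h3.unique ((hasFDerivAt_id (φ q)).congr_of_eventuallyEq h4)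
  intro u v huv
  have := congrArg (fderiv ℝ (inCharts ψ φ F') (inCharts φ ψ F (φ q))) huv
  have h6 := fun w => DFunLike.congr_fun h5 w
  simp only [ContinuousLinearMap.comp_apply, ContinuousLinearMap.id_apply] at h6
  rwa [h6, h6] at this

theorem iterate_contMDiff {r : ℕ∞} (f : M ≃ₘ^r⟮𝓡 3, 𝓡 3⟯ M) (n : ℕ) :
    ContMDiff (𝓡 3) (𝓡 3) r f^[n] := f.contMDiff.iterate n

theorem trans_homeomorph_mem_maximalAtlas {r : ℕ∞} {φ : OpenPartialHomeomorph M E3}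
    (hφ : φ ∈ IsManifold.maximalAtlas (𝓡 3) r M) (A : E3 ≃ₜ E3) (hA : ContDiff ℝ r A)
    (hA' : ContDiff ℝ r A.symm) :
    φ.trans A.toOpenPartialHomeomorph ∈ IsManifold.maximalAtlas (𝓡 3) r M := by
  have hmem : A.toOpenPartialHomeomorph ∈ contDiffGroupoid r (𝓡 3) := by
    rw [contDiffGroupoid, mem_groupoid_of_pregroupoid]
    constructor
    · simpa [contDiffPregroupoid, Function.comp_def] using hA.contDiffOn
    · simpa [contDiffPregroupoid, Function.comp_def] using hA'.contDiffOn
  rw [IsManifold.mem_maximalAtlas_iff, mem_maximalAtlas_iff]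
  rw [IsManifold.mem_maximalAtlas_iff, mem_maximalAtlas_iff] at hφ
  intro e' he'
  obtain ⟨h1, h2⟩ := hφ e' he'
  constructor
  · rw [OpenPartialHomeomorph.trans_symm_eq_symm_trans_symm, OpenPartialHomeomorph.trans_assoc]
    exact StructureGroupoid.trans _ (StructureGroupoid.symm _ hmem) h1
  · rw [← OpenPartialHomeomorph.trans_assoc]
    exact StructureGroupoid.trans _ h2 hmem

variable [T2Space M]

theorem contMDiffOn_extendChart {r : ℕ∞} {φ : OpenPartialHomeomorph M E3}
    (hφ : φ ∈ IsManifold.maximalAtlas (𝓡 3) r M) {K : Set E3} (hK : IsCompact K)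
    (hKφ : K ⊆ φ.target) {h : E3 → E3 → E3} (hh : ContDiff ℝ r fun q : E3 × E3 => h q.1 q.2)
    (hfix : ∀ μ, ∀ v ∉ K, h μ v = v) {C : Set E3}
    (ht : ∀ μ ∈ C, MapsTo (h μ) φ.target φ.target) :
    ContMDiffOn (𝓘(ℝ, E3).prod (𝓡 3)) (𝓡 3) r
      (fun q : E3 × M => extendChart φ (h q.1) q.2) (C ×ˢ univ) := by
  have hclosed : IsClosed (φ.symm '' K) :=
    (hK.image_of_continuousOn (φ.continuousOn_symm.mono hKφ)).isClosed
  have h1 : ContMDiffOn (𝓘(ℝ, E3).prod (𝓡 3)) (𝓡 3) r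
      (fun q : E3 × M => extendChart φ (h q.1) q.2) (C ×ˢ φ.source) := by
    have e1 : ContMDiffOn (𝓘(ℝ, E3).prod (𝓡 3)) (𝓡 3) r (fun q : E3 × M => φ q.2)
        (C ×ˢ φ.source) :=
      (contMDiffOn_of_mem_maximalAtlas hφ).comp contMDiff_snd.contMDiffOn fun q hq => hq.2
    have e2 : ContMDiffOn (𝓘(ℝ, E3).prod (𝓡 3)) 𝓘(ℝ, E3 × E3) r
        (fun q : E3 × M => (q.1, φ q.2)) (C ×ˢ φ.source) :=
      contMDiff_fst.contMDiffOn.prodMk_space e1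
    have e3 := (contMDiffOn_symm_of_mem_maximalAtlas hφ).comp
      (hh.contMDiff.comp_contMDiffOn e2) (fun q hq => ht q.1 hq.1 (φ.map_source hq.2))
    refine e3.congr fun q hq => ?_
    have : q.2 ∈ φ.source := hq.2
    simp [extendChart, this]
  have h2 : ContMDiffOn (𝓘(ℝ, E3).prod (𝓡 3)) (𝓡 3) r
      (fun q : E3 × M => extendChart φ (h q.1) q.2) (C ×ˢ (φ.symm '' K)ᶜ) :=
    contMDiff_snd.contMDiffOn.congr fun q hq => extendChart_of_notMem (hfix q.1) hq.2
  intro q hq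
  by_cases hs : q.2 ∈ φ.source
  · refine (h1 q ⟨hq.1, hs⟩).mono_of_mem_nhdsWithin ?_
    have : univ ×ˢ φ.source ∈ 𝓝 q := (isOpen_univ.prod φ.open_source).mem_nhds ⟨mem_univ _, hs⟩
    refine mem_of_superset (inter_mem_nhdsWithin _ this) ?_
    rintro ⟨x, y⟩ ⟨⟨hx, -⟩, -, hy⟩
    exact ⟨hx, hy⟩
  · have hs' : q.2 ∉ φ.symm '' K := by
      rintro ⟨v, hv, hvq⟩
      exact hs (hvq ▸ φ.map_target (hKφ hv))
    refine (h2 q ⟨hq.1, hs'⟩).mono_of_mem_nhdsWithin ?_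
    have : univ ×ˢ (φ.symm '' K)ᶜ ∈ 𝓝 q :=
      (isOpen_univ.prod hclosed.isOpen_compl).mem_nhds ⟨mem_univ _, hs'⟩
    refine mem_of_superset (inter_mem_nhdsWithin _ this) ?_
    rintro ⟨x, y⟩ ⟨⟨hx, -⟩, -, hy⟩
    exact ⟨hx, hy⟩

theorem contMDiff_extendChart {r : ℕ∞} {φ : OpenPartialHomeomorph M E3}
    (hφ : φ ∈ IsManifold.maximalAtlas (𝓡 3) r M) {K : Set E3} (hK : IsCompact K)
    (hKφ : K ⊆ φ.target) {h : E3 → E3} (hh : ContDiff ℝ r h) (hfix : ∀ v ∉ K, h v = v)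
    (ht : MapsTo h φ.target φ.target) : ContMDiff (𝓡 3) (𝓡 3) r (extendChart φ h) := by
  have h1 := contMDiffOn_extendChart hφ hK hKφ (h := fun _ => h) (C := univ)
    (hh.comp contDiff_snd) (fun _ => hfix) fun _ _ => ht
  rw [univ_prod_univ, contMDiffOn_univ] at h1
  exact h1.comp (f := fun q : M => ((0 : E3), q)) (contMDiff_const.prodMk contMDiff_id)

theorem mapsTo_of_eq_off {K t : Set E3} (hKt : K ⊆ t) (e : E3 ≃ E3) (hfix : ∀ v ∉ K, e v = v) :
    MapsTo e t t := by
  intro v hv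
  by_cases hK : e v ∈ K
  · exact hKt hK
  · have := e.injective (hfix _ hK)
    rwa [this]

/-- The diffeomorphism which extends a compactly supported diffeomorphism in a chart. -/
noncomputable def extendDiffeo {r : ℕ∞} {φ : OpenPartialHomeomorph M E3}
    (hφ : φ ∈ IsManifold.maximalAtlas (𝓡 3) r M) {K : Set E3} (hK : IsCompact K)
    (hKφ : K ⊆ φ.target) (e : E3 ≃ E3) (he : ContDiff ℝ r e) (he' : ContDiff ℝ r e.symm)
    (hfix : ∀ v ∉ K, e v = v) : M ≃ₘ^r⟮𝓡 3, 𝓡 3⟯ M :=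
  have hfix' : ∀ v ∉ K, e.symm v = v := fun v hv => by
    rw [Equiv.symm_apply_eq, hfix v hv]
  { toFun := extendChart φ e
    invFun := extendChart φ e.symm
    left_inv := extendChart_extendChart (mapsTo_of_eq_off hKφ e hfix) e.symm_apply_apply
    right_inv := extendChart_extendChart (mapsTo_of_eq_off hKφ e.symm hfix') e.apply_symm_apply
    contMDiff_toFun := contMDiff_extendChart hφ hK hKφ he hfix (mapsTo_of_eq_off hKφ e hfix)
    contMDiff_invFun := contMDiff_extendChart hφ hK hKφ he' hfix'
      (mapsTo_of_eq_off hKφ e.symm hfix') }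

end

theorem exists_bump_translation {p : E3} {O : Set E3} (hO : O ∈ 𝓝 p) :
    ∃ ε > 0, ∃ K ⊆ O, IsCompact K ∧ ∃ ρ : E3 → ℝ, ContDiff ℝ ∞ ρ ∧ (∀ v ∉ K, ρ v = 0) ∧
      (∀ᶠ v in 𝓝 p, ρ v = 1) ∧ ∀ μ : E3, ‖μ‖ ≤ ε → ∃ e : E3 ≃ E3, (∀ v, e v = v + ρ v • μ) ∧
        ContDiff ℝ ∞ e ∧ ContDiff ℝ ∞ e.symm := by
  obtain ⟨R, hR, hRO⟩ := Metric.nhds_basis_closedBall.mem_iff.1 hO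
  let ρ : ContDiffBump p := ⟨R / 2, R, by positivity, by linarith⟩
  obtain ⟨L, hL⟩ := ContDiff.lipschitzWith_of_hasCompactSupport (𝕂 := ℝ) ρ.hasCompactSupport
    (ρ.contDiff (n := ⊤)) (by simp)
  refine ⟨1 / (2 * (L + 1)), by positivity, Metric.closedBall p R, hRO, isCompact_closedBall p R,
    ρ, ρ.contDiff, fun v hv => ρ.zero_of_le_dist ?_, ρ.eventuallyEq_one, fun μ hμ => ?_⟩
  · rw [Metric.mem_closedBall, not_le] at hv
    exact hv.le
  have hLμ : (L : ℝ) * ‖μ‖ ≤ 1 / 2 := by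
    calc (L : ℝ) * ‖μ‖ ≤ (L + 1) * (1 / (2 * (L + 1))) := by gcongr; linarith
      _ = 1 / 2 := by field_simp
  have happ : ApproximatesLinearOn (fun v => v + ρ v • μ)
      ((ContinuousLinearEquiv.refl ℝ E3 : E3 ≃L[ℝ] E3) : E3 →L[ℝ] E3) univ (1 / 2) := by
    intro x _ y _
    have e : x + ρ x • μ - (y + ρ y • μ) -
        ((ContinuousLinearEquiv.refl ℝ E3 : E3 ≃L[ℝ] E3) : E3 →L[ℝ] E3) (x - y) =
        (ρ x - ρ y) • μ := by
      simp only [ContinuousLinearEquiv.coe_refl, ContinuousLinearMap.id_apply, sub_smul]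
      abel
    rw [e, norm_smul]
    have h1 := hL.dist_le_mul x y
    rw [Real.dist_eq, dist_eq_norm] at h1
    rw [Real.norm_eq_abs]
    calc |ρ x - ρ y| * ‖μ‖ ≤ L * ‖x - y‖ * ‖μ‖ := by gcongr
      _ = L * ‖μ‖ * ‖x - y‖ := by ring
      _ ≤ 1 / 2 * ‖x - y‖ := by gcongr
      _ = _ := by simp
  have hlt : (1 / 2 : NNReal) < ‖((ContinuousLinearEquiv.refl ℝ E3).symm : E3 →L[ℝ] E3)‖₊⁻¹ := by
    have : ((ContinuousLinearEquiv.refl ℝ E3).symm : E3 →L[ℝ] E3) =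
      ContinuousLinearMap.id ℝ E3 := rfl
    rw [this, show ‖ContinuousLinearMap.id ℝ E3‖₊ = 1 from
      NNReal.eq ContinuousLinearMap.norm_id, inv_one]
    rw [← NNReal.coe_lt_coe]
    norm_num
  have hsmooth : ContDiff ℝ ∞ fun v : E3 => v + ρ v • μ :=
    contDiff_id.add (ρ.contDiff.smul contDiff_const)
  set e := happ.toHomeomorph _ (Or.inr hlt) with he
  have hev : ∀ v, e v = v + ρ v • μ := fun v => rfl
  have hed : ∀ v, ∃ D : E3 ≃L[ℝ] E3, HasFDerivAt e (D : E3 →L[ℝ] E3) v := by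
    intro v
    have hd : HasFDerivAt e (fderiv ℝ e v) v :=
      ((hsmooth.differentiable (by simp)) v).hasFDerivAt
    have hn : ‖fderiv ℝ e v - ContinuousLinearMap.id ℝ E3‖ < 1 := by
      have h1 := hd.fun_sub (hasFDerivAt_id v)
      have h2 : LipschitzWith (1 / 2) (fun v => e v - id v) := by
        refine LipschitzWith.of_dist_le_mul fun x y => ?_
        rw [dist_eq_norm, dist_eq_norm]
        have := happ x (mem_univ _) y (mem_univ _)
        refine le_trans (le_of_eq ?_) this
        congr 1
        simp only [hev, id, ContinuousLinearEquiv.coe_refl,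
          ContinuousLinearMap.id_apply]
        abel
      refine (h1.le_of_lipschitz h2).trans_lt ?_
      norm_num
    have hu : IsUnit (fderiv ℝ e v) := by
      have := (Units.oneSub (ContinuousLinearMap.id ℝ E3 - fderiv ℝ e v)
        (by rwa [norm_sub_rev])).isUnit
      have e1 : (Units.oneSub (ContinuousLinearMap.id ℝ E3 - fderiv ℝ e v)
        (by rwa [norm_sub_rev]) : E3 →L[ℝ] E3) = fderiv ℝ e v := by
        rw [Units.val_oneSub]
        exact sub_sub_cancel (1 : E3 →L[ℝ] E3) _
      rwa [e1] at this
    obtain ⟨u, hu⟩ := hu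
    exact ⟨ContinuousLinearEquiv.ofUnit u, by
      rw [show ((ContinuousLinearEquiv.ofUnit u : E3 ≃L[ℝ] E3) : E3 →L[ℝ] E3) = u from rfl, hu]
      exact hd⟩
  choose D hD using hed
  exact ⟨e.toEquiv, hev, hsmooth, e.contDiff_symm hD hsmooth⟩

section

variable {M : Type*} [TopologicalSpace M] [ChartedSpace E3 M]

theorem LinearizingChart.linear_diagMap {r : ℕ∞} {g : M → M} {p : M} {l₁ l₂ l₃ : ℝ}
    (c : LinearizingChart r g p l₁ l₂ l₃) {q : M} (hq : q ∈ c.dom) :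
    g q ∈ c.chart.source ∧ c.chart (g q) = diagMap ![l₁, l₂, l₃] (c.chart q) := by
  refine ⟨(c.linear q hq).1, ?_⟩
  rw [(c.linear q hq).2]
  ext i
  rw [diagMap_apply]
  fin_cases i <;> rfl

/-- A smooth conjugacy between fixed points identifies the eigenvalues of their derivatives. -/
theorem exists_eigenvalue_eq_of_semiconj {r : ℕ∞} (hr : 1 ≤ r) {g g' F F' : M → M} {p q : M}
    {a b c a' b' c' : ℝ} (cp : LinearizingChart r g p a b c) (cq : LinearizingChart r g' q a' b' c')
    (hF : ContMDiff (𝓡 3) (𝓡 3) r F) (hF' : ContMDiff (𝓡 3) (𝓡 3) r F')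
    (hinv : LeftInverse F' F) (hsemi : Semiconj F g g') (hpq : F p = q) (i : Fin 3) :
    ∃ j, ![a', b', c'] j = ![a, b, c] i := by
  have hr0 : (r : WithTop ℕ∞) ≠ 0 := by
    intro h
    have h1 : ((1 : ℕ∞) : WithTop ℕ∞) ≤ r := WithTop.coe_le_coe.2 hr
    rw [h] at h1
    simp at h1
  set φ := cp.chart
  set ψ := cq.chart
  set h := inCharts φ ψ F with hh
  have hps : p ∈ φ.source := cp.dom_subset cp.mem_dom
  have hqs : F p ∈ ψ.source := hpq ▸ cq.dom_subset cq.mem_dom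
  have h0 : φ p = 0 := cp.chart_center
  have hinj := fderiv_inCharts_injective hr cp.chart_mem cq.chart_mem hF hF' hinv hps hqs
  rw [h0] at hinj
  have hmem0 : (0 : E3) ∈ φ.target := h0 ▸ φ.map_source hps
  have hsymm0 : φ.symm 0 = p := by rw [← h0, φ.left_inv hps]
  have hmem : (0 : E3) ∈ φ.target ∩ φ.symm ⁻¹' (F ⁻¹' ψ.source) :=
    ⟨hmem0, by simpa [hsymm0] using hqs⟩
  have hopen := isOpen_inCharts_domain φ ψ hF.continuous
  have hd : HasFDerivAt h (fderiv ℝ h 0) 0 :=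
    (((contDiffOn_inCharts cp.chart_mem cq.chart_mem hF).contDiffAt
      (hopen.mem_nhds hmem)).differentiableAt hr0).hasFDerivAt
  have hval : h 0 = 0 := by
    simp only [hh, inCharts, hsymm0, hpq]
    exact cq.chart_center
  have hconj : (fun v => h (diagMap ![a, b, c] v)) =ᶠ[𝓝 0] fun v => diagMap ![a', b', c'] (h v) := by
    have hcont : ContinuousAt φ.symm 0 := φ.continuousAt_symm hmem0
    have e1 : ∀ᶠ v in 𝓝 (0 : E3), φ.symm v ∈ cp.dom :=
      hcont.eventually (by rw [hsymm0]; exact cp.isOpen_dom.eventually_mem cp.mem_dom)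
    have e2 : ∀ᶠ v in 𝓝 (0 : E3), F (φ.symm v) ∈ cq.dom := by
      refine (hF.continuous.continuousAt.comp hcont).eventually ?_
      simp only [Function.comp, hsymm0, hpq]
      exact cq.isOpen_dom.eventually_mem cq.mem_dom
    filter_upwards [e1, e2, φ.open_target.eventually_mem hmem0] with v h1 h2 h3
    obtain ⟨h4, h5⟩ := cp.linear_diagMap h1
    obtain ⟨h6, h7⟩ := cq.linear_diagMap h2
    have h8 : φ (φ.symm v) = v := φ.right_inv h3
    rw [← hsemi.eq] at h7
    rw [h8] at h5
    have h9 : φ.symm (diagMap ![a, b, c] v) = g (φ.symm v) := by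
      rw [← h5]; exact φ.left_inv h4
    simp only [hh, inCharts, h9]
    exact h7
  have hd0 : HasFDerivAt h (fderiv ℝ h 0) (diagMap ![a, b, c] 0) := by rwa [map_zero]
  have e1 := hd0.comp (0 : E3) (diagMap ![a, b, c]).hasFDerivAt
  have e2 := (diagMap ![a', b', c']).hasFDerivAt.comp (0 : E3) hd
  have e3 := e1.unique (e2.congr_of_eventuallyEq hconj)
  have e4 := DFunLike.congr_fun e3 (axis i)
  simp only [ContinuousLinearMap.comp_apply, diagMap_axis, map_smul] at e4
  have hne : fderiv ℝ h 0 (axis i) ≠ 0 := by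
    intro hz
    have : axis i = 0 := hinj (by rw [hz, map_zero])
    have h1 : axis i i = 0 := by rw [this]; rfl
    simp [axis_apply] at h1
  obtain ⟨j, hj⟩ : ∃ j, fderiv ℝ h 0 (axis i) j ≠ 0 := by
    by_contra! hall
    exact hne (by ext j; exact hall j)
  refine ⟨j, ?_⟩
  have e5 : (![a, b, c] i • fderiv ℝ h 0 (axis i)) j =
      diagMap ![a', b', c'] (fderiv ℝ h 0 (axis i)) j := by rw [e4]
  rw [diagMap_apply, PiLp.smul_apply, smul_eq_mul] at e5
  exact (mul_right_cancel₀ hj e5).symm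

theorem iterate_ne_of_index_ne {r : ℕ∞} (hr : 1 ≤ r) (f : M ≃ₘ^r⟮𝓡 3, 𝓡 3⟯ M) {P Q : M}
    (hP : P ∈ periodicPts f) {lam' sig' zet' lam sig zet : ℝ}
    (cP : LinearizingChart r f^[minimalPeriod f P] P lam' sig' zet')
    (cQ : LinearizingChart r f^[minimalPeriod f Q] Q lam sig zet)
    (heigP : 1 < |sig'| ∧ |sig'| < |zet'|) (heigQ : |lam| < |zet| ∧ |zet| < 1) (l : ℕ) :
    f^[l] P ≠ Q := by
  intro hl
  have hper : minimalPeriod f Q = minimalPeriod f P := by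
    rw [← hl]; exact minimalPeriod_apply_iterate hP l
  have hsemi : Semiconj f^[l] f^[minimalPeriod f P] f^[minimalPeriod f Q] := by
    rw [hper]
    exact fun x => (Function.Commute.refl f).iterate_iterate l _ x
  have hinv : LeftInverse f.symm^[l] f^[l] := LeftInverse.iterate f.symm_apply_apply l
  have key := exists_eigenvalue_eq_of_semiconj hr cP cQ (iterate_contMDiff f l)
    (iterate_contMDiff f.symm l) hinv hsemi hl
  have big : ∀ x, 1 < |x| → (∃ j, ![lam, sig, zet] j = x) → sig = x := by
    rintro x hx ⟨j, rfl⟩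
    fin_cases j
    · exact absurd hx (heigQ.1.trans heigQ.2).not_gt
    · rfl
    · exact absurd hx heigQ.2.not_gt
  have h1 := big sig' heigP.1 (key 1)
  have h2 := big zet' (heigP.1.trans heigP.2) (key 2)
  rw [← h1, ← h2] at heigP
  exact lt_irrefl _ heigP.2

theorem iterate_ne_comm {α : Type*} {f : α → α} {P Q : α} (hQ : Q ∈ periodicPts f)
    (h : ∀ l, f^[l] P ≠ Q) (l : ℕ) : f^[l] Q ≠ P := by
  rintro rfl
  obtain ⟨n, hn, hper⟩ := hQ
  refine h (n * l - l) ?_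
  rw [← iterate_add_apply, Nat.sub_add_cancel (Nat.le_mul_of_pos_left l hn)]
  exact hper.mul_const l

variable [T2Space M]

/-- Perturbations of the identity which translate in a chart and are supported near a point. -/
theorem exists_chart_translation {r : ℕ∞} {φ : OpenPartialHomeomorph M E3}
    (hφ : φ ∈ IsManifold.maximalAtlas (𝓡 3) r M) {p : M} (hp : p ∈ φ.source) {W : Set M}
    (hW : W ∈ 𝓝 p) :
    ∃ ε > 0, ∃ A : E3 → (M ≃ₘ^r⟮𝓡 3, 𝓡 3⟯ M), (∀ q, A 0 q = q) ∧
      ContMDiffOn (𝓘(ℝ, E3).prod (𝓡 3)) (𝓡 3) r (fun q : E3 × M => A q.1 q.2)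
        (paramCube ε ×ˢ univ) ∧
      ∃ S ⊆ W, IsClosed S ∧ (∀ μ ∈ paramCube ε, ∀ q ∉ S, A μ q = q) ∧
        ∃ V ∈ 𝓝 p, ∀ μ ∈ paramCube ε, ∀ q ∈ V,
          q ∈ φ.source ∧ A μ q ∈ φ.source ∧ φ (A μ q) = φ q + μ := by
  have hO : φ.target ∩ φ.symm ⁻¹' W ∈ 𝓝 (φ p) := by
    refine inter_mem (φ.open_target.mem_nhds (φ.map_source hp)) ?_
    refine (φ.continuousAt_symm (φ.map_source hp)).preimage_mem_nhds ?_
    rwa [φ.left_inv hp]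
  obtain ⟨ε, hε, K, hKO, hK, ρ, hρ, hρ0, hρ1, he⟩ := exists_bump_translation hO
  choose! e hev hed hed' using he
  have hKφ : K ⊆ φ.target := hKO.trans inter_subset_left
  have hcube : ∀ μ ∈ paramCube (ε / 3), ‖μ‖ ≤ ε := fun μ hμ => by
    have h0 := hμ 0
    have h1 := hμ 1
    have h2 := hμ 2
    linarith [E3.norm_le_sum μ]
  have hr : (r : WithTop ℕ∞) ≤ ∞ := WithTop.coe_le_coe.2 le_top
  have hfix : ∀ μ, ‖μ‖ ≤ ε → ∀ v ∉ K, e μ v = v := fun μ hμ v hv => by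
    rw [hev μ hμ, hρ0 v hv, zero_smul, add_zero]
  classical
  set A : E3 → (M ≃ₘ^r⟮𝓡 3, 𝓡 3⟯ M) := fun μ => if h : ‖μ‖ ≤ ε then
    extendDiffeo hφ hK hKφ (e μ) ((hed μ h).of_le hr) ((hed' μ h).of_le hr) (hfix μ h)
    else Diffeomorph.refl _ _ _ with hA
  have hAe : ∀ μ, ‖μ‖ ≤ ε → ∀ q, A μ q = extendChart φ (e μ) q := fun μ hμ q => by
    simp only [hA, hμ, dif_pos]
    rfl
  have hmaps : ∀ μ, ‖μ‖ ≤ ε → MapsTo (e μ) φ.target φ.target := fun μ hμ =>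
    mapsTo_of_eq_off hKφ (e μ) (hfix μ hμ)
  have hef : ∀ μ, ‖μ‖ ≤ ε → ⇑(e μ) = fun v => v + ρ v • μ := fun μ hμ => funext (hev μ hμ)
  refine ⟨ε / 3, by positivity, A, fun q => ?_, ?_, φ.symm '' K, ?_, ?_, ?_, ?_⟩
  · have h0 : ‖(0 : E3)‖ ≤ ε := by rw [norm_zero]; exact hε.le
    rw [hAe 0 h0]
    refine extendChart_of_notMem (K := ∅) (fun v _ => ?_) (by simp)
    rw [hev 0 h0, smul_zero, add_zero]
  · refine (contMDiffOn_extendChart hφ hK hKφ (h := fun μ v => v + ρ v • μ)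
      (C := paramCube (ε / 3)) ?_ ?_ ?_).congr ?_
    · exact contDiff_snd.add (((hρ.of_le hr).comp contDiff_snd).smul contDiff_fst)
    · intro μ v hv
      rw [hρ0 v hv, zero_smul, add_zero]
    · intro μ hμ
      rw [← hef μ (hcube μ hμ)]
      exact hmaps μ (hcube μ hμ)
    · rintro ⟨μ, q⟩ hq
      simp only
      rw [hAe μ (hcube μ hq.1), hef μ (hcube μ hq.1)]
  · rintro _ ⟨v, hv, rfl⟩
    exact (hKO hv).2
  · exact (hK.image_of_continuousOn (φ.continuousOn_symm.mono hKφ)).isClosed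
  · intro μ hμ q hq
    rw [hAe μ (hcube μ hμ)]
    exact extendChart_of_notMem (hfix μ (hcube μ hμ)) hq
  · refine ⟨φ.source ∩ φ ⁻¹' {v | ρ v = 1}, inter_mem (φ.open_source.mem_nhds hp)
      ((φ.continuousAt hp).preimage_mem_nhds hρ1), fun μ hμ q hq => ?_⟩
    have h1 : extendChart φ (e μ) q = φ.symm (e μ (φ q)) := by
      simp [extendChart, hq.1]
    have h2 : e μ (φ q) = φ q + μ := by
      have : ρ (φ q) = 1 := hq.2
      rw [hev μ (hcube μ hμ), this, one_smul]
    have h3 : e μ (φ q) ∈ φ.target := hmaps μ (hcube μ hμ) (φ.map_source hq.1)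
    rw [hAe μ (hcube μ hμ), h1]
    exact ⟨hq.1, φ.map_target h3, by rw [φ.right_inv h3, h2]⟩

theorem paramCube_mono {ε ε' : ℝ} (h : ε ≤ ε') : paramCube ε ⊆ paramCube ε' :=
  fun _ hμ i => (hμ i).trans h

/-- The six-parameter unfolding of a cycle. -/
theorem exists_unfolding {r : ℕ∞} (f : M ≃ₘ^r⟮𝓡 3, 𝓡 3⟯ M) {P Q : M}
    {φP φQ : OpenPartialHomeomorph M E3} (hφP : φP ∈ IsManifold.maximalAtlas (𝓡 3) r M)
    (hφQ : φQ ∈ IsManifold.maximalAtlas (𝓡 3) r M) {X Y : M} {N₁ N₂ : ℕ} (hN₁ : 0 < N₁)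
    (hN₂ : 0 < N₂) (ha : f^[N₁] X ∈ φP.source) (hb : f^[N₂] Y ∈ φQ.source)
    (hab : f^[N₁] X ≠ f^[N₂] Y) {K : Set M} (hK : IsClosed K) (haK : f^[N₁] X ∉ K)
    (hbK : f^[N₂] Y ∉ K) (hPK : ∀ i, f^[i] P ∈ K) (hQK : ∀ i, f^[i] Q ∈ K)
    (hXK : ∀ i < N₁, f^[i] X ∈ K) (hYK : ∀ i < N₂, f^[i] Y ∈ K) :
    ∃ ε > 0, ∃ F : E3 → E3 → (M ≃ₘ^r⟮𝓡 3, 𝓡 3⟯ M),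
      IsUnfolding f P Q φP φQ X Y N₁ N₂ ε F ∧
      ∃ S : Set M, IsClosed S ∧ Disjoint S K ∧
        ∀ μ ∈ paramCube ε, ∀ ν ∈ paramCube ε, ∀ q, f q ∉ S → F μ ν q = f q := by
  obtain ⟨Ua, Ub, hUa, hUb, haU, hbU, hdisj⟩ := t2_separation hab
  obtain ⟨εA, hεA, A, hA0, hAs, SA, hSAW, hSA, hAid, VA, hVA, hAt⟩ :=
    exists_chart_translation hφQ hb (inter_mem (hUb.mem_nhds hbU) (hK.isOpen_compl.mem_nhds hbK))
  obtain ⟨εB, hεB, B, hB0, hBs, SB, hSBW, hSB, hBid, VB, hVB, hBt⟩ :=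
    exists_chart_translation hφP ha (inter_mem (hUa.mem_nhds haU) (hK.isOpen_compl.mem_nhds haK))
  set ε := min εA εB
  have hA' : paramCube ε ⊆ paramCube εA := paramCube_mono (min_le_left _ _)
  have hB' : paramCube ε ⊆ paramCube εB := paramCube_mono (min_le_right _ _)
  set S := SA ∪ SB with hS
  have hScl : IsClosed S := hSA.union hSB
  have hSK : Disjoint S K := by
    rw [disjoint_left]
    rintro x (hx | hx) hxK
    · exact (hSAW hx).2 hxK
    · exact (hSBW hx).2 hxK
  have haSA : f^[N₁] X ∉ SA := fun h => disjoint_left.1 hdisj haU (hSAW h).1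
  have hbSB : f^[N₂] Y ∉ SB := fun h => disjoint_left.1 hdisj (hSBW h).1 hbU
  let F : E3 → E3 → (M ≃ₘ^r⟮𝓡 3, 𝓡 3⟯ M) := fun μ ν => f.trans ((A μ).trans (B ν))
  have hF : ∀ μ ν q, F μ ν q = B ν (A μ (f q)) := fun _ _ _ => rfl
  have hoff : ∀ μ ∈ paramCube ε, ∀ ν ∈ paramCube ε, ∀ q, f q ∉ S → F μ ν q = f q := by
    intro μ hμ ν hν q hq
    rw [hF, hAid μ (hA' hμ) _ fun h => hq (Or.inl h), hBid ν (hB' hν) _ fun h => hq (Or.inr h)]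
  have hpass : ∀ {Z : M} {N : ℕ}, 0 < N → (∀ i < N, f^[i] Z ∈ K) →
      ∃ V ∈ 𝓝 Z, ∀ μ ∈ paramCube ε, ∀ ν ∈ paramCube ε, ∀ q ∈ V,
        (F μ ν)^[N] q = B ν (A μ (f^[N] q)) := by
    intro Z N hN hZ
    refine ⟨{q | ∀ i ∈ Finset.Icc 1 (N - 1), f^[i] q ∈ Sᶜ}, ?_, fun μ hμ ν hν q hq => ?_⟩
    · have := (Filter.eventually_all_finset (l := 𝓝 Z) (Finset.Icc 1 (N - 1))
        (p := fun i q => f^[i] q ∈ Sᶜ)).2 fun i hi => by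
          have hi' := Finset.mem_Icc.1 hi
          exact ((iterate_contMDiff f i).continuous.tendsto Z).eventually
            (hScl.isOpen_compl.eventually_mem fun h =>
              disjoint_left.1 hSK h (hZ i (by omega)))
      exact this
    · obtain ⟨n, rfl⟩ : ∃ n, N = n + 1 := ⟨N - 1, by omega⟩
      rw [iterate_succ_apply', iterate_succ_apply', ← hF]
      congr 1
      exact iterate_eq_of_eq_off (hoff μ hμ ν hν) fun i h1 h2 =>
        hq i (Finset.mem_Icc.2 ⟨h1, by omega⟩)
  refine ⟨ε, lt_min hεA hεB, F, ?_, S, hScl, hSK, hoff⟩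
  constructor
  · ext q
    rw [hF, hA0, hB0]
  · have h1 : ContMDiffOn (𝓘(ℝ, E3 × E3).prod (𝓡 3)) (𝓘(ℝ, E3).prod (𝓡 3)) r
        (fun q : (E3 × E3) × M => (q.1.1, f q.2)) ((paramCube ε ×ˢ paramCube ε) ×ˢ univ) :=
      ((contDiff_fst.contMDiff.comp contMDiff_fst).prodMk
        (f.contMDiff.comp contMDiff_snd)).contMDiffOn
    have h2 := (hAs.mono (prod_mono hA' subset_rfl)).comp h1 fun q hq => ⟨hq.1.1, mem_univ _⟩
    have h3 : ContMDiffOn (𝓘(ℝ, E3 × E3).prod (𝓡 3)) 𝓘(ℝ, E3) r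
        (fun q : (E3 × E3) × M => q.1.2) ((paramCube ε ×ˢ paramCube ε) ×ˢ univ) :=
      (contDiff_snd.contMDiff.comp contMDiff_fst).contMDiffOn
    exact (hBs.mono (prod_mono hB' subset_rfl)).comp (h3.prodMk h2) fun q hq => ⟨hq.1.2, mem_univ _⟩
  · refine ⟨f ⁻¹' Sᶜ, hScl.isOpen_compl.preimage f.continuous, fun i => ⟨?_, ?_⟩,
      fun μ hμ ν hν q hq => hoff μ hμ ν hν q hq⟩
    · intro h
      rw [← iterate_succ_apply' f] at h
      exact disjoint_left.1 hSK h (hPK _)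
    · intro h
      rw [← iterate_succ_apply' f] at h
      exact disjoint_left.1 hSK h (hQK _)
  · obtain ⟨V, hV, hVF⟩ := hpass hN₁ hXK
    have hcont := (iterate_contMDiff f N₁).continuous.continuousAt (x := X)
    refine ⟨V ∩ f^[N₁] ⁻¹' (VB ∩ SAᶜ), inter_mem hV (hcont.preimage_mem_nhds
      (inter_mem hVB (hSA.isOpen_compl.mem_nhds haSA))), fun μ hμ ν hν q hq => ?_⟩
    have hq1 : f^[N₁] q ∈ VB := hq.2.1
    have hq2 : f^[N₁] q ∉ SA := hq.2.2
    rw [hVF μ hμ ν hν q hq.1, hAid μ (hA' hμ) _ hq2]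
    exact hBt ν (hB' hν) _ hq1
  · obtain ⟨V, hV, hVF⟩ := hpass hN₂ hYK
    have hcont := (iterate_contMDiff f N₂).continuous.continuousAt (x := Y)
    refine ⟨V ∩ f^[N₂] ⁻¹' (VA ∩ SBᶜ), inter_mem hV (hcont.preimage_mem_nhds
      (inter_mem hVA (hSB.isOpen_compl.mem_nhds hbSB))), fun μ hμ ν hν q hq => ?_⟩
    have hq1 : f^[N₂] q ∈ VA := hq.2.1
    have hq2 : f^[N₂] q ∉ SB := hq.2.2
    have hAS : A μ (f^[N₂] q) ∉ SB := by
      intro h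
      have h1 : A μ (f^[N₂] q) ∉ SA := fun h' =>
        disjoint_left.1 hdisj (hSBW h).1 (hSAW h').1
      have h2 : A μ (f^[N₂] q) = f^[N₂] q := (A μ).injective (hAid μ (hA' hμ) _ h1)
      rw [h2] at h
      exact hq2 h
    rw [hVF μ hμ ν hν q hq.1, hBid ν (hB' hν) _ hAS]
    exact hAt μ (hA' hμ) _ hq1

end

section

variable {M : Type*} [TopologicalSpace M]

/-- The points near a saddle whose next `π` images avoid the set `S`. -/
def avoiding (f : M → M) (π : ℕ) (U S : Set M) : Set M :=
  {q | q ∈ U ∧ ∀ i ∈ Finset.Icc 1 π, f^[i] q ∈ Sᶜ}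

theorem isOpen_avoiding {f : M → M} (hf : Continuous f) (π : ℕ) {U S : Set M} (hU : IsOpen U)
    (hS : IsClosed S) : IsOpen (avoiding f π U S) := by
  have : avoiding f π U S = U ∩ ⋂ i ∈ Finset.Icc 1 π, f^[i] ⁻¹' Sᶜ := by
    ext q; simp only [avoiding, Set.mem_ofPred_eq, mem_inter_iff, mem_iInter, mem_preimage]
  rw [this]
  exact hU.inter (isOpen_biInter_finset fun i _ => hS.isOpen_compl.preimage (hf.iterate i))

/-- The itinerary of a point which passes near the saddle of index one, follows the first
transition, passes near the saddle of index two and follows the second transition. -/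
theorem return_map_eq {f G : M → M} {φP φQ : OpenPartialHomeomorph M E3} {πP πQ N₁ N₂ : ℕ}
    {dP dQ : Fin 3 → ℝ} {ΩP ΩQ VX VY : Set M} {μ ν : E3}
    (hGQ : ∀ q ∈ ΩQ, G^[πQ] q ∈ φQ.source ∧ φQ (G^[πQ] q) = diagMap dQ (φQ q))
    (hGP : ∀ q ∈ ΩP, G^[πP] q ∈ φP.source ∧ φP (G^[πP] q) = diagMap dP (φP q))
    (hGX : ∀ q ∈ VX, G^[N₁] q ∈ φP.source ∧ φP (G^[N₁] q) = φP (f^[N₁] q) + ν)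
    (hGY : ∀ q ∈ VY, G^[N₂] q ∈ φQ.source ∧ φQ (G^[N₂] q) = φQ (f^[N₂] q) + μ)
    {c c' : E3} {m n : ℕ} (hc : c ∈ φQ.target)
    (h1 : ∀ j < n, diagMap (dQ ^ j) c ∈ φQ.target ∩ φQ.symm ⁻¹' ΩQ)
    (h2 : φQ.symm (diagMap (dQ ^ n) c) ∈ VX)
    (hc' : c' = inCharts φQ φP f^[N₁] (diagMap (dQ ^ n) c) + ν)
    (h3 : ∀ j < m, diagMap (dP ^ j) c' ∈ φP.target ∩ φP.symm ⁻¹' ΩP)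
    (h4 : φP.symm (diagMap (dP ^ m) c') ∈ VY) :
    G^[N₂ + πP * m + N₁ + πQ * n] (φQ.symm c) ∈ φQ.source ∧
      φQ (G^[N₂ + πP * m + N₁ + πQ * n] (φQ.symm c)) =
        inCharts φP φQ f^[N₂] (diagMap (dP ^ m) c') + μ := by
  obtain ⟨e1, e2⟩ := iterate_eq_symm_diagMap_pow hGQ hc h1
  have e3 : (G^[πQ])^[n] (φQ.symm c) = φQ.symm (diagMap (dQ ^ n) c) := by
    rw [← e2, φQ.left_inv e1]
  obtain ⟨e4, e5⟩ := hGX _ h2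
  have e6 : φP (G^[N₁] (φQ.symm (diagMap (dQ ^ n) c))) = c' := by rw [e5, hc']; rfl
  have hc'' : c' ∈ φP.target := e6 ▸ φP.map_source e4
  have e7 : G^[N₁] (φQ.symm (diagMap (dQ ^ n) c)) = φP.symm c' := by rw [← e6, φP.left_inv e4]
  obtain ⟨e8, e9⟩ := iterate_eq_symm_diagMap_pow hGP hc'' h3
  have e10 : (G^[πP])^[m] (φP.symm c') = φP.symm (diagMap (dP ^ m) c') := by
    rw [← e9, φP.left_inv e8]
  have e11 : G^[N₂ + πP * m + N₁ + πQ * n] (φQ.symm c) =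
      G^[N₂] (φP.symm (diagMap (dP ^ m) c')) := by
    rw [iterate_add_apply, iterate_mul, e3, iterate_add_apply, e7, iterate_add_apply, iterate_mul,
      e10]
  rw [e11]
  exact hGY _ h4

variable [ChartedSpace E3 M]

theorem LinearizingChart.symm_zero {r : ℕ∞} {g : M → M} {p : M} {l₁ l₂ l₃ : ℝ}
    (c : LinearizingChart r g p l₁ l₂ l₃) : c.chart.symm 0 = p := by
  rw [← c.chart_center, c.chart.left_inv (c.dom_subset c.mem_dom)]

theorem LinearizingChart.zero_mem_target {r : ℕ∞} {g : M → M} {p : M} {l₁ l₂ l₃ : ℝ}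
    (c : LinearizingChart r g p l₁ l₂ l₃) : (0 : E3) ∈ c.chart.target := by
  rw [← c.chart_center]
  exact c.chart.map_source (c.dom_subset c.mem_dom)

theorem LinearizingChart.eigenvalue_ne_zero {r : ℕ∞} {g : M → M} (hg : Injective g) {p : M}
    {l₁ l₂ l₃ : ℝ} (c : LinearizingChart r g p l₁ l₂ l₃) (i : Fin 3) : ![l₁, l₂, l₃] i ≠ 0 := by
  intro hi
  have h1 : ∀ᶠ t : ℝ in 𝓝[≠] 0, t • axis i ∈ c.chart.target ∧ c.chart.symm (t • axis i) ∈ c.dom := by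
    have h2 : Tendsto (fun t : ℝ => t • axis i) (𝓝[≠] 0) (𝓝 0) := by
      have : Tendsto (fun t : ℝ => t • axis i) (𝓝 0) (𝓝 ((0 : ℝ) • axis i)) :=
        tendsto_id.smul_const _
      rw [zero_smul] at this
      exact this.mono_left nhdsWithin_le_nhds
    have h3 : Tendsto (fun t : ℝ => c.chart.symm (t • axis i)) (𝓝[≠] 0) (𝓝 p) := by
      have := (c.chart.continuousAt_symm c.zero_mem_target).tendsto.comp h2
      rwa [c.symm_zero] at this
    exact (h2.eventually (c.chart.open_target.eventually_mem c.zero_mem_target)).and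
      (h3.eventually (c.isOpen_dom.eventually_mem c.mem_dom))
  obtain ⟨t, ⟨ht1, ht2⟩, ht0⟩ := (h1.and self_mem_nhdsWithin).exists
  obtain ⟨h4, h5⟩ := c.linear_diagMap ht2
  obtain ⟨h6, h7⟩ := c.linear_diagMap c.mem_dom
  rw [c.chart.right_inv ht1, map_smul, diagMap_axis, hi, zero_smul, smul_zero] at h5
  rw [c.chart_center, map_zero] at h7
  have h8 := hg (c.chart.injOn h4 h6 (h5.trans h7.symm))
  have h9 : t • axis i = 0 := by
    rw [← c.chart.right_inv ht1, h8, c.chart_center]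
  have h10 : (t • axis i) i = 0 := by rw [h9]; rfl
  simp only [PiLp.smul_apply, axis_apply, if_true, smul_eq_mul, mul_one] at h10
  exact ht0 h10

theorem LinearizingChart.iterate_avoiding {r : ℕ∞} {f F : M → M} {π : ℕ} {p : M} {l₁ l₂ l₃ : ℝ}
    (c : LinearizingChart r f^[π] p l₁ l₂ l₃) {S : Set M} (hF : ∀ q, f q ∉ S → F q = f q) {q : M}
    (hq : q ∈ avoiding f π c.dom S) :
    F^[π] q ∈ c.chart.source ∧ c.chart (F^[π] q) = diagMap ![l₁, l₂, l₃] (c.chart q) := by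
  rw [iterate_eq_of_eq_off hF fun i h1 h2 => hq.2 i (Finset.mem_Icc.2 ⟨h1, h2⟩)]
  exact c.linear_diagMap hq.1

theorem LinearizingChart.chart_iterate {r : ℕ∞} {g : M → M} {p : M} {l₁ l₂ l₃ : ℝ}
    (c : LinearizingChart r g p l₁ l₂ l₃) {y : M} (hy : ∀ j : ℕ, g^[j] y ∈ c.dom) (j : ℕ) :
    c.chart (g^[j] y) = diagMap (![l₁, l₂, l₃] ^ j) (c.chart y) := by
  induction j with
  | zero => ext i; simp [diagMap_apply]
  | succ j ih =>
    rw [iterate_succ_apply', (c.linear_diagMap (hy j)).2, ih]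
    ext i
    simp only [diagMap_apply, Pi.pow_apply]
    ring

theorem LinearizingChart.chart_iterate_symm {r : ℕ∞} {g h : M → M} (hgh : LeftInverse g h)
    (hg : Injective g) {p : M} {l₁ l₂ l₃ : ℝ} (c : LinearizingChart r g p l₁ l₂ l₃) {x : M}
    (hx : ∀ j : ℕ, h^[j] x ∈ c.dom) (j : ℕ) :
    c.chart (h^[j] x) = diagMap (![l₁, l₂, l₃]⁻¹ ^ j) (c.chart x) := by
  induction j with
  | zero => ext i; simp [diagMap_apply]
  | succ j ih =>
    have h1 := (c.linear_diagMap (hx (j + 1))).2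
    rw [iterate_succ_apply', hgh, ih] at h1
    rw [iterate_succ_apply']
    ext i
    have h2 := congrArg (fun v : E3 => v i) h1
    simp only [diagMap_apply, Pi.pow_apply, Pi.inv_apply] at h2 ⊢
    have h3 := c.eigenvalue_ne_zero hg i
    rw [pow_succ, mul_right_comm, h2]
    field_simp

/-- The orbits of the ends of a passage near a saddle, seen in the linearizing chart. -/
theorem LinearizingChart.passage {r : ℕ∞} (f : M ≃ₜ M) {π : ℕ} {p : M} {l₁ l₂ l₃ : ℝ}
    (c : LinearizingChart r f^[π] p l₁ l₂ l₃) {S K : Set M} (hS : IsClosed S) (hSK : Disjoint S K)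
    (hpK : ∀ i, f^[i] p ∈ K) {x y : M} (hy : y ∈ localStable f^[π] p c.dom)
    (hyK : ∀ i, f^[i + 1] y ∈ K) (hx : x ∈ localStable f.symm^[π] p c.dom)
    (hxK : ∀ i, f.symm^[i] x ∈ K) {O : Set E3}
    (hO : O = c.chart.target ∩ c.chart.symm ⁻¹' avoiding f π c.dom S) :
    IsOpen O ∧ (0 : E3) ∈ O ∧ (∀ j, diagMap (![l₁, l₂, l₃] ^ j) (c.chart y) ∈ O) ∧
      ∀ j, diagMap (![l₁, l₂, l₃]⁻¹ ^ (j + 1)) (c.chart x) ∈ O := by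
  have hKS : ∀ {z}, z ∈ K → z ∈ Sᶜ := fun hz h => disjoint_left.1 hSK h hz
  subst hO
  have key : ∀ {q}, q ∈ avoiding f π c.dom S →
      c.chart q ∈ c.chart.target ∩ c.chart.symm ⁻¹' avoiding f π c.dom S := fun {q} hq => by
    have := c.dom_subset hq.1
    exact ⟨c.chart.map_source this, by simpa [c.chart.left_inv this] using hq⟩
  refine ⟨c.chart.isOpen_inter_preimage_symm
    (isOpen_avoiding f.continuous π c.isOpen_dom hS), ?_, fun j => ?_, fun j => ?_⟩
  · rw [← c.chart_center]
    exact key ⟨c.mem_dom, fun i _ => hKS (hpK i)⟩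
  · rw [← c.chart_iterate hy.1]
    refine key ⟨hy.1 j, fun i hi => hKS ?_⟩
    have hi' := (Finset.mem_Icc.1 hi).1
    rw [← iterate_mul, ← iterate_add_apply, show i + π * j = (i - 1 + π * j) + 1 by omega]
    exact hyK _
  · have hinv : LeftInverse f^[π] f.symm^[π] := LeftInverse.iterate f.apply_symm_apply π
    rw [← c.chart_iterate_symm hinv (f.injective.iterate π) hx.1]
    refine key ⟨hx.1 (j + 1), fun i hi => hKS ?_⟩
    have hi' := (Finset.mem_Icc.1 hi).2
    have e : π * (j + 1) = i + (π * (j + 1) - i) := by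
      have : π ≤ π * (j + 1) := Nat.le_mul_of_pos_right π j.succ_pos
      omega
    rw [← iterate_mul, e, iterate_add_apply]
    have h2 : LeftInverse f^[i] f.symm^[i] := LeftInverse.iterate f.apply_symm_apply i
    rw [h2]
    exact hxK _

end

/-- The homeomorphism `w ↦ p + (d₀ w₀, d₁ w₁, d₂ w₂)`. -/
noncomputable def affineHomeo (p : E3) (d : Fin 3 → ℝ) (hd : ∀ i, d i ≠ 0) : E3 ≃ₜ E3 where
  toFun w := p + diagMap d w
  invFun v := diagMap d⁻¹ (v - p)
  left_inv w := by
    ext i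
    simp only [add_sub_cancel_left, diagMap_apply, Pi.inv_apply]
    exact inv_mul_cancel_left₀ (hd i) _
  right_inv v := by
    ext i
    simp only [PiLp.add_apply, PiLp.sub_apply, diagMap_apply, Pi.inv_apply]
    rw [mul_inv_cancel_left₀ (hd i)]
    ring
  continuous_toFun := by fun_prop
  continuous_invFun := by fun_prop

theorem contDiff_affineHomeo {n : WithTop ℕ∞} (p : E3) (d : Fin 3 → ℝ) (hd : ∀ i, d i ≠ 0) :
    ContDiff ℝ n (affineHomeo p d hd) ∧ ContDiff ℝ n (affineHomeo p d hd).symm :=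
  ⟨contDiff_const.add (diagMap d).contDiff, (diagMap d⁻¹).contDiff.comp
    (contDiff_id.sub contDiff_const)⟩

theorem hasFDerivAt_of_expansion {T H : E3 → E3} {x p : E3} {A : E3 →L[ℝ] E3}
    (hH : ∀ v, T (x + v) = H v + (p + A v)) (h0 : H 0 = 0)
    (h : HasFDerivAt H (0 : E3 →L[ℝ] E3) 0) : T x = p ∧ HasFDerivAt T A x := by
  constructor
  · simpa [h0] using hH 0
  · have h1 : HasFDerivAt (fun v => H v + (p + A v)) A 0 := by
      have := h.add (A.hasFDerivAt.const_add p)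
      rwa [zero_add] at this
    have h2 : HasFDerivAt (fun w : E3 => w - x) (ContinuousLinearMap.id ℝ E3) x :=
      (hasFDerivAt_id x).sub_const x
    have h3 := HasFDerivAt.comp x (g := fun v => H v + (p + A v)) (by rwa [sub_self]) h2
    rw [ContinuousLinearMap.comp_id] at h3
    refine h3.congr_of_eventuallyEq (Eventually.of_forall fun w => ?_)
    simp [← hH]

theorem HasExpansionAtX.hasFDerivAt {T : E3 → E3} {α₁ α₂ α₃ β₁ β₂ β₃ γ₁ γ₂ γ₃ : ℝ}
    (h : HasExpansionAtX T α₁ α₂ α₃ β₁ β₂ β₃ γ₁ γ₂ γ₃) :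
    T !₂[0, 1, 0] = !₂[1, 0, 0] ∧
      HasFDerivAt T (matMap !![α₁, α₂, α₃; β₁, β₂, β₃; γ₁, γ₂, γ₃]) !₂[0, 1, 0] := by
  refine hasFDerivAt_of_expansion (fun v => ?_) h.1 h.2
  rw [sub_add, eq_comm, sub_eq_self, sub_eq_zero]
  ext i
  fin_cases i <;> simp [matMap_apply]
  ring

/-- The quadratic form `b₂ y² + b₃ z² + b₄ y z`. -/
def quadYZ (b₂ b₃ b₄ : ℝ) (v : E3) : ℝ := b₂ * v 1 ^ 2 + b₃ * v 2 ^ 2 + b₄ * v 1 * v 2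

theorem contDiff_quadYZ (b₂ b₃ b₄ : ℝ) {n : WithTop ℕ∞} : ContDiff ℝ n (quadYZ b₂ b₃ b₄) := by
  unfold quadYZ
  fun_prop

/-- The derivative of `quadYZ`. -/
noncomputable def polarYZ (b₂ b₃ b₄ : ℝ) : E3 →L[ℝ] E3 →L[ℝ] ℝ :=
  ((2 * b₂) • EuclideanSpace.proj 1 + b₄ • EuclideanSpace.proj 2 : E3 →L[ℝ] ℝ).smulRight
      (EuclideanSpace.proj 1 : E3 →L[ℝ] ℝ) +
    ((2 * b₃) • EuclideanSpace.proj 2 + b₄ • EuclideanSpace.proj 1 : E3 →L[ℝ] ℝ).smulRight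
      (EuclideanSpace.proj 2 : E3 →L[ℝ] ℝ)

theorem polarYZ_apply (b₂ b₃ b₄ : ℝ) (v w : E3) : polarYZ b₂ b₃ b₄ v w =
    (2 * b₂ * v 1 + b₄ * v 2) * w 1 + (2 * b₃ * v 2 + b₄ * v 1) * w 2 := by
  simp [polarYZ]

theorem hasFDerivAt_quadYZ (b₂ b₃ b₄ : ℝ) (v : E3) :
    HasFDerivAt (quadYZ b₂ b₃ b₄) (polarYZ b₂ b₃ b₄ v) v := by
  have h1 : HasFDerivAt (fun v : E3 => v 1) (EuclideanSpace.proj 1 : E3 →L[ℝ] ℝ) v :=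
    (EuclideanSpace.proj 1 : E3 →L[ℝ] ℝ).hasFDerivAt
  have h2 : HasFDerivAt (fun v : E3 => v 2) (EuclideanSpace.proj 2 : E3 →L[ℝ] ℝ) v :=
    (EuclideanSpace.proj 2 : E3 →L[ℝ] ℝ).hasFDerivAt
  have h3 := (((h1.pow 2).const_mul b₂).add ((h2.pow 2).const_mul b₃)).add
    ((h1.const_mul b₄).mul h2)
  refine h3.congr_fderiv ?_
  ext w
  simp [polarYZ_apply]
  ring

theorem iteratedFDeriv_two_quadYZ (b₂ b₃ b₄ : ℝ) (x v : E3) :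
    iteratedFDeriv ℝ 2 (quadYZ b₂ b₃ b₄) x ![v, v] = 2 * quadYZ b₂ b₃ b₄ v := by
  have h1 : fderiv ℝ (quadYZ b₂ b₃ b₄) = polarYZ b₂ b₃ b₄ :=
    funext fun v => (hasFDerivAt_quadYZ b₂ b₃ b₄ v).fderiv
  rw [iteratedFDeriv_two_apply, h1, ContinuousLinearMap.fderiv]
  simp only [Matrix.cons_val_zero, Matrix.cons_val_one, polarYZ_apply, quadYZ]
  ring

theorem iteratedFDeriv_two_eq_zero_of_axis {g : E3 → ℝ} {x : E3} (hg : ContDiffAt ℝ 2 g x)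
    (h11 : iteratedFDeriv ℝ 2 g x ![axis 1, axis 1] = 0)
    (h22 : iteratedFDeriv ℝ 2 g x ![axis 2, axis 2] = 0)
    (h12 : iteratedFDeriv ℝ 2 g x ![axis 1, axis 2] = 0) {v : E3} (hv : v 0 = 0) :
    iteratedFDeriv ℝ 2 g x ![v, v] = 0 := by
  have hs := (hg.isSymmSndFDerivAt (by simp)).eq (axis 1) (axis 2)
  rw [iteratedFDeriv_two_apply] at h11 h22 h12 ⊢
  simp only [Matrix.cons_val_zero, Matrix.cons_val_one] at h11 h22 h12 hs ⊢
  rw [E3.eq_sum_axis v, hv]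
  simp [h11, h22, h12, ← hs]

section

variable {T : E3 → E3} {a₁ a₂ a₃ b₁ b₂ b₃ b₄ c₁ c₂ c₃ : ℝ}

theorem HasExpansionAtY.hasFDerivAt (h : HasExpansionAtY T a₁ a₂ a₃ b₁ b₂ b₃ b₄ c₁ c₂ c₃) :
    T !₂[0, 1, 1] = !₂[1, 0, 1] ∧
      HasFDerivAt T (matMap !![a₁, a₂, a₃; b₁, 0, 0; c₁, c₂, c₃]) !₂[0, 1, 1] := by
  have h1 : HasFDerivAt (fun v : E3 => quadYZ b₂ b₃ b₄ v • axis 1) (0 : E3 →L[ℝ] E3) 0 := by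
    refine ((hasFDerivAt_quadYZ b₂ b₃ b₄ 0).smul_const (axis 1)).congr_fderiv ?_
    simp
  have h2 := h.2.1.add h1
  rw [add_zero] at h2
  refine hasFDerivAt_of_expansion (fun v => ?_) ?_ h2
  · simp only [Pi.add_apply]
    rw [sub_add, sub_add, eq_comm, sub_eq_self, sub_sub, sub_eq_zero]
    ext i
    fin_cases i <;> simp [matMap_apply, quadYZ, axis_apply] <;> ring
  · exact (congrArg₂ (· + ·) h.1 (by simp [quadYZ])).trans (add_zero 0)

theorem HasExpansionAtY.iteratedFDeriv_two
    (h : HasExpansionAtY T a₁ a₂ a₃ b₁ b₂ b₃ b₄ c₁ c₂ c₃) (hT : ContDiffAt ℝ 2 T !₂[0, 1, 1])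
    {v : E3} (hv : v 0 = 0) :
    iteratedFDeriv ℝ 2 T !₂[0, 1, 1] ![v, v] 1 = 2 * quadYZ b₂ b₃ b₄ v := by
  obtain ⟨-, -, h11, h22, h12⟩ := h
  set x : E3 := !₂[0, 1, 1] with hx
  set H : E3 → ℝ := fun v => (T (x + v) - !₂[1 + a₁ * v 0 + a₂ * v 1 + a₃ * v 2,
    b₁ * v 0 + b₂ * v 1 ^ 2 + b₃ * v 2 ^ 2 + b₄ * v 1 * v 2,
    1 + c₁ * v 0 + c₂ * v 1 + c₃ * v 2] : E3) 1 with hHdef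
  let L : E3 →L[ℝ] ℝ := EuclideanSpace.proj 1
  let B : E3 →L[ℝ] ℝ := b₁ • EuclideanSpace.proj 0
  have hTx : ContDiffAt ℝ 2 (fun v => T (x + v)) 0 := by
    refine ContDiffAt.comp (0 : E3) (g := T) (by rwa [add_zero]) ?_
    fun_prop
  have hHe : H = fun v => L (T (x + v)) - (B v + quadYZ b₂ b₃ b₄ v) := by
    funext v
    simp only [hHdef, L, B, quadYZ, PiLp.sub_apply]
    simp
    ring
  have hLT : ContDiffAt ℝ 2 (fun v => L (T (x + v))) 0 := L.contDiff.contDiffAt.comp _ hTx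
  have hq : ContDiffAt ℝ 2 (quadYZ b₂ b₃ b₄) 0 := (contDiff_quadYZ b₂ b₃ b₄).contDiffAt
  have hH : ContDiffAt ℝ 2 H 0 := by
    rw [hHe]
    exact hLT.sub (B.contDiff.contDiffAt.add hq)
  have e1 : (fun v => L (T (x + v))) = fun v => H v + (B v + quadYZ b₂ b₃ b₄ v) := by
    funext v; rw [hHe]; ring
  have e2 : iteratedFDeriv ℝ 2 (fun v => L (T (x + v))) 0 =
      L.compContinuousMultilinearMap (iteratedFDeriv ℝ 2 T x) := by
    have := L.iteratedFDeriv_comp_left (i := 2) hTx le_rfl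
    simp only [Function.comp_def] at this
    rw [this, iteratedFDeriv_comp_add_left, add_zero]
  have e3 := fun_iteratedFDeriv_add_apply (i := 2) hH (B.contDiff.contDiffAt.add hq)
  have e4 := fun_iteratedFDeriv_add_apply (i := 2) (B.contDiff (n := 2)).contDiffAt hq
  have e5 : iteratedFDeriv ℝ 2 (fun v => B v) 0 = 0 := by
    ext m
    rw [iteratedFDeriv_two_apply]
    have : fderiv ℝ (fun v => B v) = fun _ => B := funext fun v => B.fderiv
    rw [this]
    simp
  have e6 := congrArg (fun D => D ![v, v]) (e2.symm.trans ((congrArg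
    (fun g => iteratedFDeriv ℝ 2 g 0) e1).trans (e3.trans (congrArg _ e4))))
  simp only [add_apply, e5] at e6
  rw [iteratedFDeriv_two_quadYZ, iteratedFDeriv_two_eq_zero_of_axis hH h11 h22 h12 hv] at e6
  simpa [L] using e6

end

namespace SaddleScales

variable {a b c a' b' c' : ℕ → ℝ} {γ : ℝ} {r : ℕ∞} {T₁ T₂ : E3 → E3}

/-- The image in the chart at `Q`, after the passage near `Q`, of the centre of the
renormalization. -/
noncomputable def baseX (a c : ℕ → ℝ) (k : ℕ) : E3 := !₂[0, 1, 0] + !₂[a k, 0, c k]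

/-- The translation of the first transition which sends the centre of the renormalization to a
point whose passage near `P` ends over `Y`. -/
noncomputable def shiftX (T₁ : E3 → E3) (a c b' c' : ℕ → ℝ) (k : ℕ) : E3 :=
  !₂[0, (b' k)⁻¹ - T₁ (baseX a c k) 1, (c' k)⁻¹ - T₁ (baseX a c k) 2]

/-- The image in the chart at `P`, after the passage near `P`, of the centre of the
renormalization. -/
noncomputable def baseY (T₁ : E3 → E3) (a c a' : ℕ → ℝ) (k : ℕ) : E3 :=
  !₂[a' k * T₁ (baseX a c k) 0, 1, 1]

/-- The centre of the renormalization. -/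
noncomputable def centre (b : ℕ → ℝ) (k : ℕ) : E3 := !₂[1, (b k)⁻¹, 1]

/-- The scaling of the renormalization. -/
noncomputable def frame (b b' : ℕ → ℝ) (k : ℕ) : Fin 3 → ℝ :=
  ![scale b b' k, scale b b' k ^ 2, scale b b' k]

/-- The reparametrization of the translations of the second transition. -/
noncomputable def shiftY (T₁ T₂ : E3 → E3) (a b c a' b' : ℕ → ℝ) (k : ℕ) (s : ℝ) : E3 :=
  centre b k - T₂ (baseY T₁ a c a' k) + (scale b b' k ^ 2 * s) • axis 1

/-- The first transition, rescaled. -/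
noncomputable def firstMap (T₁ : E3 → E3) (a b c a' b' c' : ℕ → ℝ) (k : ℕ) (w : E3) : E3 :=
  diagMap (tgt b a' b' c' k) (T₁ (baseX a c k + diagMap (src a b c b' k) w) - T₁ (baseX a c k))

/-- The second transition, rescaled. -/
noncomputable def secondMap (T₁ T₂ : E3 → E3) (a b c a' b' : ℕ → ℝ) (k : ℕ) (w : E3) : E3 :=
  ((scale b b' k ^ 2)⁻¹ • diagMap ![scale b b' k, 1, scale b b' k])
    (T₂ (baseY T₁ a c a' k + (scale b b' k • diagMap ![scale b b' k, 1, 1]) w) -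
      T₂ (baseY T₁ a c a' k))

theorem frame_ne_zero (h : SaddleScales a b c a' b' c' γ) (k : ℕ) (i : Fin 3) :
    frame b b' k i ≠ 0 := by
  have := (h.scale_pos k).ne'
  fin_cases i <;> simpa [frame] using this

theorem diagMap_centre_add (h : SaddleScales a b c a' b' c' γ) (k : ℕ) (w : E3) :
    diagMap ![a k, b k, c k] (centre b k + diagMap (frame b b' k) w) =
      baseX a c k + diagMap (src a b c b' k) w := by
  have := (h.b_pos k).ne'
  ext i
  fin_cases i <;> simp [diagMap_apply, centre, baseX, frame, src] <;> field_simp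

theorem diagMap_add_shiftX (h : SaddleScales a b c a' b' c' γ) (k : ℕ) (w : E3) :
    diagMap ![a' k, b' k, c' k]
        (T₁ (baseX a c k + diagMap (src a b c b' k) w) + shiftX T₁ a c b' c' k) =
      baseY T₁ a c a' k + (scale b b' k • diagMap ![scale b b' k, 1, 1])
        (firstMap T₁ a b c a' b' c' k w) := by
  have := (h.b'_pos k).ne'
  have := (h.c'_pos k).ne'
  have := (h.scale_pos k).ne'
  ext i
  fin_cases i <;> simp [diagMap_apply, firstMap, shiftX, baseY, tgt] <;> field_simp <;> ring

theorem diagMap_frame_inv (h : SaddleScales a b c a' b' c' γ) (k : ℕ) (w : E3) (s : ℝ) :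
    diagMap (frame b b' k)⁻¹
        (T₂ (baseY T₁ a c a' k + (scale b b' k • diagMap ![scale b b' k, 1, 1]) w) +
          shiftY T₁ T₂ a b c a' b' k s - centre b k) =
      s • axis 1 + secondMap T₁ T₂ a b c a' b' k w := by
  have := (h.scale_pos k).ne'
  ext i
  fin_cases i <;> simp [diagMap_apply, secondMap, shiftY, frame, axis_apply] <;> field_simp <;> ring


theorem tendsto_centre_add (h : SaddleScales a b c a' b' c' γ) (w : E3) :
    Tendsto (fun q : ℕ × E3 => centre b q.1 + diagMap (frame b b' q.1) q.2) (atTop ×ˢ 𝓝 w)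
      (𝓝 !₂[1, 0, 1]) := by
  have hδ : Tendsto (fun q : ℕ × E3 => scale b b' q.1) (atTop ×ˢ 𝓝 w) (𝓝 0) :=
    Tendsto.comp (g := scale b b') h.δ_lim tendsto_fst
  have hb : Tendsto (fun q : ℕ × E3 => (b q.1)⁻¹) (atTop ×ˢ 𝓝 w) (𝓝 0) :=
    h.b_lim.comp tendsto_fst
  have hw := fun i => tendsto_E3.1 (tendsto_snd : Tendsto (fun q : ℕ × E3 => q.2)
    (atTop ×ˢ 𝓝 w) (𝓝 w)) i
  rw [tendsto_E3]
  intro i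
  fin_cases i
  · simpa [centre, frame, diagMap_apply] using (hδ.mul (hw 0)).const_add 1
  · simpa [centre, frame, diagMap_apply] using hb.add ((hδ.pow 2).mul (hw 1))
  · simpa [centre, frame, diagMap_apply] using (hδ.mul (hw 2)).const_add 1

theorem tendsto_baseX (h : SaddleScales a b c a' b' c' γ) :
    Tendsto (baseX a c) atTop (𝓝 !₂[0, 1, 0]) := by
  rw [tendsto_E3]
  intro i
  fin_cases i
  · simpa [baseX] using h.a_lim
  · simp [baseX]
  · simpa [baseX] using h.c_lim

theorem tendsto_baseX_add (h : SaddleScales a b c a' b' c' γ) (w : E3) :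
    Tendsto (fun q : ℕ × E3 => baseX a c q.1 + diagMap (src a b c b' q.1) q.2) (atTop ×ˢ 𝓝 w)
      (𝓝 !₂[0, 1, 0]) := by
  have hs : ∀ i, Tendsto (fun q : ℕ × E3 => src a b c b' q.1 i * q.2 i) (atTop ×ˢ 𝓝 w)
      (𝓝 0) := fun i => by
    have := ((h.tendsto_src i).comp tendsto_fst).mul (tendsto_E3.1 (tendsto_snd :
      Tendsto (fun q : ℕ × E3 => q.2) (atTop ×ˢ 𝓝 w) (𝓝 w)) i)
    rwa [zero_mul] at this
  have h1 : Tendsto (fun q : ℕ × E3 => diagMap (src a b c b' q.1) q.2) (atTop ×ˢ 𝓝 w) (𝓝 0) := by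
    rw [tendsto_E3]
    intro i
    simpa only [diagMap_apply, PiLp.zero_apply] using hs i
  simpa using (h.tendsto_baseX.comp tendsto_fst).add h1

theorem tendsto_shiftX (h : SaddleScales a b c a' b' c' γ) (hT : ContinuousAt T₁ !₂[0, 1, 0])
    (hTx : T₁ !₂[0, 1, 0] = !₂[1, 0, 0]) :
    Tendsto (shiftX T₁ a c b' c') atTop (𝓝 0) := by
  have h1 := tendsto_E3.1 (hTx ▸ hT.tendsto.comp h.tendsto_baseX)
  rw [tendsto_E3]
  intro i
  fin_cases i
  · simp [shiftX]
  · simpa [shiftX] using h.b'_lim.sub (h1 1)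
  · simpa [shiftX] using h.c'_lim.sub (h1 2)

theorem isBigO_baseY (h : SaddleScales a b c a' b' c' γ) (hT : ContinuousAt T₁ !₂[0, 1, 0]) :
    (fun k => baseY T₁ a c a' k - !₂[0, 1, 1]) =O[atTop] a' := by
  have h1 := tendsto_E3.1 (hT.tendsto.comp h.tendsto_baseX) 0
  have h2 := (Asymptotics.isBigO_refl a' atTop).mul (h1.isBigO_one ℝ)
  simp only [mul_one] at h2
  refine Asymptotics.IsBigO.trans ?_ h2
  refine Asymptotics.IsBigO.of_bound 1 (Eventually.of_forall fun k => ?_)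
  refine (E3.norm_le_sum _).trans ?_
  simp [baseY]

theorem tendsto_baseY (h : SaddleScales a b c a' b' c' γ) (hT : ContinuousAt T₁ !₂[0, 1, 0]) :
    Tendsto (baseY T₁ a c a') atTop (𝓝 !₂[0, 1, 1]) := by
  simpa using ((h.isBigO_baseY hT).trans_tendsto h.a'_lim).add_const !₂[0, 1, 1]

theorem tendsto_shiftY (h : SaddleScales a b c a' b' c' γ) (hT₁ : ContinuousAt T₁ !₂[0, 1, 0])
    (hT₂ : ContinuousAt T₂ !₂[0, 1, 1]) (hTy : T₂ !₂[0, 1, 1] = !₂[1, 0, 1]) (s : ℝ) :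
    Tendsto (fun q : ℕ × ℝ => shiftY T₁ T₂ a b c a' b' q.1 q.2) (atTop ×ˢ 𝓝 s) (𝓝 0) := by
  have h1 : Tendsto (centre b) atTop (𝓝 !₂[1, 0, 1]) := by
    rw [tendsto_E3]
    intro i
    fin_cases i
    · simp [centre]
    · simpa [centre] using h.b_lim
    · simp [centre]
  have h2 := hTy ▸ hT₂.tendsto.comp (h.tendsto_baseY hT₁)
  have h3 := (h1.sub h2).comp (tendsto_fst (f := atTop) (g := 𝓝 s))
  have h4 : Tendsto (fun q : ℕ × ℝ => scale b b' q.1 ^ 2 * q.2) (atTop ×ˢ 𝓝 s) (𝓝 0) := by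
    have := ((Tendsto.comp (g := scale b b') h.δ_lim
      (tendsto_fst (f := atTop) (g := 𝓝 s))).pow 2).mul tendsto_snd
    simpa using this
  simpa [shiftY, Function.comp_def] using h3.add (h4.smul_const (axis 1))

section

variable {U : Set E3}

theorem tendstoCrAt_firstMap (h : SaddleScales a b c a' b' c' γ) (hr : 2 ≤ r) (hU : IsOpen U)
    (hT : ContDiffOn ℝ r T₁ U) (hx : !₂[0, 1, 0] ∈ U) {m : Matrix (Fin 3) (Fin 3) ℝ}
    (hm : HasFDerivAt T₁ (matMap m) !₂[0, 1, 0])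
    (h12 : m 1 2 = 0) (h21 : m 2 1 = 0) (h22 : m 2 2 = 0) (w : E3) :
    TendstoCrAt r (firstMap T₁ a b c a' b' c')
      (matMap !![0, 0, 0; 0, m 1 1, 0; γ * m 2 0, 0, 0]) w :=
  h.tendstoCrAt_first hr hU hT hx (fun i j => by rw [hm.fderiv, matMap_axis]) h12 h21 h22 w

theorem tendstoCrAt_secondMap (h : SaddleScales a b c a' b' c' γ) (hr : 2 ≤ r) (hU : IsOpen U)
    (hT : ContDiffOn ℝ r T₂ U) (hx : !₂[0, 1, 1] ∈ U) (hT₁ : ContinuousAt T₁ !₂[0, 1, 0])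
    {m : Matrix (Fin 3) (Fin 3) ℝ} (hm : HasFDerivAt T₂ (matMap m) !₂[0, 1, 1])
    (h11 : m 1 1 = 0) (h12 : m 1 2 = 0) {b₂ b₃ b₄ : ℝ}
    (hb : ∀ v : E3, v 0 = 0 →
      iteratedFDeriv ℝ 2 T₂ !₂[0, 1, 1] ![v, v] 1 = 2 * quadYZ b₂ b₃ b₄ v) (w : E3) :
    TendstoCrAt r (secondMap T₁ T₂ a b c a' b')
      (fun w => matMap !![0, m 0 1, m 0 2; m 1 0, 0, 0; 0, m 2 1, m 2 2] w +
        quadYZ b₂ b₃ b₄ w • axis 1) w := by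
  have key := h.tendstoCrAt_second hr hU hT hx (fun i j => by rw [hm.fderiv, matMap_axis]) h11 h12
    (h.isBigO_baseY hT₁) w
  have e : ∀ w : E3, quadYZ b₂ b₃ b₄ w • axis 1 = (1 / 2 : ℝ) • diagMap ![0, 1, 0]
      (iteratedFDeriv ℝ 2 T₂ !₂[0, 1, 1] ![diagMap ![0, 1, 1] w, diagMap ![0, 1, 1] w]) := fun w => by
    ext i
    fin_cases i
    · simp [diagMap_apply, axis_apply]
    · simp only [Fin.mk_one, PiLp.smul_apply, diagMap_apply]
      rw [hb _ (by simp [diagMap_apply])]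
      simp [axis_apply, quadYZ, diagMap_apply]
    · simp [diagMap_apply, axis_apply]
  simp only [e]
  exact key

end

theorem tendsto_add_shiftX (h : SaddleScales a b c a' b' c' γ) (hT : ContinuousAt T₁ !₂[0, 1, 0])
    (hTx : T₁ !₂[0, 1, 0] = !₂[1, 0, 0]) (w : E3) :
    Tendsto (fun q : ℕ × E3 => T₁ (baseX a c q.1 + diagMap (src a b c b' q.1) q.2) +
      shiftX T₁ a c b' c' q.1) (atTop ×ˢ 𝓝 w) (𝓝 !₂[1, 0, 0]) := by
  have h1 := hTx ▸ hT.tendsto.comp (h.tendsto_baseX_add w)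
  simpa [Function.comp_def] using h1.add
    ((h.tendsto_shiftX hT hTx).comp (tendsto_fst (f := atTop) (g := 𝓝 w)))

theorem tendsto_baseY_add (h : SaddleScales a b c a' b' c' γ) (hT : ContinuousAt T₁ !₂[0, 1, 0])
    {R : E3 → E3} {w : E3} (hR : TendstoCrAt r (firstMap T₁ a b c a' b' c') R w) :
    Tendsto (fun q : ℕ × E3 => baseY T₁ a c a' q.1 +
      (scale b b' q.1 • diagMap ![scale b b' q.1, 1, 1]) (firstMap T₁ a b c a' b' c' q.1 q.2))
      (atTop ×ˢ 𝓝 w) (𝓝 !₂[0, 1, 1]) := by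
  have hδ : Tendsto (fun q : ℕ × E3 => scale b b' q.1) (atTop ×ˢ 𝓝 w) (𝓝 0) :=
    Tendsto.comp (g := scale b b') h.δ_lim tendsto_fst
  have h1 := tendsto_E3.1 hR.tendsto_apply
  have h2 : Tendsto (fun q : ℕ × E3 => (scale b b' q.1 • diagMap ![scale b b' q.1, 1, 1])
      (firstMap T₁ a b c a' b' c' q.1 q.2)) (atTop ×ˢ 𝓝 w) (𝓝 0) := by
    rw [tendsto_E3]
    intro i
    fin_cases i
    · simpa [diagMap_apply] using hδ.mul (hδ.mul (h1 0))
    · simpa [diagMap_apply] using hδ.mul (h1 1)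
    · simpa [diagMap_apply] using hδ.mul (h1 2)
  simpa using ((h.tendsto_baseY hT).comp tendsto_fst).add h2

theorem shiftY_props (h : SaddleScales a b c a' b' c' γ) (k : ℕ) :
    ContDiff ℝ r (shiftY T₁ T₂ a b c a' b' k) ∧ Injective (shiftY T₁ T₂ a b c a' b' k) ∧
      ∀ s, deriv (shiftY T₁ T₂ a b c a' b' k) s ≠ 0 := by
  have h0 := (h.scale_pos k).ne'
  have hax : axis 1 ≠ 0 := fun h => by
    have := congrArg (fun v : E3 => v 1) h
    simp [axis_apply] at this
  have hd : ∀ s, HasDerivAt (shiftY T₁ T₂ a b c a' b' k) (scale b b' k ^ 2 • axis 1) s :=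
    fun s => by
    have := (((hasDerivAt_id s).const_mul (scale b b' k ^ 2)).smul_const (axis 1)).const_add
      (centre b k - T₂ (baseY T₁ a c a' k))
    rw [mul_one] at this
    exact this
  refine ⟨?_, fun s t hst => ?_, fun s => ?_⟩
  · unfold shiftY
    fun_prop
  · have h1 := smul_left_injective ℝ hax (add_left_cancel hst)
    exact mul_left_cancel₀ (pow_ne_zero 2 h0) h1
  · rw [(hd s).deriv]
    exact smul_ne_zero (pow_ne_zero 2 h0) hax

end SaddleScales

/-- The limit of the rescaled return maps is conjugate to the Hénon-like family. -/
theorem exists_conj_henonLike {a₂ a₃ b₁ b₂ b₃ b₄ c₂ β γ ξ : ℝ} (ha₂ : a₂ ≠ 0)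
    (ha₃ : a₃ ≠ 0) (hb₂ : b₂ ≠ 0) (hc₂ : c₂ ≠ 0) (hβ : β ≠ 0) (hγ : γ = ξ / a₃) :
    ∃ (Θ : E3 ≃L[ℝ] E3) (τ : ℝ), τ ≠ 0 ∧ ∀ (s : ℝ) (v w : E3),
      w = matMap !![0, 0, 0; 0, β, 0; γ, 0, 0] v →
      Θ (s • axis 1 + (matMap !![0, a₂, a₃; b₁, 0, 0; 0, c₂, 0] w + quadYZ b₂ b₃ b₄ w • axis 1)) =
        henonLike ξ (τ * s) ((ξ * a₂ / a₃) ^ 2 * b₃ / b₂) (ξ * a₂ * b₄ / (a₃ * b₂)) (Θ v) := by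
  have hd : ∀ i, ![b₂ * β / a₂, b₂ * β ^ 2, b₂ * β / c₂] i ≠ 0 := fun i => by
    fin_cases i <;> simp [ha₂, hb₂, hc₂, hβ]
  set d := ![b₂ * β / a₂, b₂ * β ^ 2, b₂ * β / c₂] with hdef
  let Θ : E3 ≃L[ℝ] E3 := ContinuousLinearEquiv.equivOfInverse (diagMap d) (diagMap d⁻¹)
    (fun v => by ext i; simp [diagMap_apply, hd i]) (fun v => by ext i; simp [diagMap_apply, hd i])
  have hΘ : ∀ v, Θ v = diagMap d v := fun _ => rfl
  refine ⟨Θ, b₂ * β ^ 2, by positivity, fun s v w hw => ?_⟩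
  subst hw hγ
  rw [hΘ, hΘ]
  ext i
  fin_cases i <;> simp [diagMap_apply, henonLike, hdef, matMap_apply, quadYZ, axis_apply] <;>
    field_simp <;> ring

theorem paramCube_mem_nhds {ε : ℝ} (hε : 0 < ε) : paramCube ε ∈ 𝓝 (0 : E3) := by
  filter_upwards [Metric.ball_mem_nhds (0 : E3) hε] with v hv i
  exact (E3.abs_apply_le_norm v i).trans (mem_ball_zero_iff.1 hv).le

theorem diag_pow (l₁ l₂ l₃ : ℝ) (n : ℕ) :
    (![l₁, l₂, l₃] ^ n : Fin 3 → ℝ) = ![l₁ ^ n, l₂ ^ n, l₃ ^ n] := by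
  ext i
  fin_cases i <;> rfl

section

variable {M : Type*} [TopologicalSpace M] [ChartedSpace E3 M]

open SaddleScales in
/-- The return maps of the unfolding, seen in the charts. -/
theorem IsUnfolding.eventually_return {r : ℕ∞} {f : M ≃ₘ^r⟮𝓡 3, 𝓡 3⟯ M} {P Q : M}
    {lam' sig' zet' lam sig zet : ℝ}
    {cP : LinearizingChart r f^[minimalPeriod f P] P lam' sig' zet'}
    {cQ : LinearizingChart r f^[minimalPeriod f Q] Q lam sig zet} {X Y : M} {N₁ N₂ : ℕ}
    {ε : ℝ} (hε : 0 < ε) {F : E3 → E3 → (M ≃ₘ^r⟮𝓡 3, 𝓡 3⟯ M)}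
    (hF : IsUnfolding f P Q cP.chart cQ.chart X Y N₁ N₂ ε F)
    (hcycle : IsNonTransverseCycle f P Q cP cQ X Y N₁ N₂)
    (heigP : |lam'| < 1 ∧ 1 < |sig'| ∧ |sig'| < |zet'|)
    (heigQ : |lam| < |zet| ∧ |zet| < 1 ∧ 1 < |sig|)
    {S K : Set M} (hS : IsClosed S) (hSK : Disjoint S K)
    (hFS : ∀ μ ∈ paramCube ε, ∀ ν ∈ paramCube ε, ∀ q, f q ∉ S → F μ ν q = f q)
    (hPK : ∀ i, f^[i] P ∈ K) (hQK : ∀ i, f^[i] Q ∈ K)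
    (haK : ∀ i, f^[i + 1] (f^[N₁] X) ∈ K) (hbK : ∀ i, f^[i + 1] (f^[N₂] Y) ∈ K)
    (hXK : ∀ i, f.symm^[i] X ∈ K) (hYK : ∀ i, f.symm^[i] Y ∈ K)
    {m n : ℕ → ℕ} (hm : Tendsto m atTop atTop) (hn : Tendsto n atTop atTop)
    {a b c a' b' c' : ℕ → ℝ} {γ : ℝ} (h : SaddleScales a b c a' b' c' γ)
    (ha : a = fun k => lam ^ n k) (hb : b = fun k => sig ^ n k) (hc : c = fun k => zet ^ n k)
    (ha' : a' = fun k => lam' ^ m k) (hb' : b' = fun k => sig' ^ m k)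
    (hc' : c' = fun k => zet' ^ m k) {T₁ T₂ : E3 → E3}
    (hT₁ : T₁ = inCharts cQ.chart cP.chart f^[N₁]) (hT₂ : T₂ = inCharts cP.chart cQ.chart f^[N₂])
    (hT₁c : ContinuousAt T₁ !₂[0, 1, 0]) (hT₂c : ContinuousAt T₂ !₂[0, 1, 1])
    (hT₁x : T₁ !₂[0, 1, 0] = !₂[1, 0, 0]) (hT₂y : T₂ !₂[0, 1, 1] = !₂[1, 0, 1])
    {R : E3 → E3} {p : ℝ × E3} (hR : TendstoCrAt r (firstMap T₁ a b c a' b' c') R p.2) :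
    ∀ᶠ q : ℕ × (ℝ × E3) in atTop ×ˢ 𝓝 p,
      (F (shiftY T₁ T₂ a b c a' b' q.1 q.2.1)
          (shiftX T₁ a c b' c' q.1))^[N₂ + minimalPeriod f P * m q.1 + N₁ +
            minimalPeriod f Q * n q.1]
          (cQ.chart.symm (centre b q.1 + diagMap (frame b b' q.1) q.2.2)) ∈ cQ.chart.source ∧
      cQ.chart ((F (shiftY T₁ T₂ a b c a' b' q.1 q.2.1)
          (shiftX T₁ a c b' c' q.1))^[N₂ + minimalPeriod f P * m q.1 + N₁ +
            minimalPeriod f Q * n q.1]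
          (cQ.chart.symm (centre b q.1 + diagMap (frame b b' q.1) q.2.2))) =
        T₂ (baseY T₁ a c a' q.1 + (scale b b' q.1 • diagMap ![scale b b' q.1, 1, 1])
          (firstMap T₁ a b c a' b' c' q.1 q.2.2)) + shiftY T₁ T₂ a b c a' b' q.1 q.2.1 := by
  have hw : Tendsto (fun q : ℕ × (ℝ × E3) => (q.1, q.2.2)) (atTop ×ˢ 𝓝 p)
      (atTop ×ˢ 𝓝 p.2) := tendsto_fst.prodMk ((continuous_snd.tendsto p).comp tendsto_snd)
  have hs : Tendsto (fun q : ℕ × (ℝ × E3) => (q.1, q.2.1)) (atTop ×ˢ 𝓝 p)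
      (atTop ×ˢ 𝓝 p.1) := tendsto_fst.prodMk ((continuous_fst.tendsto p).comp tendsto_snd)
  have hk : Tendsto (fun q : ℕ × (ℝ × E3) => q.1) (atTop ×ˢ 𝓝 p) atTop := tendsto_fst
  obtain ⟨WX, hWX, hFX⟩ := hF.unfold_X
  obtain ⟨WY, hWY, hFY⟩ := hF.unfold_Y
  have hXs : X ∈ cQ.chart.source := cQ.dom_subset (hcycle.X_mem.1 0)
  have hYs : Y ∈ cP.chart.source := cP.dom_subset (hcycle.Y_mem.1 0)
  have hbs : f^[N₂] Y ∈ cQ.chart.source := cQ.dom_subset (hcycle.fY_mem.1 0)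
  have hXt : !₂[0, 1, 0] ∈ cQ.chart.target := hcycle.X_coord ▸ cQ.chart.map_source hXs
  have hYt : !₂[0, 1, 1] ∈ cP.chart.target := hcycle.Y_coord ▸ cP.chart.map_source hYs
  have hbt : !₂[1, 0, 1] ∈ cQ.chart.target := hcycle.fY_coord ▸ cQ.chart.map_source hbs
  have hXe : cQ.chart.symm !₂[0, 1, 0] = X := by rw [← hcycle.X_coord, cQ.chart.left_inv hXs]
  have hYe : cP.chart.symm !₂[0, 1, 1] = Y := by rw [← hcycle.Y_coord, cP.chart.left_inv hYs]
  obtain ⟨oQ, zQ, sQ, eQ⟩ := cQ.passage f.toHomeomorph hS hSK hQK hcycle.fY_mem hbK hcycle.X_mem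
    hXK rfl
  obtain ⟨oP, zP, sP, eP⟩ := cP.passage f.toHomeomorph hS hSK hPK hcycle.fX_mem haK hcycle.Y_mem
    hYK rfl
  rw [hcycle.fY_coord] at sQ
  rw [hcycle.X_coord] at eQ
  rw [hcycle.fX_coord] at sP
  rw [hcycle.Y_coord] at eP
  have dQ : ∀ k, (![lam, sig, zet] ^ n k : Fin 3 → ℝ) = ![a k, b k, c k] := fun k => by
    rw [diag_pow, ha, hb, hc]
  have dP : ∀ k, (![lam', sig', zet'] ^ m k : Fin 3 → ℝ) = ![a' k, b' k, c' k] := fun k => by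
    rw [diag_pow, ha', hb', hc']
  have t1 := (h.tendsto_centre_add p.2).comp hw
  have t2 := (h.tendsto_baseX_add p.2).comp hw
  have t3 := (h.tendsto_add_shiftX hT₁c hT₁x p.2).comp hw
  have t4 := (h.tendsto_baseY_add hT₁c hR).comp hw
  have t5 := (h.tendsto_shiftY hT₁c hT₂c hT₂y p.1).comp hs
  have t6 := (h.tendsto_shiftX hT₁c hT₁x).comp hk
  have e1 := eventually_diagMap_pow_mem (d := ![lam, sig, zet]) (q := !₂[0, 1, 0])
    (fun i => by
      fin_cases i
      · exact Or.inl (heigQ.1.trans heigQ.2.1)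
      · exact Or.inr heigQ.2.2
      · exact Or.inl heigQ.2.1) oQ zQ sQ eQ
    (fun i => by
      fin_cases i
      · simp
      · exact fun h1 => absurd heigQ.2.2 h1.not_gt
      · simp) (hn.comp hk) t1 (t2.congr fun q => by
        simp only [Function.comp_apply, dQ]
        exact (h.diagMap_centre_add _ _).symm)
  have e2 := eventually_diagMap_pow_mem (d := ![lam', sig', zet']) (q := !₂[0, 1, 1])
    (fun i => by
      fin_cases i
      · exact Or.inl heigP.1
      · exact Or.inr heigP.2.1
      · exact Or.inr (heigP.2.1.trans heigP.2.2)) oP zP sP eP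
    (fun i => by
      fin_cases i
      · simp
      · exact fun h1 => absurd heigP.2.1 h1.not_gt
      · exact fun h1 => absurd (heigP.2.1.trans heigP.2.2) h1.not_gt) (hm.comp hk) t3
      (t4.congr fun q => by
        simp only [Function.comp_apply, dP]
        exact (h.diagMap_add_shiftX _ _).symm)
  have e3 : ∀ᶠ q in atTop ×ˢ 𝓝 p, _ ∈ cQ.chart.target :=
    t1.eventually (cQ.chart.open_target.eventually_mem hbt)
  have e4 : ∀ᶠ q in atTop ×ˢ 𝓝 p, cQ.chart.symm _ ∈ WX :=
    ((cQ.chart.continuousAt_symm hXt).tendsto.comp t2).eventually (hXe.symm ▸ hWX)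
  have e5 : ∀ᶠ q in atTop ×ˢ 𝓝 p, cP.chart.symm _ ∈ WY :=
    ((cP.chart.continuousAt_symm hYt).tendsto.comp t4).eventually (hYe.symm ▸ hWY)
  have e6 := t5.eventually (paramCube_mem_nhds hε)
  have e7 := t6.eventually (paramCube_mem_nhds hε)
  filter_upwards [e1, e2, e3, e4, e5, e6, e7] with q q1 q2 q3 q4 q5 q6 q7
  simp only [Function.comp_apply] at q1 q2 q3 q4 q5 q6 q7
  have hFq := hFS _ q6 _ q7
  have key := return_map_eq (f := f) (G := F (shiftY T₁ T₂ a b c a' b' q.1 q.2.1)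
      (shiftX T₁ a c b' c' q.1)) (φP := cP.chart) (φQ := cQ.chart)
    (dP := ![lam', sig', zet']) (dQ := ![lam, sig, zet])
    (fun z hz => cQ.iterate_avoiding hFq hz) (fun z hz => cP.iterate_avoiding hFq hz)
    (fun z hz => (hFX _ q6 _ q7 z hz).2) (fun z hz => (hFY _ q6 _ q7 z hz).2)
    (c := centre b q.1 + diagMap (frame b b' q.1) q.2.2)
    (c' := T₁ (baseX a c q.1 + diagMap (src a b c b' q.1) q.2.2) + shiftX T₁ a c b' c' q.1)
    (m := m q.1) (n := n q.1)
    q3 q1 (by rw [dQ, h.diagMap_centre_add]; exact q4)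
    (by rw [dQ, h.diagMap_centre_add, hT₁]) q2 (by rw [dP, h.diagMap_add_shiftX]; exact q5)
  rw [dP, h.diagMap_add_shiftX, ← hT₂] at key
  exact key

end

theorem theorem1p2 {M : Type*} [TopologicalSpace M] [CompactSpace M] [T2Space M]
    [ChartedSpace E3 M] [IsManifold (𝓡 3) ∞ M]
    (r : ℕ∞) (hr : 2 ≤ r) (f : M ≃ₘ^r⟮𝓡 3, 𝓡 3⟯ M)
    (P Q : M) (hP : P ∈ periodicPts f) (hQ : Q ∈ periodicPts f)
    -- the eigenvalues at `P` (primed) and at `Q`, and their linearizing charts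
    (lam' sig' zet' lam sig zet : ℝ)
    (cP : LinearizingChart r f^[minimalPeriod f P] P lam' sig' zet')
    (cQ : LinearizingChart r f^[minimalPeriod f Q] Q lam sig zet)
    (heigP : |lam'| < 1 ∧ 1 < |sig'| ∧ |sig'| < |zet'|)
    (heigQ : |lam| < |zet| ∧ |zet| < 1 ∧ 1 < |sig|)
    (κ : ℝ) (hκ : κ = Real.log |lam|⁻¹ / Real.log |zet'|)
    (heig₁ : |sig' * zet'| ^ κ * |sig * zet ^ 2| < 1)
    (heig₂ : |(sig' ^ 3)⁻¹ * zet'| ^ κ * |sig⁻¹| < 1)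
    (heig₃ : |lam' * sig'| ^ κ * |sig| < 1)
    (hirr : Irrational (Real.log |zet'| / Real.log |lam|))
    -- the cycle and its transitions
    (X Y : M) (N₁ N₂ : ℕ) (hcycle : IsNonTransverseCycle f P Q cP cQ X Y N₁ N₂)
    (α₁ α₂ α₃ β₁ β₂ β₃ γ₁ γ₂ γ₃ : ℝ)
    (hX : HasExpansionAtX (inCharts cQ.chart cP.chart f^[N₁]) α₁ α₂ α₃ β₁ β₂ β₃ γ₁ γ₂ γ₃)
    (hβγ : β₃ = 0 ∧ γ₂ = 0 ∧ γ₃ = 0)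
    (a₁ a₂ a₃ b₁ b₂ b₃ b₄ c₁ c₂ c₃ : ℝ)
    (hY : HasExpansionAtY (inCharts cP.chart cQ.chart f^[N₂]) a₁ a₂ a₃ b₁ b₂ b₃ b₄ c₁ c₂ c₃)
    (hc₃ : c₃ = 0) (hb : b₂ * b₃ ≠ 0) (hγa : 0 < γ₁ * a₃) (ha₂ : a₂ ≠ 0) :
    ∃ ε : ℝ, 0 < ε ∧ ∃ F : E3 → E3 → (M ≃ₘ^r⟮𝓡 3, 𝓡 3⟯ M),
      IsUnfolding f P Q cP.chart cQ.chart X Y N₁ N₂ ε F ∧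
      ∀ ξ : ℝ, 0 < ξ →
        ∃ (Ψ : ℕ → OpenPartialHomeomorph E3 M) (μ : ℕ → ℝ → E3) (ν : ℕ → E3) (m n : ℕ → ℕ)
          (G : ℝ → E3 → E3),
          -- coordinate changes and reparametrizations
          (∀ k, (Ψ k).symm ∈ IsManifold.maximalAtlas (𝓡 3) r M) ∧
          (∀ k, ContDiff ℝ r (μ k) ∧ Injective (μ k) ∧ ∀ s, deriv (μ k) s ≠ 0) ∧
          Tendsto m atTop atTop ∧ Tendsto n atTop atTop ∧
          -- convergence of the parameters to zero and of the coordinates to the tangency point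
          Tendsto ν atTop (𝓝 0) ∧
          (∀ I : Set ℝ, IsCompact I → TendstoUniformlyOn μ (fun _ => 0) atTop I) ∧
          (∀ K : Set E3, IsCompact K → ∀ W ∈ 𝓝 (f^[N₂] Y),
            ∀ᶠ k in atTop, ∀ v ∈ K, v ∈ (Ψ k).source ∧ Ψ k v ∈ W) ∧
          -- the renormalized return maps are eventually defined on any compact set
          (∀ (I : Set ℝ) (K : Set E3), IsCompact I → IsCompact K →
            ∀ᶠ k in atTop, ∀ s ∈ I, ∀ v ∈ K,
              (F (μ k s) (ν k))^[N₂ + minimalPeriod f P * m k + N₁ + minimalPeriod f Q * n k]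
                (Ψ k v) ∈ (Ψ k).target) ∧
          -- and they converge to a family conjugate to the Hénon-like one
          TendstoCr r
            (fun k (p : ℝ × E3) => (Ψ k).symm
              ((F (μ k p.1) (ν k))^[N₂ + minimalPeriod f P * m k + N₁ + minimalPeriod f Q * n k]
                (Ψ k p.2)))
            (fun p => G p.1 p.2) ∧
          ∃ (Θ : E3 ≃L[ℝ] E3) (τ : ℝ), τ ≠ 0 ∧ ∀ s v,
            Θ (G s v) = henonLike ξ (τ * s)
              ((ξ * a₂ / a₃) ^ 2 * b₃ / b₂) (ξ * a₂ * b₄ / (a₃ * b₂)) (Θ v) := by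
  obtain ⟨rfl, rfl, rfl⟩ := hβγ
  subst hc₃
  have hr1 : 1 ≤ r := le_trans (by norm_num) hr
  have hr2 : (2 : WithTop ℕ∞) ≤ r := WithTop.coe_le_coe.2 hr
  have hb₂ : b₂ ≠ 0 := left_ne_zero_of_mul hb
  have ha₃ : a₃ ≠ 0 := right_ne_zero_of_mul hγa.ne'
  have hγ₁ : γ₁ ≠ 0 := left_ne_zero_of_mul hγa.ne'
  have hXs : X ∈ cQ.chart.source := cQ.dom_subset (hcycle.X_mem.1 0)
  have hYs : Y ∈ cP.chart.source := cP.dom_subset (hcycle.Y_mem.1 0)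
  have has : f^[N₁] X ∈ cP.chart.source := cP.dom_subset (hcycle.fX_mem.1 0)
  have hbs : f^[N₂] Y ∈ cQ.chart.source := cQ.dom_subset (hcycle.fY_mem.1 0)
  have hXt : !₂[0, 1, 0] ∈ cQ.chart.target := hcycle.X_coord ▸ cQ.chart.map_source hXs
  have hYt : !₂[0, 1, 1] ∈ cP.chart.target := hcycle.Y_coord ▸ cP.chart.map_source hYs
  have hbt : !₂[1, 0, 1] ∈ cQ.chart.target := hcycle.fY_coord ▸ cQ.chart.map_source hbs
  have hXe : cQ.chart.symm !₂[0, 1, 0] = X := by rw [← hcycle.X_coord, cQ.chart.left_inv hXs]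
  have hYe : cP.chart.symm !₂[0, 1, 1] = Y := by rw [← hcycle.Y_coord, cP.chart.left_inv hYs]
  -- the transitions in the charts
  obtain ⟨hT₁x, hD₁⟩ := hX.hasFDerivAt
  obtain ⟨hT₂y, hD₂⟩ := hY.hasFDerivAt
  have hT₁ := contDiffOn_inCharts cQ.chart_mem cP.chart_mem (iterate_contMDiff f N₁)
  have hT₂ := contDiffOn_inCharts cP.chart_mem cQ.chart_mem (iterate_contMDiff f N₂)
  have hU₁ := isOpen_inCharts_domain cQ.chart cP.chart (iterate_contMDiff f N₁).continuous
  have hU₂ := isOpen_inCharts_domain cP.chart cQ.chart (iterate_contMDiff f N₂).continuous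
  have hxU₁ : !₂[0, 1, 0] ∈ cQ.chart.target ∩ cQ.chart.symm ⁻¹' (f^[N₁] ⁻¹' cP.chart.source) :=
    ⟨hXt, by simpa [hXe] using has⟩
  have hyU₂ : !₂[0, 1, 1] ∈ cP.chart.target ∩ cP.chart.symm ⁻¹' (f^[N₂] ⁻¹' cQ.chart.source) :=
    ⟨hYt, by simpa [hYe] using hbs⟩
  have hD₁i := fderiv_inCharts_injective hr1 cQ.chart_mem cP.chart_mem (iterate_contMDiff f N₁)
    (iterate_contMDiff f.symm N₁) (LeftInverse.iterate f.symm_apply_apply N₁) hXs has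
  have hD₂i := fderiv_inCharts_injective hr1 cP.chart_mem cQ.chart_mem (iterate_contMDiff f N₂)
    (iterate_contMDiff f.symm N₂) (LeftInverse.iterate f.symm_apply_apply N₂) hYs hbs
  rw [hcycle.X_coord] at hD₁i
  rw [hcycle.Y_coord] at hD₂i
  rw [hD₁.fderiv] at hD₁i
  rw [hD₂.fderiv] at hD₂i
  have hβ : β₂ ≠ 0 := by
    rintro rfl
    have h1 : (!₂[0, α₃, -α₂] : E3) = 0 := hD₁i (by
      ext i; fin_cases i <;> simp [matMap_apply]; ring)
    have h2 : α₂ = 0 := by simpa using congrArg (fun v : E3 => v 2) h1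
    have h3 : (!₂[0, 1, 0] : E3) = 0 := hD₁i (by
      ext i; fin_cases i <;> simp [matMap_apply, h2])
    simpa using congrArg (fun v : E3 => v 1) h3
  have hc₂ : c₂ ≠ 0 := by
    rintro rfl
    have h1 : (!₂[0, a₃, -a₂] : E3) = 0 := hD₂i (by
      ext i; fin_cases i <;> simp [matMap_apply]; ring)
    exact ha₃ (by simpa using congrArg (fun v : E3 => v 1) h1)
  have hq := fun {v : E3} => hY.iteratedFDeriv_two
    ((hT₂.contDiffAt (hU₂.mem_nhds hyU₂)).of_le hr2) (v := v)
  have hT₁c := (hT₁.contDiffAt (hU₁.mem_nhds hxU₁)).continuousAt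
  have hT₂c := (hT₂.contDiffAt (hU₂.mem_nhds hyU₂)).continuousAt
  set T₁ := inCharts cQ.chart cP.chart f^[N₁] with hT₁def
  set T₂ := inCharts cP.chart cQ.chart f^[N₂] with hT₂def
  -- the unfolding
  have hPQ := iterate_ne_of_index_ne hr1 f hP cP cQ heigP.2 ⟨heigQ.1, heigQ.2.1⟩
  have hQP := iterate_ne_comm hQ hPQ
  have haP : f^[N₁] X ≠ P := fun he => by
    have := congrArg (fun v : E3 => v 0) (hcycle.fX_coord.symm.trans
      ((congrArg cP.chart he).trans cP.chart_center))
    simp at this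
  have hbQ : f^[N₂] Y ≠ Q := fun he => by
    have := congrArg (fun v : E3 => v 0) (hcycle.fY_coord.symm.trans
      ((congrArg cQ.chart he).trans cQ.chart_center))
    simp at this
  obtain ⟨hab, K, hK, haK, hbK, hPK, hQK, haK', hbK', hXK, hYK, hXK', hYK'⟩ :=
    exists_isClosed_cycle f.toHomeomorph (minimalPeriod_pos_of_mem_periodicPts hP)
      (minimalPeriod_pos_of_mem_periodicPts hQ) (isPeriodicPt_minimalPeriod f P)
      (isPeriodicPt_minimalPeriod f Q) hPQ hQP hcycle.N₁_pos hcycle.N₂_pos rfl rfl haP hbQ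
      hcycle.fX_mem.2 hcycle.fY_mem.2 hcycle.X_mem.2 hcycle.Y_mem.2
  obtain ⟨ε, hε, F, hF, S, hS, hSK, hFS⟩ := exists_unfolding f cP.chart_mem cQ.chart_mem
    hcycle.N₁_pos hcycle.N₂_pos has hbs hab hK haK hbK hPK hQK hXK' hYK'
  refine ⟨ε, hε, F, hF, fun ξ hξ => ?_⟩
  have hγ : 0 < ξ / (γ₁ * a₃) := div_pos hξ hγa
  obtain ⟨m, n, hm, hn, h⟩ := exists_saddleScales heigP heigQ hκ heig₁ heig₂ heig₃ hirr hγ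
  obtain ⟨a, ha⟩ : ∃ a : ℕ → ℝ, a = fun k => lam ^ n k := ⟨_, rfl⟩
  obtain ⟨b, hb⟩ : ∃ b : ℕ → ℝ, b = fun k => sig ^ n k := ⟨_, rfl⟩
  obtain ⟨c, hc⟩ : ∃ c : ℕ → ℝ, c = fun k => zet ^ n k := ⟨_, rfl⟩
  obtain ⟨a', ha'⟩ : ∃ a' : ℕ → ℝ, a' = fun k => lam' ^ m k := ⟨_, rfl⟩
  obtain ⟨b', hb'⟩ : ∃ b' : ℕ → ℝ, b' = fun k => sig' ^ m k := ⟨_, rfl⟩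
  obtain ⟨c', hc'⟩ : ∃ c' : ℕ → ℝ, c' = fun k => zet' ^ m k := ⟨_, rfl⟩
  rw [← ha, ← hb, ← hc, ← ha', ← hb', ← hc'] at h
  have hfirst := h.tendstoCrAt_firstMap hr hU₁ hT₁ hxU₁ hD₁ (by simp) (by simp) (by simp)
  have hsecond := h.tendstoCrAt_secondMap hr hU₂ hT₂ hyU₂ hT₁c hD₂ (by simp) (by simp)
    (fun v hv => hq hv)
  simp only [Matrix.of_apply, Matrix.cons_val', Matrix.cons_val_zero, Matrix.cons_val_one,
    Matrix.cons_val] at hfirst hsecond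
  have hret := fun p : ℝ × E3 => hF.eventually_return hε hcycle heigP heigQ hS hSK hFS hPK hQK
    haK' hbK' hXK hYK hm hn h ha hb hc ha' hb' hc' hT₁def hT₂def hT₁c hT₂c hT₁x hT₂y (hfirst p.2)
  set R₁ := matMap !![0, 0, 0; 0, β₂, 0; ξ / (γ₁ * a₃) * γ₁, 0, 0] with hR₁
  set R₂ : E3 → E3 := fun w => matMap !![0, a₂, a₃; b₁, 0, 0; 0, c₂, 0] w +
    quadYZ b₂ b₃ b₄ w • axis 1 with hR₂
  have hR₂c : ContDiff ℝ r R₂ :=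
    (ContinuousLinearMap.contDiff _).add ((contDiff_quadYZ b₂ b₃ b₄).smul contDiff_const)
  have hsc : ContDiff ℝ r (fun p : ℝ × E3 => p.1 • axis 1) := contDiff_fst.smul contDiff_const
  have hRc : ContDiff ℝ r (fun p : ℝ × E3 => R₂ (R₁ p.2)) :=
    hR₂c.comp (R₁.contDiff.comp contDiff_snd)
  refine ⟨fun k => (affineHomeo (SaddleScales.centre b k) (SaddleScales.frame b b' k)
      (h.frame_ne_zero k)).toOpenPartialHomeomorph.trans cQ.chart.symm,
    SaddleScales.shiftY T₁ T₂ a b c a' b', SaddleScales.shiftX T₁ a c b' c', m, n,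
    fun s v => s • axis 1 + R₂ (R₁ v), fun k => ?_, h.shiftY_props, hm, hn,
    h.tendsto_shiftX hT₁c hT₁x, fun I hI => tendstoUniformlyOn_of_tendsto_prod continuous_const
      (h.tendsto_shiftY hT₁c hT₂c hT₂y) hI, fun K hK W hW => ?_, fun I K hI hK => ?_, ?_, ?_⟩
  · have := contDiff_affineHomeo (n := r) (SaddleScales.centre b k) (SaddleScales.frame b b' k)
      (h.frame_ne_zero k)
    have := trans_homeomorph_mem_maximalAtlas cQ.chart_mem (affineHomeo (SaddleScales.centre b k)
      (SaddleScales.frame b b' k) (h.frame_ne_zero k)).symm this.2 this.1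
    rw [OpenPartialHomeomorph.trans_symm_eq_symm_trans_symm, OpenPartialHomeomorph.symm_symm]
    exact this
  · refine eventually_atTop_forall_mem_compact hK fun w _ => ?_
    have h1 := h.tendsto_centre_add w
    have h2 : Tendsto cQ.chart.symm (𝓝 !₂[1, 0, 1]) (𝓝 (f^[N₂] Y)) := by
      have := (cQ.chart.continuousAt_symm hbt).tendsto
      rwa [← hcycle.fY_coord, cQ.chart.left_inv hbs, hcycle.fY_coord] at this
    filter_upwards [h1.eventually (cQ.chart.open_target.eventually_mem hbt),
      (h2.comp h1).eventually hW] with q h3 h4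
    refine ⟨?_, h4⟩
    rw [OpenPartialHomeomorph.trans_source]
    exact ⟨mem_univ _, h3⟩
  · have h1 := eventually_atTop_forall_mem_compact (hI.prod hK)
      (P := fun k p => (F (SaddleScales.shiftY T₁ T₂ a b c a' b' k p.1) (SaddleScales.shiftX T₁ a c b'
        c' k))^[N₂ + minimalPeriod f P * m k + N₁ + minimalPeriod f Q * n k] (cQ.chart.symm
          (SaddleScales.centre b k + diagMap (SaddleScales.frame b b' k) p.2)) ∈ cQ.chart.source)
      fun p _ => (hret p).mono fun q hq => hq.1
    filter_upwards [h1] with k hk s hs v hv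
    rw [OpenPartialHomeomorph.trans_target]
    exact ⟨hk (s, v) ⟨hs, hv⟩, mem_univ _⟩
  · refine tendstoCr_of_tendstoCrAt (hsc.add hRc) fun p => ?_
    have h1 : TendstoCrAt r (fun k (p : ℝ × E3) => SaddleScales.firstMap T₁ a b c a' b' c' k p.2)
        (fun p => R₁ p.2) p :=
      (hfirst p.2).comp (.of_contDiff contDiff_snd p) R₁.contDiff.contDiffAt contDiff_snd.contDiffAt
    have h2 := (hsecond (R₁ p.2)).comp (W' := fun p : ℝ × E3 => R₁ p.2) h1 hR₂c.contDiffAt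
      (R₁.contDiff.comp contDiff_snd).contDiffAt
    refine ((TendstoCrAt.of_contDiff hsc p).add h2 hsc.contDiffAt hRc.contDiffAt).congr ?_
    filter_upwards [hret p] with q hq
    refine Eq.trans ?_ (h.diagMap_frame_inv q.1 _ q.2.1)
    rw [← hq.2]
    rfl
  · obtain ⟨Θ, τ, hτ, hΘ⟩ := exists_conj_henonLike (b₁ := b₁) (b₃ := b₃) (b₄ := b₄) ha₂ ha₃ hb₂ hc₂
      hβ (show ξ / (γ₁ * a₃) * γ₁ = ξ / a₃ by field_simp)
    exact ⟨Θ, τ, hτ, fun s v => hΘ s v _ rfl⟩
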